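/- **Protocol $\Pi_{\rm CLC}$ (checkpointed longest chain).** Honest nodes re-broadcast all messages they receive. A node has *heard of a checkpoint* when it has a certificate for some chain $v$ (cert-votes for $v$, from one period of one iteration, of at least $2/3$ of all checkpointers); the checkpoint is the block exactly $k$-deep in $v$ (genesis if $v$ is too short). Each honest node holds a longest chain, among those it has received, that contains the last checkpoint it has heard of; ties are broken by the adversary. Honest and adversarial miners are elected at the points of independent Poisson processes of rates $(1-\beta)\lambda$ and $\beta\lambda$; an elected honest miner is online, extends the chain it holds and broadcasts the new block; at each adversarial election the adversary may mine one block on any parent. The checkpointers, of whom strictly fewer than $1/3$ are adversarial, run the following agreement protocol in iterations, each divided into periods ("quorum" means messages from at least $2/3$ of all checkpointers). The first period of the first iteration starts at time $0$; the first period of an iteration starts a time $e$ after a certificate of the preceding iteration is received; any later period starts when a quorum of next-votes for one value for the preceding period is received, that value (in a first period: $\bot$) being the starting value; a node never goes back. Every period has a leader, drawn by the oracle independently and uniformly among the (online) checkpointers. On a clock reset at the start of the period: (1) at $0$ the leader proposes the chain it holds if the period is the first or it has a quorum of next-votes for $\bot$ for the preceding period, and otherwise the $v\ne\bot$ with such a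 quorum; (2) at $2\Delta$, if the period is the first or a quorum of next-votes for $\bot$ for the preceding period was received, a node soft-votes a value $v$ that it received from the leader and that is *valid* (the block exactly $k$-deep in $v$ is a descendant of, or equal to, every earlier checkpoint known to the node, and lies in the chain the node held on entering the period) or has a quorum of next-votes for the preceding period; otherwise it soft-votes the $v\neq\bot$ with such a quorum; (3) from $2\Delta$ to $4\Delta$ it cert-votes a $v$ with a quorum of soft-votes; (4) at $4\Delta$ it next-votes the value it cert-voted; else $\bot$, if it has a quorum of next-votes for $\bot$ for the preceding period; else its starting value; (5) from $4\Delta$ on it next-votes any $v$ with a quorum of soft-votes, and next-votes $\bot$ if it has a quorum of next-votes for $\bot$ for the preceding period and has not cert-voted. A node halts the iteration when it has a certificate for it. **Confirmation rules.** $\Pi_{\rm fin}$: a node confirms all blocks up to the last checkpoint it has heard of. $\Pi_{\rm ada}$: a node confirms all but the last $k'$ blocks of the chain it holds; every node may choose its own $k'$. **Settings.** A message known to an honest node at time $s$ reaches every other honest node by time $\max(s,{\sf GST})+\Delta$, or, if that node is then offline, when it is next online. *Partially synchronous, sized*: ${\sf GST}\ge0$ is arbitrary and all nodes are always online. *Synchronous,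 unsized*: ${\sf GST}=0$, and the adversary decides when nodes go online and offline; offline nodes neither send nor receive. The adversary corrupts nodes before the start, controls corrupted nodes and the order of messages within these bounds, but cannot forge signatures of honest nodes. **Theorem 1.** Let $0\le\beta<1/2$ and $\lambda,\Delta>0$ be such that $\bar y>\lambda\Delta-\bar y$, where $\bar y=(1-\beta)\lambda\Delta e^{-3(1-\beta)\lambda\Delta}$ (for given $\beta,\Delta$ this holds for all small $\lambda$). Let $k=k(\kappa)=\Theta(\kappa)$; let $e=e(\kappa)>0$ with $e=\Omega(\sqrt\kappa)$ and $e=O(\kappa^{a})$ for some $a<1$; let $T_{\max}(\kappa)=O({\rm poly}(\kappa))$; and let $a_1>0$ and $a_2$ be real. There are constants $C,c,c'>0$ and a function $\nu$ negligible in $\kappa$, depending only on these data, such that for every $\kappa$, all sets of nodes, miners, checkpointers and corrupted nodes with strictly fewer than $1/3$ adversarial checkpointers, and every adversary: * *(Security of $\Pi_{\rm fin}$; partially synchronous, sized.)* During $[0,T_{\max}]$, $\Pi_{\rm fin}$ is always safe: a block once confirmed by an honest node remains confirmed by it, and all blocks confirmed by honest nodes lie on one chain. Except with probability at most $\nu(\kappa)$,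 it is live after time $C({\sf GST}+\kappa)$: for all $C({\sf GST}+\kappa)\le r\le s\le T_{\max}$, every honest node newly confirms at least $\lfloor c(s-r)-c'\kappa\rfloor$ honest blocks in $[r,s]$. * *(Security of $\Pi_{\rm ada}$; synchronous, unsized.)* Except with probability at most $\nu(\kappa)$, for all choices $a_1\kappa\le k'\le a_2\kappa$ of the nodes, $\Pi_{\rm ada}$ is safe during $[0,T_{\max}]$ in the same sense, and live: for all $0\le r\le s\le T_{\max}$, every honest node online at time $s$ newly confirms at least $\lfloor c(s-r)-c'\kappa\rfloor$ honest blocks in $[r,s]$. * *(Nested protocols.)* In all settings, at any time, the set of blocks confirmed by an honest node under $\Pi_{\rm ada}$ with $k'\le k$ contains the set of blocks that it confirms under $\Pi_{\rm fin}$. -/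

import Mathlib

open MeasureTheory ProbabilityTheory Filter Asymptotics
open scoped NNReal ENNReal

namespace CLC

/-! ### Blocks, chains, messages -/

/-- A block is identified by the instant at which it is mined and by whether its miner is honest.
Its position (its chain of ancestors) is recorded by the chain that ends in it. -/
structure Block where
  time : ℝ
  honest : Bool

/-- A chain, listed from its tip down; the genesis block is the empty list. As every block commits
to its parent, a block (with all of its ancestors) is the same thing as the chain ending in it, so
`b <:+ c` (list suffix) says that the block `b` is contained in the chain `c`, equivalently that
`b` is an ancestor of, or equal to, the tip of `c`. The length of the list is the height of the tip,
and `c.drop k` is the block that is exactly `k`-deep in `c` (genesis if the chain is too short). -/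
abbrev Chain := List Block

/-- The block at the tip of the chain was mined by an honest miner. -/
def HonestBlock (b : Chain) : Prop := ∃ (B : Block) (c : Chain), b = B :: c ∧ B.honest = true

/-- The four kinds of signed messages of the Byzantine agreement protocol. -/
inductive Kind
  | propose | soft | cert | next

/-- Messages: a chain, or a signed message of a given kind of a given sender for an iteration,
a period, and a value (a chain, or `none` for the empty value `⊥`). A message about a chain carries
that chain. -/
inductive Msg (Node : Type*)
  | chain (c : Chain)
  | signed (kind : Kind) (sender : Node) (iter per : ℕ) (value : Option Chain)

/-- The chain that a message carries, if any. -/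
def Msg.carried {Node : Type*} : Msg Node → Option Chain
  | .chain c => some c
  | .signed _ _ _ _ v => v

/-- The static data: maximal network delay `Δ`, inter-checkpoint interval `e`, checkpoint depth `k`,
the honest nodes (the others are corrupted by the adversary), the miners, the checkpointers. -/
structure Config (Node : Type*) where
  Δ : ℝ
  e : ℝ
  k : ℕ
  honest : Set Node
  miners : Set Node
  checkpointers : Finset Node

/-- The record of one run. Everything in it that the rules below leave open is chosen by the
adversary.
* `H`, `A`: the instants at which honest, respectively adversarial, miners are elected;
* `leader n p`: the leader of period `p` of iteration `n` (both are numbered from `0`);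
* `online i t`: node `i` is online at time `t`;
* `recv i m`: the time at which node `i` receives message `m` (`⊤` if never);
* `miner t`: the honest miner elected at `t ∈ H`, and `base t`: the chain that it extends;
* `advParent t`: the chain that the adversary extends at `t ∈ A`;
* `ckpt i t`, `held i t`: the last checkpoint block known to node `i`, and the chain that it holds;
* `softVal i n p`: the value that `i` soft-votes in period `p` of iteration `n` (if any);
* `startVal i n p`: its starting value for that period (`none` is `⊥`). -/
structure Execution (Node : Type*) where
  H : Set ℝ
  A : Set ℝ
  leader : ℕ → ℕ → Node
  online : Node → ℝ → Prop
  recv : Node → Msg Node → WithTop ℝ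
  miner : ℝ → Node
  base : ℝ → Chain
  advParent : ℝ → Chain
  ckpt : Node → ℝ → Chain
  held : Node → ℝ → Chain
  softVal : Node → ℕ → ℕ → Option Chain
  startVal : Node → ℕ → ℕ → Option Chain

section Rules

variable {Node : Type*} (cfg : Config Node) (ex : Execution Node)

/-! ### What exists and what a node knows -/

/-- Every block of the chain has been mined by time `t`: each is the unique block mined at an
election instant, on top of the parent fixed at that instant. -/
def Mined : ℝ → Chain → Prop
  | _, [] => True
  | t, b :: c => b.time ≤ t ∧ Mined b.time c ∧
      ((b.honest = true ∧ b.time ∈ ex.H ∧ c = ex.base b.time) ∨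
       (b.honest = false ∧ b.time ∈ ex.A ∧ c = ex.advParent b.time))

/-- Node `i` has received `m` by time `t`. -/
def Known (i : Node) (t : ℝ) (m : Msg Node) : Prop := ex.recv i m ≤ (t : WithTop ℝ)

/-- Node `i` has received the chain `c` by time `t`. -/
def KnownChain (i : Node) (t : ℝ) (c : Chain) : Prop :=
  c = [] ∨ ∃ m, Known ex i t m ∧ m.carried = some c

/-- By time `t`, node `i` has received messages of the given kind for `w`, for period `p` of
iteration `n`, from at least two thirds of all checkpointers. -/
def Quorum (i : Node) (t : ℝ) (kind : Kind) (n p : ℕ) (w : Option Chain) : Prop :=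
  ∃ Q : Finset Node, Q ⊆ cfg.checkpointers ∧ 2 * cfg.checkpointers.card ≤ 3 * Q.card ∧
    ∀ j ∈ Q, Known ex i t (.signed kind j n p w)

/-- Node `i` has received a certificate that iteration `n` ended with the chain `v`. -/
def HeardCert (i : Node) (t : ℝ) (n : ℕ) (v : Chain) : Prop :=
  ∃ p, Quorum cfg ex i t .cert n p (some v)

/-- `B` is the last checkpoint block that `i` has heard of by time `t`: the block exactly `k`-deep
in the chain certified in the latest iteration (genesis if there is none). -/
def IsLastCkpt (i : Node) (t : ℝ) (B : Chain) : Prop :=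
  ((∀ n v, ¬ HeardCert cfg ex i t n v) ∧ B = []) ∨
  ∃ n v, HeardCert cfg ex i t n v ∧ B = v.drop cfg.k ∧
    ∀ n' v', HeardCert cfg ex i t n' v' → n' ≤ n

/-- `c` is a longest chain of `K` among those containing the block `B`. -/
def IsLongest (K : Set Chain) (B c : Chain) : Prop :=
  c ∈ K ∧ B <:+ c ∧ ∀ d ∈ K, B <:+ d → d.length ≤ c.length

/-! ### The checkpointing protocol -/

/-- The period `(n', p')` comes after the period `(n, p)`. -/
def Later (n p n' p' : ℕ) : Prop := n < n' ∨ (n = n' ∧ p < p')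

/-- Period `p` is not the first one of its iteration, and node `i` has received a quorum of
next-votes for `w` for the period before. -/
def PrevNext (i : Node) (t : ℝ) (n p : ℕ) (w : Option Chain) : Prop :=
  ∃ q, p = q + 1 ∧ Quorum cfg ex i t .next n q w

/-- What is needed to start period `p` of iteration `n`. -/
def Ready (i : Node) (n p : ℕ) (t : ℝ) : Prop :=
  (n = 0 ∧ p = 0 ∧ 0 ≤ t) ∨
  (∃ m v s, n = m + 1 ∧ p = 0 ∧ HeardCert cfg ex i s m v ∧ s + cfg.e ≤ t) ∨
  ∃ w, PrevNext cfg ex i t n p w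

/-- Node `i` starts period `p` of iteration `n` at time `t`: it is then ready for it (and online)
for the first time, and has not moved to a later period or iteration. -/
def Starts (i : Node) (n p : ℕ) (t : ℝ) : Prop :=
  IsLeast {s | ex.online i s ∧ Ready cfg ex i n p s} t ∧
  ∀ n' p', Later n p n' p' → ∀ s ≤ t, ex.online i s → ¬ Ready cfg ex i n' p' s

/-- At time `t`, node `i` is online and works on period `p` of iteration `n`, which it started at
time `s` (so that its clock shows `t - s`): it has neither moved on nor halted the iteration
before `t`. -/
def Active (i : Node) (n p : ℕ) (s t : ℝ) : Prop :=
  Starts cfg ex i n p s ∧ s ≤ t ∧ ex.online i t ∧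
  (∀ n' p', Later n p n' p' → ∀ u < t, ex.online i u → ¬ Ready cfg ex i n' p' u) ∧
  ∀ v, ∀ u < t, ¬ HeardCert cfg ex i u n v

/-- The new value `v`, considered at time `t`, is valid for node `i`, which entered the period at
time `s`: the block exactly `k`-deep in `v` descends from all earlier checkpoints and lies in the
chain that `i` held when it entered the period. -/
def Valid (i : Node) (n : ℕ) (s t : ℝ) (v : Chain) : Prop :=
  (∀ m < n, ∀ u, HeardCert cfg ex i t m u → u.drop cfg.k <:+ v.drop cfg.k) ∧
  v.drop cfg.k <:+ ex.held i s

/-- The period is the first of its iteration, or the previous one is known to have a quorum of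
next-votes for `⊥`. -/
def Fresh (i : Node) (t : ℝ) (n p : ℕ) : Prop := p = 0 ∨ PrevNext cfg ex i t n p none

/-- Step 1 (clock `0`): the leader proposes its own chain, or the value with a quorum of next-votes
in the previous period. -/
def Proposes (i : Node) (n p : ℕ) (t : ℝ) (v : Chain) : Prop :=
  Active cfg ex i n p t t ∧ i = ex.leader n p ∧
  ((Fresh cfg ex i t n p ∧ v = ex.held i t) ∨
   (¬ Fresh cfg ex i t n p ∧ PrevNext cfg ex i t n p (some v)))

/-- The values that node `i` may soft-vote in Step 2, at time `t`, when it entered the period at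
time `s`. -/
def SoftCandidate (i : Node) (n p : ℕ) (s t : ℝ) (v : Chain) : Prop :=
  (Fresh cfg ex i t n p ∧ Known ex i t (.signed .propose (ex.leader n p) n p (some v)) ∧
    (Valid cfg ex i n s t v ∨ PrevNext cfg ex i t n p (some v))) ∨
  (¬ Fresh cfg ex i t n p ∧ PrevNext cfg ex i t n p (some v))

/-- Step 2 (clock `2Δ`): soft-vote. -/
def SoftVotes (i : Node) (n p : ℕ) (t : ℝ) (v : Chain) : Prop :=
  ∃ s, Active cfg ex i n p s t ∧ t = s + 2 * cfg.Δ ∧ ex.softVal i n p = some v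

/-- Step 3 (clock between `2Δ` and `4Δ`): cert-vote a value with a quorum of soft-votes. -/
def CertVotes (i : Node) (n p : ℕ) (t : ℝ) (v : Chain) : Prop :=
  ∃ s, Active cfg ex i n p s t ∧ s + 2 * cfg.Δ ≤ t ∧ t ≤ s + 4 * cfg.Δ ∧
    Quorum cfg ex i t .soft n p (some v)

/-- Node `i` has cert-voted `v` in this period by time `t`. -/
def Certified (i : Node) (n p : ℕ) (t : ℝ) (v : Chain) : Prop :=
  ∃ u ≤ t, CertVotes cfg ex i n p u v

/-- Step 4 (clock `4Δ`): the first finishing step. -/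
def NextVotesFirst (i : Node) (n p : ℕ) (t : ℝ) (w : Option Chain) : Prop :=
  ∃ s, Active cfg ex i n p s t ∧ t = s + 4 * cfg.Δ ∧
    ((∃ v, Certified cfg ex i n p t v ∧ w = some v) ∨
     ((∀ v, ¬ Certified cfg ex i n p t v) ∧ PrevNext cfg ex i t n p none ∧ w = none) ∨
     ((∀ v, ¬ Certified cfg ex i n p t v) ∧ ¬ PrevNext cfg ex i t n p none ∧
        w = ex.startVal i n p))

/-- Step 5 (clock from `4Δ` on): the second finishing step. -/
def NextVotesSecond (i : Node) (n p : ℕ) (t : ℝ) (w : Option Chain) : Prop :=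
  ∃ s, Active cfg ex i n p s t ∧ s + 4 * cfg.Δ ≤ t ∧
    ((∃ v, Quorum cfg ex i t .soft n p (some v) ∧ w = some v) ∨
     (PrevNext cfg ex i t n p none ∧ (∀ v, ¬ Certified cfg ex i n p t v) ∧ w = none))

/-- The honest node `i` broadcasts the message at time `t` as its author: a block that it mines, or,
if it is a checkpointer, one of the messages prescribed by the five steps. (A message whose
condition persists may be broadcast again; only the first time matters.) -/
def Sends (i : Node) (t : ℝ) : Msg Node → Prop
  | .chain c => t ∈ ex.H ∧ i = ex.miner t ∧ c = ⟨t, true⟩ :: ex.base t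
  | .signed kind j n p w => j = i ∧ i ∈ cfg.checkpointers ∧
      match kind with
      | .propose => ∃ v, w = some v ∧ Proposes cfg ex i n p t v
      | .soft => ∃ v, w = some v ∧ SoftVotes cfg ex i n p t v
      | .cert => ∃ v, w = some v ∧ CertVotes cfg ex i n p t v
      | .next => NextVotesFirst cfg ex i n p t w ∨ NextVotesSecond cfg ex i n p t w

/-- A message can be in circulation at time `t` only if the chain it carries has been mined and, when
its sender is honest, the sender has sent it. -/
def Authentic (t : ℝ) (m : Msg Node) : Prop :=
  (∀ c, m.carried = some c → Mined ex t c) ∧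
  ∀ kind j n p w, m = .signed kind j n p w → j ∈ cfg.honest → ∃ s ≤ t, Sends cfg ex j s m

/-! ### Executions of the protocol, and the network and participation models -/

/-- `ex` is an execution of the checkpointed longest chain protocol in which all messages between
honest nodes sent at time `s` arrive by `max s GST + Δ`. -/
structure Admissible (GST : ℝ) : Prop where
  /-- every node holds a longest known chain containing the last checkpoint it has heard of -/
  last_ckpt : ∀ i ∈ cfg.honest, ∀ t, IsLastCkpt cfg ex i t (ex.ckpt i t)
  holds : ∀ i ∈ cfg.honest, ∀ t, IsLongest {c | KnownChain ex i t c} (ex.ckpt i t) (ex.held i t)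
  /-- an elected honest miner is online and extends the chain held just before its new block -/
  mining : ∀ t ∈ ex.H, ex.miner t ∈ cfg.honest ∧ ex.miner t ∈ cfg.miners ∧
    ex.online (ex.miner t) t ∧
    IsLongest {c | KnownChain ex (ex.miner t) t c ∧ (⟨t, true⟩ : Block) ∉ c}
      (ex.ckpt (ex.miner t) t) (ex.base t)
  leader_mem : ∀ n p, ex.leader n p ∈ cfg.checkpointers
  /-- nodes receive messages only while online, and only authentic ones -/
  recv_online : ∀ i ∈ cfg.honest, ∀ m (t : ℝ), ex.recv i m = t → ex.online i t
  authentic : ∀ i ∈ cfg.honest, ∀ m (t : ℝ), ex.recv i m = t → Authentic cfg ex t m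
  /-- a node knows at once what it broadcasts -/
  own : ∀ i ∈ cfg.honest, ∀ m t, Sends cfg ex i t m → Known ex i t m
  /-- everything that an honest node knows is re-broadcast; it reaches every honest node within the
  delay bound, or as soon as that node is online again after it -/
  deliver : ∀ i ∈ cfg.honest, ∀ j ∈ cfg.honest, ∀ m (s : ℝ), ex.recv j m = s →
    ∀ t, max s GST + cfg.Δ ≤ t → ex.online i t → Known ex i t m
  /-- at clock `2Δ` a candidate is soft-voted, if there is one -/
  soft_some : ∀ i ∈ cfg.honest, ∀ n p s, Starts cfg ex i n p s → ∀ v, ex.softVal i n p = some v →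
    SoftCandidate cfg ex i n p s (s + 2 * cfg.Δ) v
  soft_none : ∀ i ∈ cfg.honest, ∀ n p s, Starts cfg ex i n p s → ex.softVal i n p = none →
    ∀ v, ¬ SoftCandidate cfg ex i n p s (s + 2 * cfg.Δ) v
  /-- the starting value is `⊥` in the first period of an iteration, and afterwards a value whose
  quorum of next-votes allowed the node to start the period -/
  start_zero : ∀ i ∈ cfg.honest, ∀ n, ex.startVal i n 0 = none
  start_succ : ∀ i ∈ cfg.honest, ∀ n p s, Starts cfg ex i n (p + 1) s →
    PrevNext cfg ex i s n (p + 1) (ex.startVal i n (p + 1))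

/-- The partially synchronous, sized setting (M1, U1) with a given global stabilization time: all
nodes are always online, and `L` are the leaders drawn by the oracle. -/
def PartialSyncSized (L : ℕ × ℕ → Node) (GST : ℝ) : Prop :=
  0 ≤ GST ∧ Admissible cfg ex GST ∧ (∀ i ∈ cfg.honest, ∀ t, 0 ≤ t → ex.online i t) ∧
  ∀ n p, ex.leader n p = L (n, p)

/-- The synchronous, unsized setting (M2, U2): message delays are bounded by `Δ` from the start, and
the adversary decides when each node is online. Nothing is asked of the leader choice. -/
def SyncUnsized : Prop := Admissible cfg ex 0

/-! ### The two confirmation rules; safety and liveness -/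

/-- Rule `C₁`: the blocks up to the last known checkpoint. -/
def confirmedFin (i : Node) (t : ℝ) : Set Chain := {b | b <:+ ex.ckpt i t}

/-- Rule `C₂`: all but the last `depth i` blocks of the chain held. -/
def confirmedAda (depth : Node → ℕ) (i : Node) (t : ℝ) : Set Chain :=
  {b | b <:+ (ex.held i t).drop (depth i)}

/-- Safety during `[0, T]`: a block once confirmed by an honest node remains confirmed by it, and the
blocks confirmed by honest nodes all lie on one chain. -/
def Safe (confirmed : Node → ℝ → Set Chain) (T : ℝ) : Prop :=
  (∀ i ∈ cfg.honest, ∀ r s, 0 ≤ r → r ≤ s → s ≤ T → confirmed i r ⊆ confirmed i s) ∧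
  ∀ i ∈ cfg.honest, ∀ j ∈ cfg.honest, ∀ r s, 0 ≤ r → r ≤ T → 0 ≤ s → s ≤ T →
    ∀ b ∈ confirmed i r, ∀ b' ∈ confirmed j s, b <:+ b' ∨ b' <:+ b

/-- Liveness during `[t₀, T]` with constants `c`, `c'`: at every honest node (that is online at
the end of the interval), the number of honest blocks newly confirmed in any interval `[r, s]` is
at least `⌊c (s - r) - c'⌋`. -/
def Live (confirmed : Node → ℝ → Set Chain) (t₀ T c c' : ℝ) : Prop :=
  ∀ i ∈ cfg.honest, ∀ r s, t₀ ≤ r → r ≤ s → s ≤ T → ex.online i s →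
    ⌊c * (s - r) - c'⌋ ≤
      (({b | b ∈ confirmed i s ∧ b ∉ confirmed i r ∧ HonestBlock b}.ncard : ℕ) : ℤ)

end Rules

/-! ### The oracle -/

/-- The number of elections in `(a, b]`. -/
noncomputable def count (S : Set ℝ) (a b : ℝ) : ℕ := (S ∩ Set.Ioc a b).ncard

/-- `S` is the random set of points of a homogeneous Poisson process on `(0, ∞)`. -/
structure IsPoisson {Ω : Type*} [MeasurableSpace Ω] (μ : Measure Ω) (rate : ℝ≥0)
    (S : Ω → Set ℝ) : Prop where
  pos : ∀ ω, ∀ t ∈ S ω, 0 < t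
  finite : ∀ ω t, (S ω ∩ Set.Iic t).Finite
  measurable : ∀ a b, Measurable fun ω => count (S ω) a b
  law : ∀ a b : ℝ, 0 ≤ a → a ≤ b →
    μ.map (fun ω => count (S ω) a b) = poissonMeasure (rate * (b - a).toNNReal)
  indep : ∀ t : ℕ → ℝ, 0 ≤ t 0 → Monotone t →
    iIndepFun (fun (n : ℕ) ω => count (S ω) (t n) (t (n + 1))) μ

/-- The oracle: honest and adversarial elections are independent Poisson processes of rates
`(1 - β) lam` and `β lam`; the leaders of the periods are independent and uniformly distributed
among the checkpointers. -/
structure IsOracle {Node Ω : Type*} [MeasurableSpace Ω] (cfg : Config Node) (β lam : ℝ)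
    (μ : Measure Ω) (H A : Ω → Set ℝ) (L : Ω → ℕ × ℕ → Node) : Prop where
  poisson_honest : IsPoisson μ ((1 - β) * lam).toNNReal H
  poisson_adv : IsPoisson μ (β * lam).toNNReal A
  indep_mining : IndepFun (fun ω (I : ℝ × ℝ) => count (H ω) I.1 I.2)
    (fun ω (I : ℝ × ℝ) => count (A ω) I.1 I.2) μ
  leader_mem : ∀ ω q, L ω q ∈ cfg.checkpointers
  leader_measurable : ∀ q j, MeasurableSet {ω | L ω q = j}
  leader_law : ∀ q, ∀ j ∈ cfg.checkpointers,
    μ {ω | L ω q = j} = ((cfg.checkpointers.card : ℝ≥0∞))⁻¹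
  leader_indep : iIndepFun (β := fun _ : ℕ × ℕ => Node) (m := fun _ => ⊤) (fun q ω => L ω q) μ

/-- The expected number of convergence opportunities per time slot of length `Δ`: slots with exactly
one honest block, whose two neighbours contain no honest block. -/
noncomputable def convergenceRate (β lam Δ : ℝ) : ℝ :=
  (1 - β) * lam * Δ * Real.exp (-3 * (1 - β) * lam * Δ)

end CLC

namespace CLC

/-! ### Mined chains -/

section Chains

variable {Node : Type*} {ex : Execution Node}

/-! All randomness is confined to an event defined by the oracle alone. Outside it the conclusions
hold for every execution, so the adversary's strategy never enters a probability estimate. Safety of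
the finality rule and nesting need no exceptional event.

Agreement. Any two quorums share an honest checkpointer (`exists_honest_inter`). Hence in one period
at most one chain gathers a quorum of soft-votes, and at most one a quorum of next-votes
(`SentQuorum.next_unique`). A certificate locks its value for the rest of the iteration
(`SentQuorum.lock`), so an iteration certifies one chain. Tracing that chain back to the period in
which it was new (`SentQuorum.origin`) reaches honest voters that found it valid; one of them
already knew the previous checkpoint (`HeardCert.extends_pred`). So checkpoints form a chain. For
nesting, a certified chain is itself a competitor in the longest chain rule, hence the held chain is
at least as long and the checkpoint at least `k`-deep in it.

Longest chain. A loner is an honest election alone in its slot and followed by an empty slot; loners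
are at least `Δ` apart. Where chains keep growing past them, marked loners have distinct heights
(`Climbing`). Two chains that fork must then exhibit an unmarked block at the height of nearly every
marked block since the last common one (`Climbing.fork`). In a typical run loners outnumber all
other blocks over long windows, so forks are short. The same count yields honest blocks on a chain
(`Climbing.quality`).

The difficulty is that a new checkpoint may force a node to abandon a longer chain. In the
synchronous setting this is excluded by induction on the iteration (`SyncRun.grows`). The new
checkpoint lies in a chain held by an honest voter. A chain held at least `Δ` before was known to
that voter and is no longer than the voter's chain. Any other chain shares a recent block with the
voter's chain and therefore contains the deep checkpoint too.

In the partially synchronous setting an old proposal may be certified late. But an iteration without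
certificate soon reaches an honest leader, and from then on a stale value can be certified only if
that leader holds it (`SizedRun.exists_holder`). So only loners shortly before a certificate are
lost, a small fraction of the drift because iterations are `e` apart (`FinRun.ncard_wasted_le`).
After a time of order `GST + κ` chains agree again, chains of honest leaders are valid, and
iterations keep ending. An honest leader of a first period gets a freshly held chain certified,
whose quality gives liveness (`FinRun.live`).

Probability. Lone slots at every other position are independent, so Hoeffding bounds their number
from below; Chernoff bounds for Poisson counts bound all elections from above. A leader is
adversarial with probability below 1/3, independently. Windows of order `κ`, leader delays `R` of
order `√κ` and `R'` of order `κ ^ (1 - a)` make a union bound over polynomially many events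
negligible. -/

theorem mined_cons {t : ℝ} {b : Block} {c : Chain} :
    Mined ex t (b :: c) ↔ b.time ≤ t ∧ Mined ex b.time c ∧
      ((b.honest = true ∧ b.time ∈ ex.H ∧ c = ex.base b.time) ∨
       (b.honest = false ∧ b.time ∈ ex.A ∧ c = ex.advParent b.time)) := by
  rw [Mined]

theorem Mined.mono {s t : ℝ} {c : Chain} (h : Mined ex s c) (hst : s ≤ t) : Mined ex t c := by
  cases c with
  | nil => simp [Mined]
  | cons b c =>
    rw [mined_cons] at h ⊢
    exact ⟨h.1.trans hst, h.2⟩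

theorem Mined.suffix {t : ℝ} {c d : Chain} (h : Mined ex t c) (hd : d <:+ c) : Mined ex t d := by
  induction c generalizing t with
  | nil => rw [List.suffix_nil.1 hd]; exact h
  | cons b c ih =>
    rcases List.suffix_cons_iff.1 hd with rfl | hd
    · exact h
    · rw [mined_cons] at h
      exact (ih h.2.1 hd).mono h.1

theorem Mined.time_le {t : ℝ} {c : Chain} (h : Mined ex t c) {b : Block} (hb : b ∈ c) :
    b.time ≤ t := by
  obtain ⟨l, l', rfl⟩ := List.append_of_mem hb
  have := h.suffix (List.suffix_append l (b :: l'))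
  rw [mined_cons] at this
  exact this.1

/-- The execution fixes one parent for each election instant and kind of miner. Thus a block
determines its whole chain and in particular its height, which makes the matchings by height below
injective. -/
theorem Mined.parent_eq {t t' : ℝ} {b : Block} {c c' : Chain} (h : Mined ex t (b :: c))
    (h' : Mined ex t' (b :: c')) : c = c' := by
  rw [mined_cons] at h h'
  rcases h.2.2 with h1 | h1 <;> rcases h'.2.2 with h2 | h2
  · rw [h1.2.2, h2.2.2]
  · simp [h1.1] at h2
  · simp [h1.1] at h2
  · rw [h1.2.2, h2.2.2]

theorem Mined.time_le_of_suffix {t : ℝ} {b₁ b₂ : Block} {c₁ c₂ : Chain}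
    (h : Mined ex t (b₂ :: c₂)) (hs : (b₁ :: c₁) <:+ (b₂ :: c₂)) : b₁.time ≤ b₂.time := by
  rcases List.suffix_cons_iff.1 hs with h1 | h1
  · simp only [List.cons.injEq] at h1
    rw [h1.1]
  · rw [mined_cons] at h
    exact h.2.1.time_le (h1.subset (by simp))

theorem Mined.nodup {t : ℝ} {c : Chain} (h : Mined ex t c) : c.Nodup := by
  induction c generalizing t with
  | nil => simp
  | cons b c ih =>
    have h' := mined_cons.1 h
    refine List.nodup_cons.2 ⟨fun hb => ?_, ih h'.2.1⟩
    obtain ⟨l, l', hl⟩ := List.append_of_mem hb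
    have h2 := h'.2.1.suffix (hl ▸ List.suffix_append l (b :: l'))
    have := congrArg List.length (h.parent_eq h2)
    rw [hl] at this
    simp at this
    omega

/-- The chain ending in the block mined by the honest miner elected at time `g`. -/
def blk (ex : Execution Node) (g : ℝ) : Chain := ⟨g, true⟩ :: ex.base g

theorem length_blk (g : ℝ) : (blk ex g).length = (ex.base g).length + 1 := by simp [blk]

theorem Mined.eq_blk {t : ℝ} {b : Block} {c : Chain} (h : Mined ex t (b :: c))
    (hb : b.honest = true) : b :: c = blk ex b.time := by
  have := mined_cons.1 h
  rcases this.2.2 with h1 | h1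
  · rw [blk, ← h1.2.2]; cases b; simp_all
  · simp [h1.1] at hb

theorem Mined.blk_time_le {t g : ℝ} {c : Chain} (h : Mined ex t c) (hg : blk ex g <:+ c) :
    g ≤ t :=
  h.time_le (b := ⟨g, true⟩) (hg.subset (by simp [blk]))

theorem Mined.le_time {t g : ℝ} {b : Block} {c : Chain} (h : Mined ex t (b :: c))
    (hs : blk ex g <:+ (b :: c)) : g ≤ b.time :=
  h.time_le_of_suffix (b₁ := ⟨g, true⟩) hs

theorem Mined.time_le_blk {t g : ℝ} {b : Block} {c : Chain} (h : Mined ex t (blk ex g))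
    (hs : (b :: c) <:+ blk ex g) : b.time ≤ g :=
  Mined.time_le_of_suffix (b₂ := ⟨g, true⟩) h hs

/-- The blocks that can have been mined during `[a, t]`. -/
def blocks (H A : Set ℝ) (a t : ℝ) : Set Block :=
  {b | a ≤ b.time ∧ b.time ≤ t ∧ ((b.honest = true ∧ b.time ∈ H) ∨ (b.honest = false ∧ b.time ∈ A))}

/-- A set of election times that is locally finite and positive. -/
structure Elections (S : Set ℝ) : Prop where
  pos : ∀ t ∈ S, 0 < t
  finite : ∀ t, (S ∩ Set.Iic t).Finite

theorem Elections.finite_Icc {S : Set ℝ} (h : Elections S) (a b : ℝ) :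
    (S ∩ Set.Icc a b).Finite :=
  (h.finite b).subset fun _ hx => ⟨hx.1, hx.2.2⟩

theorem blocks_subset_image (H A : Set ℝ) (a t : ℝ) : blocks H A a t ⊆
    (fun x => (⟨x, true⟩ : Block)) '' (H ∩ Set.Icc a t) ∪
    (fun x => (⟨x, false⟩ : Block)) '' (A ∩ Set.Icc a t) := by
  rintro ⟨x, f⟩ ⟨h1, h2, h3 | h3⟩
  · left; exact ⟨x, ⟨h3.2, h1, h2⟩, by simp_all⟩
  · right; exact ⟨x, ⟨h3.2, h1, h2⟩, by simp_all⟩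

theorem blocks_finite {H A : Set ℝ} (hH : Elections H) (hA : Elections A) (a t : ℝ) :
    (blocks H A a t).Finite :=
  (((hH.finite_Icc a t).image _).union ((hA.finite_Icc a t).image _)).subset
    (blocks_subset_image H A a t)

theorem ncard_blocks_le {H A : Set ℝ} (hH : Elections H) (hA : Elections A) (a t : ℝ) :
    (blocks H A a t).ncard ≤ (H ∩ Set.Icc a t).ncard + (A ∩ Set.Icc a t).ncard := by
  refine (Set.ncard_le_ncard (blocks_subset_image H A a t)
    (((hH.finite_Icc a t).image _).union ((hA.finite_Icc a t).image _))).trans ?_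
  exact (Set.ncard_union_le _ _).trans (add_le_add (Set.ncard_image_le (hH.finite_Icc a t))
    (Set.ncard_image_le (hA.finite_Icc a t)))

theorem blocks_mono {H A : Set ℝ} {a a' t t' : ℝ} (ha : a' ≤ a) (ht : t ≤ t') :
    blocks H A a t ⊆ blocks H A a' t' :=
  fun _ hb => ⟨ha.trans hb.1, hb.2.1.trans ht, hb.2.2⟩

theorem Mined.mem_blocks {t a : ℝ} {b : Block} {c : Chain} (h : Mined ex t c) (hb : b ∈ c)
    (ha : a ≤ b.time) : b ∈ blocks ex.H ex.A a t := by
  obtain ⟨l, l', rfl⟩ := List.append_of_mem hb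
  have h1 := mined_cons.1 (h.suffix (List.suffix_append l (b :: l')))
  exact ⟨ha, h1.1, h1.2.2.imp (fun h => ⟨h.1, h.2.1⟩) (fun h => ⟨h.1, h.2.1⟩)⟩

theorem Mined.time_pos {t : ℝ} {c : Chain} (hH : Elections ex.H) (hA : Elections ex.A)
    (h : Mined ex t c) {b : Block} (hb : b ∈ c) : 0 < b.time := by
  rcases (h.mem_blocks hb le_rfl).2.2 with h | h
  · exact hH.pos _ h.2
  · exact hA.pos _ h.2

theorem Mined.eq_nil_of_nonpos {t : ℝ} {c : Chain} (hH : Elections ex.H) (hA : Elections ex.A)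
    (h : Mined ex t c) (ht : t ≤ 0) : c = [] := by
  rcases c with _ | ⟨b, c⟩
  · rfl
  · have h1 := h.time_pos hH hA (b := b) (by simp)
    have h2 := h.time_le (b := b) (by simp)
    linarith

/-- The number of blocks of a mined chain above one of its blocks is at most the number of blocks
mined since. -/
theorem Mined.length_le {t a : ℝ} {c d : Chain} (hH : Elections ex.H) (hA : Elections ex.A)
    (h : Mined ex t c) (hd : d <:+ c)
    (ha : ∀ b c', (b :: c') <:+ c → d.length < (b :: c').length → a ≤ b.time) :
    c.length ≤ d.length + (blocks ex.H ex.A a t).ncard := by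
  classical
  obtain ⟨l, rfl⟩ := hd
  have hl : l.Nodup := h.nodup.of_append_left
  have hsub : (l.toFinset : Set Block) ⊆ blocks ex.H ex.A a t := by
    intro b hb
    have hb' : b ∈ l := by simpa using hb
    refine h.mem_blocks (by simp [hb']) ?_
    obtain ⟨l₁, l₂, rfl⟩ := List.append_of_mem hb'
    refine ha b (l₂ ++ d) ⟨l₁, by simp⟩ (by simp)
  have := Set.ncard_le_ncard hsub (blocks_finite hH hA a t)
  rw [Set.ncard_coe_finset, List.toFinset_card_of_nodup hl] at this
  simp
  omega

theorem Mined.length_le_blk {t g : ℝ} {c : Chain} (hH : Elections ex.H) (hA : Elections ex.A)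
    (h : Mined ex t c) (hd : blk ex g <:+ c) :
    c.length ≤ (blk ex g).length + (blocks ex.H ex.A g t).ncard := by
  refine h.length_le hH hA hd fun b c' hb hl => ?_
  have : blk ex g <:+ b :: c' := List.suffix_of_suffix_length_le hd hb hl.le
  exact (h.suffix hb).le_time this

/-! ### Heights of marked blocks, matchings, forks and chain quality -/

theorem exists_suffix_length {c : Chain} {n : ℕ} (h : n + 1 ≤ c.length) :
    ∃ b c', (b :: c') <:+ c ∧ (b :: c').length = n + 1 := by
  have h1 : (c.drop (c.length - (n + 1))).length = n + 1 := by simp; omega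
  rcases h2 : c.drop (c.length - (n + 1)) with _ | ⟨b, c'⟩
  · simp [h2] at h1
  · exact ⟨b, c', h2 ▸ List.drop_suffix _ _, h2 ▸ h1⟩

/-- Honest election times at which the mined blocks have strictly increasing heights. -/
structure Climbing (ex : Execution Node) (G : Set ℝ) : Prop where
  subset : G ⊆ ex.H
  lt : ∀ x ∈ G, ∀ y ∈ G, x < y → (blk ex x).length < (blk ex y).length

theorem Climbing.eq {G : Set ℝ} (hG : Climbing ex G) {x y : ℝ} (hx : x ∈ G) (hy : y ∈ G)
    (h : (blk ex x).length = (blk ex y).length) : x = y := by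
  rcases lt_trichotomy x y with h1 | h1 | h1
  · have := hG.lt x hx y hy h1; omega
  · exact h1
  · have := hG.lt y hy x hx h1; omega

/-- A block of the given set of election times. -/
def Marked (G : Set ℝ) (b : Block) : Prop := b.honest = true ∧ b.time ∈ G

/-- A block used for both `x` and `y` would have the heights of both marked blocks, and marked
heights are distinct. So choosing for each `x` an unmarked block of equal height is injective. -/
theorem Climbing.ncard_le_of_matching {G U : Set ℝ} {a t : ℝ} (hH : Elections ex.H)
    (hA : Elections ex.A) (hG : Climbing ex G) (hU : U ⊆ G)
    (h : ∀ x ∈ U, ∃ b c s, Mined ex s (b :: c) ∧ (b :: c).length = (blk ex x).length ∧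
      b ∈ blocks ex.H ex.A a t ∧ ¬ Marked G b) :
    U.ncard ≤ (blocks ex.H ex.A a t \ {b | Marked G b}).ncard := by
  have : Nonempty Block := ⟨⟨0, true⟩⟩
  choose! f c s hf using h
  refine Set.ncard_le_ncard_of_injOn f (fun x hx => ⟨(hf x hx).2.2.1, (hf x hx).2.2.2⟩) ?_
    ((blocks_finite hH hA a t).subset Set.sdiff_subset)
  intro x hx y hy hxy
  refine hG.eq (hU hx) (hU hy) ?_
  have h1 := hf x hx
  have h2 := hf y hy
  rw [← h1.2.1, ← h2.2.1]
  rw [← hxy] at h2 ⊢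
  rw [h1.1.parent_eq h2.1]

theorem Climbing.ncard_add_le {G : Set ℝ} {a t : ℝ} (hH : Elections ex.H)
    (hA : Elections ex.A) (hG : Climbing ex G) :
    (G ∩ Set.Icc a t).ncard + (blocks ex.H ex.A a t \ {b | Marked G b}).ncard
      ≤ (blocks ex.H ex.A a t).ncard := by
  have hfin := blocks_finite hH hA a t
  rw [← Set.ncard_inter_add_ncard_sdiff_eq_ncard (blocks ex.H ex.A a t) {b | Marked G b} hfin]
  gcongr
  refine Set.ncard_le_ncard_of_injOn (fun x => (⟨x, true⟩ : Block)) ?_ ?_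
    (hfin.subset Set.inter_subset_left)
  · intro x hx
    exact ⟨⟨hx.2.1, hx.2.2, Or.inl ⟨rfl, hG.subset hx.1⟩⟩, rfl, hx.1⟩
  · intro x _ y _ hxy
    simpa using hxy

theorem exists_last_of_finite {S : Set ℝ} (hS : S.Finite) (hpos : ∀ x ∈ S, 0 < x) :
    ∃ t, 0 ≤ t ∧ (t = 0 ∨ t ∈ S) ∧ ∀ x ∈ S, x ≤ t := by
  rcases S.eq_empty_or_nonempty with rfl | hne
  · exact ⟨0, le_rfl, Or.inl rfl, by simp⟩
  · obtain ⟨t, ht, h⟩ := Set.exists_max_image S id hS hne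
    exact ⟨t, (hpos t ht).le, Or.inr ht, h⟩

theorem exists_first_of_finite {S : Set ℝ} {s r : ℝ} (hS : S.Finite) (hsr : s ≤ r)
    (hlow : ∀ x ∈ S, s < x) (hup : ∀ x ∈ S, x ≤ r) :
    ∃ t, s ≤ t ∧ t ≤ r ∧ (t = r ∨ t ∈ S) ∧ ∀ x ∈ S, t ≤ x := by
  rcases S.eq_empty_or_nonempty with rfl | hne
  · exact ⟨r, hsr, le_rfl, Or.inl rfl, by simp⟩
  · obtain ⟨t, ht, h⟩ := Set.exists_min_image S id hS hne
    exact ⟨t, (hlow t ht).le, hup t ht, Or.inr ht, h⟩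

theorem Climbing.finite {G : Set ℝ} (hH : Elections ex.H) (hG : Climbing ex G) {S : Set ℝ}
    {t : ℝ} (hS : S ⊆ G) (ht : ∀ x ∈ S, x ≤ t) : S.Finite :=
  (hH.finite t).subset fun x hx => ⟨hG.subset (hS hx), ht x hx⟩

/-- A marked block of the height of `blk x` is `blk x`. -/
theorem Climbing.eq_blk {G : Set ℝ} (hG : Climbing ex G) {x t : ℝ} (hx : x ∈ G) {b : Block}
    {c : Chain} (h : Mined ex t (b :: c)) (hb : Marked G b)
    (hl : (b :: c).length = (blk ex x).length) : b :: c = blk ex x := by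
  have h1 := h.eq_blk hb.1
  rw [h1] at hl ⊢
  rw [hG.eq hb.2 hx hl]

/-- Two chains whose lengths dominate the heights of the marked blocks mined a delay before share
a recent marked block, unless marked blocks are outnumbered. -/
theorem Climbing.fork {G : Set ℝ} {Δ s r : ℝ} {c₁ c₂ : Chain} (hH : Elections ex.H)
    (hA : Elections ex.A) (hG : Climbing ex G) (hΔ : 0 < Δ) (hs0 : 0 ≤ s) (hsr : s ≤ r)
    (h₁ : Mined ex s c₁) (h₂ : Mined ex r c₂)
    (hl₁ : ∀ x ∈ G, x ≤ s - Δ → (blk ex x).length ≤ c₁.length)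
    (hl₂ : ∀ x ∈ G, x ≤ r - Δ → (blk ex x).length ≤ c₂.length) :
    ∃ t₀ t₁, 0 ≤ t₀ ∧ t₀ ≤ s ∧ s ≤ t₁ ∧ t₁ ≤ r ∧
      (t₀ = 0 ∨ (t₀ ∈ G ∧ blk ex t₀ <:+ c₁ ∧ blk ex t₀ <:+ c₂)) ∧
      2 * (G ∩ (Set.Ioc t₀ (s - Δ) ∪ Set.Ioc s (t₁ - Δ))).ncard
        ≤ (blocks ex.H ex.A t₀ t₁).ncard := by
  obtain ⟨t₀, ht₀, hc₀, hmax⟩ := exists_last_of_finite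
    (S := {g | g ∈ G ∧ blk ex g <:+ c₁ ∧ blk ex g <:+ c₂})
    (hG.finite hH (fun x hx => hx.1) (fun x hx => h₁.blk_time_le hx.2.1))
    (fun x hx => hH.pos _ (hG.subset hx.1))
  obtain ⟨t₁, hst₁, ht₁r, hc₁, hmin⟩ := exists_first_of_finite
    (S := {g | g ∈ G ∧ blk ex g <:+ c₂ ∧ s < g}) (r := r) (s := s)
    (hG.finite hH (fun x hx => hx.1) (fun x hx => h₂.blk_time_le hx.2.1)) hsr
    (fun x hx => hx.2.2) (fun x hx => h₂.blk_time_le hx.2.1)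
  have ht₀s : t₀ ≤ s := by
    rcases hc₀ with rfl | h
    · exact hs0
    · exact h₁.blk_time_le h.2.1
  refine ⟨t₀, t₁, ht₀, ht₀s, hst₁, ht₁r, hc₀, ?_⟩
  -- Marked blocks mined within `Δ` before `s` or `t₁` are left out: the chains need not have
  -- reached their heights yet.
  set U := G ∩ (Set.Ioc t₀ (s - Δ) ∪ Set.Ioc s (t₁ - Δ)) with hU
  have hUx : ∀ x ∈ U, t₀ < x ∧ x < t₁ ∧ x ≤ r - Δ := by
    rintro x ⟨_, hx | hx⟩
    · exact ⟨hx.1, by linarith [hx.2], by linarith [hx.2]⟩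
    · exact ⟨by linarith [hx.1], by linarith [hx.2], by linarith [hx.2]⟩
  -- The matched blocks lie above the common block of `t₀` and, on `c₂`, below the block of `t₁`.
  -- Ancestors are not mined later than descendants, so the matching stays inside the window from
  -- `t₀` to `t₁`.
  have low : ∀ (c : Chain) (t : ℝ) (b : Block) (c' : Chain) (x : ℝ), Mined ex t c →
      (t₀ ∈ G → blk ex t₀ <:+ c₁ → blk ex t₀ <:+ c₂ → blk ex t₀ <:+ c) → x ∈ U →
      (b :: c') <:+ c → (b :: c').length = (blk ex x).length → t₀ ≤ b.time := by
    intro c t b c' x hc hsuf hx hb hl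
    rcases hc₀ with h0 | h0
    · rw [h0]; exact (hc.time_pos hH hA (hb.subset (by simp))).le
    · have h1 := hsuf h0.1 h0.2.1 h0.2.2
      have h2 := hG.lt t₀ h0.1 x hx.1 (hUx x hx).1
      exact (hc.suffix hb).le_time
        (List.suffix_of_suffix_length_le h1 hb (by omega))
  have high : ∀ (b : Block) (c' : Chain) (x : ℝ), x ∈ U → (b :: c') <:+ c₂ →
      (b :: c').length = (blk ex x).length → b.time ≤ t₁ := by
    intro b c' x hx hb hl
    rcases hc₁ with h0 | h0
    · rw [h0]; exact h₂.time_le (hb.subset (by simp))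
    · have h2 := hG.lt x hx.1 t₁ h0.1 (hUx x hx).2.1
      exact (h₂.suffix h0.2.1).time_le_blk
        (List.suffix_of_suffix_length_le hb h0.2.1 (by omega))
  have key : U.ncard ≤ (blocks ex.H ex.A t₀ t₁ \ {b | Marked G b}).ncard := by
    refine hG.ncard_le_of_matching hH hA Set.inter_subset_left fun x hx => ?_
    have hx2 := hl₂ x hx.1 (hUx x hx).2.2
    rw [length_blk] at hx2
    obtain ⟨b₂, c₂', hb₂, hlb₂⟩ := exists_suffix_length hx2
    rw [← length_blk] at hlb₂
    have hm₂ := h₂.suffix hb₂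
    have fin₂ : ¬ Marked G b₂ → ∃ b c s, Mined ex s (b :: c) ∧
        (b :: c).length = (blk ex x).length ∧ b ∈ blocks ex.H ex.A t₀ t₁ ∧ ¬ Marked G b := by
      intro hn
      have hmem := h₂.mem_blocks (hb₂.subset (by simp))
        (low c₂ r b₂ c₂' x h₂ (fun _ _ h => h) hx hb₂ hlb₂)
      exact ⟨b₂, c₂', r, hm₂, hlb₂, ⟨hmem.1, high b₂ c₂' x hx hb₂ hlb₂, hmem.2.2⟩, hn⟩
    -- At the height of `blk ex x`, a marked block can only be `blk ex x` itself. For `x ≤ s - Δ` it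
    -- cannot lie on both chains by the choice of `t₀`; for `x > s` it cannot lie on `c₂` by the
    -- choice of `t₁`.
    by_cases hxs : x ≤ s - Δ
    · have hx1 := hl₁ x hx.1 hxs
      rw [length_blk] at hx1
      obtain ⟨b₁, c₁', hb₁, hlb₁⟩ := exists_suffix_length hx1
      rw [← length_blk] at hlb₁
      have hm₁ := h₁.suffix hb₁
      by_cases hM₁ : Marked G b₁
      · refine fin₂ fun hM₂ => ?_
        have e₁ := hG.eq_blk hx.1 hm₁ hM₁ hlb₁
        have e₂ := hG.eq_blk hx.1 hm₂ hM₂ hlb₂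
        have := hmax x ⟨hx.1, e₁ ▸ hb₁, e₂ ▸ hb₂⟩
        linarith [(hUx x hx).1]
      · have hmem := h₁.mem_blocks (hb₁.subset (by simp))
          (low c₁ s b₁ c₁' x h₁ (fun _ h _ => h) hx hb₁ hlb₁)
        exact ⟨b₁, c₁', s, hm₁, hlb₁, ⟨hmem.1, hmem.2.1.trans hst₁, hmem.2.2⟩, hM₁⟩
    · refine fin₂ fun hM₂ => ?_
      have e₂ := hG.eq_blk hx.1 hm₂ hM₂ hlb₂
      rcases hx.2 with h | h
      · exact hxs h.2
      · have := hmin x ⟨hx.1, e₂ ▸ hb₂, h.1⟩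
        linarith [(hUx x hx).2.1]
  have h2 := hG.ncard_add_le hH hA (a := t₀) (t := t₁)
  have h3 : U.ncard ≤ (G ∩ Set.Icc t₀ t₁).ncard :=
    Set.ncard_le_ncard (fun x hx => ⟨hx.1, (hUx x hx).1.le, (hUx x hx).2.1.le⟩)
      (hG.finite hH (t := t₁) Set.inter_subset_left fun x hx => hx.2.2)
  omega

/-- The marked blocks of a chain mined after a given time make up for the marked blocks by which
the chain had to grow, unless marked blocks are outnumbered. -/
theorem Climbing.quality {G : Set ℝ} {Δ s r : ℝ} {c : Chain} (hH : Elections ex.H)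
    (hA : Elections ex.A) (hG : Climbing ex G) (hΔ : 0 < Δ) (hr : 0 ≤ r)
    (h : Mined ex s c) (hl : ∀ x ∈ G, x ≤ s - Δ → (blk ex x).length ≤ c.length) :
    ∃ t₀, 0 ≤ t₀ ∧ t₀ ≤ r ∧
      2 * (G ∩ Set.Ioc t₀ (s - Δ)).ncard
        ≤ (blocks ex.H ex.A t₀ s).ncard + {g | g ∈ G ∧ blk ex g <:+ c ∧ r < g}.ncard := by
  obtain ⟨t₀, ht₀, hc₀, hmax⟩ := exists_last_of_finite
    (S := {g | g ∈ G ∧ blk ex g <:+ c ∧ g ≤ r})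
    (hG.finite hH (fun x hx => hx.1) (fun x hx => hx.2.2))
    (fun x hx => hH.pos _ (hG.subset hx.1))
  refine ⟨t₀, ht₀, ?_, ?_⟩
  · rcases hc₀ with rfl | h0
    · exact hr
    · exact h0.2.2
  -- A marked block of `U` on the chain must have been mined after `r`, by maximality of `t₀`, and
  -- is then counted in `V`. For every other element of `U` the chain has an unmarked block at that
  -- height.
  set U := G ∩ Set.Ioc t₀ (s - Δ) with hU
  set V := {g | g ∈ G ∧ blk ex g <:+ c ∧ r < g} with hV
  have hVfin : V.Finite := hG.finite hH (fun x hx => hx.1) (fun x hx => h.blk_time_le hx.2.1)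
  have hUfin : U.Finite := hG.finite hH (t := s - Δ) Set.inter_subset_left fun x hx => hx.2.2
  have key : (U \ V).ncard ≤ (blocks ex.H ex.A t₀ s \ {b | Marked G b}).ncard := by
    refine hG.ncard_le_of_matching hH hA (Set.sdiff_subset.trans Set.inter_subset_left)
      fun x hx => ?_
    have hx2 := hl x hx.1.1 hx.1.2.2
    rw [length_blk] at hx2
    obtain ⟨b, c', hb, hlb⟩ := exists_suffix_length hx2
    rw [← length_blk] at hlb
    have hm := h.suffix hb
    refine ⟨b, c', s, hm, hlb, h.mem_blocks (hb.subset (by simp)) ?_, fun hM => ?_⟩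
    · rcases hc₀ with h0 | h0
      · rw [h0]; exact (h.time_pos hH hA (hb.subset (by simp))).le
      · have h2 := hG.lt t₀ h0.1 x hx.1.1 hx.1.2.1
        exact hm.le_time
          (List.suffix_of_suffix_length_le h0.2.1 hb (by omega))
    · have e := hG.eq_blk hx.1.1 hm hM hlb
      by_cases hxr : x ≤ r
      · have := hmax x ⟨hx.1.1, e ▸ hb, hxr⟩
        linarith [hx.1.2.1]
      · exact hx.2 ⟨hx.1.1, e ▸ hb, lt_of_not_ge hxr⟩
  have h2 := hG.ncard_add_le hH hA (a := t₀) (t := s)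
  have h3 : U.ncard ≤ (G ∩ Set.Icc t₀ s).ncard :=
    Set.ncard_le_ncard (fun x hx => ⟨hx.1, hx.2.1.le, by linarith [hx.2.2]⟩)
      (hG.finite hH (t := s) Set.inter_subset_left fun x hx => hx.2.2)
  have h4 : U.ncard ≤ V.ncard + (U \ V).ncard := by
    rw [← Set.ncard_inter_add_ncard_sdiff_eq_ncard U V hUfin]
    exact Nat.add_le_add_right (Set.ncard_le_ncard Set.inter_subset_right hVfin) _
  omega

end Chains

/-! ### Separated sets, lone elections, typical runs -/

/-- Points at least `Δ` apart have different values of `⌊(x - a) / Δ⌋₊`. -/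
theorem ncard_le_of_separated {S : Set ℝ} {a b Δ : ℝ} (hΔ : 0 < Δ) (hab : a ≤ b)
    (hS : S ⊆ Set.Icc a b) (hsep : ∀ x ∈ S, ∀ y ∈ S, x < y → x + Δ ≤ y) :
    (S.ncard : ℝ) ≤ (b - a) / Δ + 1 := by
  have h0 : 0 ≤ (b - a) / Δ := div_nonneg (by linarith) hΔ.le
  have h : S.ncard ≤ (Finset.range (⌊(b - a) / Δ⌋₊ + 1) : Set ℕ).ncard := by
    refine Set.ncard_le_ncard_of_injOn (fun x => ⌊(x - a) / Δ⌋₊) ?_ ?_ (Finset.finite_toSet _)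
    · intro x hx
      simp only [Finset.coe_range, Set.mem_Iio]
      have : ⌊(x - a) / Δ⌋₊ ≤ ⌊(b - a) / Δ⌋₊ := by
        gcongr; exact (hS hx).2
      omega
    · have key : ∀ x ∈ S, ∀ y ∈ S, ⌊(x - a) / Δ⌋₊ = ⌊(y - a) / Δ⌋₊ → ¬ x < y := by
        intro x hx y hy hxy hlt
        have h1 := hsep x hx y hy hlt
        have h2 : 0 ≤ (x - a) / Δ := div_nonneg (by linarith [(hS hx).1]) hΔ.le
        have h3 : (x - a) / Δ + 1 ≤ (y - a) / Δ := by
          rw [div_add_one hΔ.ne']; gcongr; linarith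
        have h4 := Nat.lt_floor_add_one ((x - a) / Δ)
        have h5 := Nat.floor_le (h2.trans (by linarith : (x - a) / Δ ≤ (y - a) / Δ))
        have h6 : ⌊(x - a) / Δ⌋₊ + 1 ≤ ⌊(y - a) / Δ⌋₊ := by
          rw [← Nat.floor_add_one h2]; exact Nat.floor_le_floor h3
        omega
      intro x hx y hy hxy
      rcases lt_trichotomy x y with h1 | h1 | h1
      · exact absurd h1 (key x hx y hy hxy)
      · exact h1
      · exact absurd h1 (key y hy x hx hxy.symm)
  rw [Set.ncard_coe_finset, Finset.card_range] at h
  calc (S.ncard : ℝ) ≤ ((⌊(b - a) / Δ⌋₊ + 1 : ℕ) : ℝ) := by exact_mod_cast h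
    _ = (⌊(b - a) / Δ⌋₊ : ℝ) + 1 := by push_cast; ring
    _ ≤ _ := by gcongr; exact Nat.floor_le h0

/-- Election times that are alone in their time slot of length `Δ`, with no election in the next
slot. -/
def loners (H : Set ℝ) (Δ : ℝ) : Set ℝ :=
  {x | x ∈ H ∧ ∃ m : ℕ, m * Δ < x ∧ x ≤ (m + 1) * Δ ∧ count H (m * Δ) ((m + 1) * Δ) = 1 ∧
    count H ((m + 1) * Δ) ((m + 2) * Δ) = 0}

/-- The next election after a loner avoids the rest of its slot and the whole following slot. Hence,
in synchrony, the block of one loner has been delivered when the next loner occurs. -/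
theorem loners_separated {H : Set ℝ} {Δ : ℝ} (hH : Elections H) :
    ∀ x ∈ loners H Δ, ∀ y ∈ loners H Δ, x < y → x + Δ ≤ y := by
  rintro x ⟨hx, m, hmx, hxm, h1, h0⟩ y ⟨hy, -⟩ hxy
  have hfin : ∀ a b, (H ∩ Set.Ioc a b).Finite := fun a b =>
    (hH.finite b).subset fun _ h => ⟨h.1, h.2.2⟩
  by_contra hlt
  push Not at hlt
  rcases le_or_gt y ((m + 1) * Δ) with h | h
  · rw [count, Set.ncard_eq_one] at h1
    obtain ⟨z, hz⟩ := h1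
    have hxz : x ∈ ({z} : Set ℝ) := hz ▸ ⟨hx, hmx, hxm⟩
    have hyz : y ∈ ({z} : Set ℝ) := hz ▸ ⟨hy, hmx.trans hxy, h⟩
    simp only [Set.mem_singleton_iff] at hxz hyz
    linarith
  · rw [count, Set.ncard_eq_zero (hfin _ _)] at h0
    have : y ∈ (∅ : Set ℝ) := h0 ▸ ⟨hy, h, by nlinarith⟩
    exact this

/-- A run of the two mining processes in which loners outnumber all other blocks over long
intervals, and in which not too many blocks are mined. -/
structure Typical (H A : Set ℝ) (Δ δ r q T : ℝ) : Prop where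
  honest : Elections H
  adv : Elections A
  drift : ∀ a b, 0 ≤ a → a ≤ b → b ≤ T →
    ((blocks H A a b).ncard : ℝ) + δ * (b - a) ≤ 2 * (loners H Δ ∩ Set.Ioc a b).ncard + q
  total : ∀ a b, 0 ≤ a → a ≤ b → b ≤ T → ((blocks H A a b).ncard : ℝ) ≤ r * (b - a) + q

/-! ### Knowledge -/

section Agreement

variable {Node : Type*} {cfg : Config Node} {ex : Execution Node} {GST : ℝ}

theorem known_iff {i : Node} {t : ℝ} {m : Msg Node} :
    Known ex i t m ↔ ∃ r : ℝ, ex.recv i m = r ∧ r ≤ t := by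
  unfold Known
  constructor
  · intro h
    obtain ⟨r, hr⟩ := WithTop.ne_top_iff_exists.1 (ne_top_of_le_ne_top WithTop.coe_ne_top h)
    refine ⟨r, hr.symm, ?_⟩
    rw [← hr] at h
    exact WithTop.coe_le_coe.1 h
  · rintro ⟨r, hr, h⟩
    rw [hr]
    exact WithTop.coe_le_coe.2 h

theorem Known.mono {i : Node} {s t : ℝ} {m : Msg Node} (h : Known ex i s m) (hst : s ≤ t) :
    Known ex i t m :=
  le_trans (show ex.recv i m ≤ s from h) (WithTop.coe_le_coe.2 hst)

theorem KnownChain.mono {i : Node} {s t : ℝ} {c : Chain} (h : KnownChain ex i s c)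
    (hst : s ≤ t) : KnownChain ex i t c :=
  h.imp_right fun ⟨m, hm, hc⟩ => ⟨m, hm.mono hst, hc⟩

theorem Quorum.mono {i : Node} {s t : ℝ} {kind : Kind} {n p : ℕ} {w : Option Chain}
    (h : Quorum cfg ex i s kind n p w) (hst : s ≤ t) : Quorum cfg ex i t kind n p w := by
  obtain ⟨Q, h1, h2, h3⟩ := h
  exact ⟨Q, h1, h2, fun j hj => (h3 j hj).mono hst⟩

theorem HeardCert.mono {i : Node} {s t : ℝ} {n : ℕ} {v : Chain}
    (h : HeardCert cfg ex i s n v) (hst : s ≤ t) : HeardCert cfg ex i t n v :=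
  h.imp fun _ hp => hp.mono hst

theorem PrevNext.mono {i : Node} {s t : ℝ} {n p : ℕ} {w : Option Chain}
    (h : PrevNext cfg ex i s n p w) (hst : s ≤ t) : PrevNext cfg ex i t n p w :=
  h.imp fun _ hp => ⟨hp.1, hp.2.mono hst⟩

theorem Ready.mono {i : Node} {s t : ℝ} {n p : ℕ}
    (h : Ready cfg ex i n p s) (hst : s ≤ t) : Ready cfg ex i n p t := by
  rcases h with h | ⟨m, v, u, h1, h2, h3, h4⟩ | ⟨w, h⟩
  · exact Or.inl ⟨h.1, h.2.1, h.2.2.trans hst⟩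
  · exact Or.inr (Or.inl ⟨m, v, u, h1, h2, h3, h4.trans hst⟩)
  · exact Or.inr (Or.inr ⟨w, h.mono hst⟩)

theorem prevNext_succ {i : Node} {t : ℝ} {n p : ℕ} {w : Option Chain} :
    PrevNext cfg ex i t n (p + 1) w ↔ Quorum cfg ex i t .next n p w := by
  constructor
  · rintro ⟨q, hq, h⟩
    obtain rfl : p = q := by omega
    exact h
  · exact fun h => ⟨p, rfl, h⟩

theorem not_prevNext_zero {i : Node} {t : ℝ} {n : ℕ} {w : Option Chain} :
    ¬ PrevNext cfg ex i t n 0 w := by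
  rintro ⟨q, hq, -⟩
  omega

theorem ready_succ {i : Node} {t : ℝ} {n p : ℕ} :
    Ready cfg ex i n (p + 1) t ↔ ∃ w, Quorum cfg ex i t .next n p w := by
  constructor
  · rintro (h | ⟨m, v, u, h1, h2, h3, h4⟩ | ⟨w, h⟩)
    · simp at h
    · simp at h2
    · exact ⟨w, prevNext_succ.1 h⟩
  · rintro ⟨w, h⟩
    exact Or.inr (Or.inr ⟨w, prevNext_succ.2 h⟩)

theorem ready_zero_succ {i : Node} {t : ℝ} {n : ℕ} :
    Ready cfg ex i (n + 1) 0 t ↔ ∃ v s, HeardCert cfg ex i s n v ∧ s + cfg.e ≤ t := by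
  constructor
  · rintro (h | ⟨m, v, u, h1, h2, h3, h4⟩ | ⟨w, h⟩)
    · simp at h
    · obtain rfl : n = m := by omega
      exact ⟨v, u, h3, h4⟩
    · exact absurd h not_prevNext_zero
  · rintro ⟨v, s, h⟩
    exact Or.inr (Or.inl ⟨n, v, s, rfl, rfl, h⟩)

theorem ready_zero_zero {i : Node} {t : ℝ} : Ready cfg ex i 0 0 t ↔ 0 ≤ t := by
  constructor
  · rintro (h | ⟨m, v, u, h1, h2, h3, h4⟩ | ⟨w, h⟩)
    · exact h.2.2
    · simp at h1
    · exact absurd h not_prevNext_zero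
  · exact fun h => Or.inl ⟨rfl, rfl, h⟩

theorem Starts.eq {i : Node} {n p : ℕ} {s t : ℝ} (h : Starts cfg ex i n p s)
    (h' : Starts cfg ex i n p t) : s = t :=
  h.1.unique h'.1

theorem Starts.ready {i : Node} {n p : ℕ} {s : ℝ} (h : Starts cfg ex i n p s) :
    Ready cfg ex i n p s :=
  h.1.1.2

theorem Starts.online {i : Node} {n p : ℕ} {s : ℝ} (h : Starts cfg ex i n p s) :
    ex.online i s :=
  h.1.1.1

/-! ### Quorums of sent messages -/

/-- At least two thirds of all checkpointers are such that the honest ones among them have sent the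
given message by time `t`. -/
def SentQuorum (cfg : Config Node) (ex : Execution Node) (t : ℝ) (kind : Kind) (n p : ℕ)
    (w : Option Chain) : Prop :=
  ∃ Q : Finset Node, Q ⊆ cfg.checkpointers ∧ 2 * cfg.checkpointers.card ≤ 3 * Q.card ∧
    ∀ j ∈ Q, j ∈ cfg.honest → ∃ s ≤ t, Sends cfg ex j s (.signed kind j n p w)

theorem SentQuorum.mono {s t : ℝ} {kind : Kind} {n p : ℕ} {w : Option Chain}
    (h : SentQuorum cfg ex s kind n p w) (hst : s ≤ t) : SentQuorum cfg ex t kind n p w := by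
  obtain ⟨Q, h1, h2, h3⟩ := h
  exact ⟨Q, h1, h2, fun j hj hh => (h3 j hj hh).imp fun _ hu => ⟨hu.1.trans hst, hu.2⟩⟩

theorem Quorum.sent {i : Node} {t : ℝ} {kind : Kind} {n p : ℕ} {w : Option Chain}
    (hadm : Admissible cfg ex GST) (hi : i ∈ cfg.honest) (h : Quorum cfg ex i t kind n p w) :
    SentQuorum cfg ex t kind n p w := by
  obtain ⟨Q, h1, h2, h3⟩ := h
  refine ⟨Q, h1, h2, fun j hj hh => ?_⟩
  obtain ⟨r, hr, hrt⟩ := known_iff.1 (h3 j hj)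
  obtain ⟨s, hs, hsend⟩ := (hadm.authentic i hi _ r hr).2 kind j n p w rfl hh
  exact ⟨s, hs.trans hrt, hsend⟩

/-- Strictly fewer than one third of the checkpointers are adversarial. -/
def HonestTwoThirds (cfg : Config Node) : Prop :=
  3 * {i | i ∈ cfg.checkpointers ∧ i ∉ cfg.honest}.ncard < cfg.checkpointers.card

/-- The honest checkpointers. -/
noncomputable def honestCkpt (cfg : Config Node) : Finset Node :=
  open Classical in cfg.checkpointers.filter (· ∈ cfg.honest)

theorem mem_honestCkpt {i : Node} :
    i ∈ honestCkpt cfg ↔ i ∈ cfg.checkpointers ∧ i ∈ cfg.honest := by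
  simp [honestCkpt]

theorem honestCkpt_card (h : HonestTwoThirds cfg) :
    2 * cfg.checkpointers.card < 3 * (honestCkpt cfg).card := by
  classical
  unfold HonestTwoThirds at h
  have h1 : {i | i ∈ cfg.checkpointers ∧ i ∉ cfg.honest} =
      ((cfg.checkpointers.filter (· ∉ cfg.honest) : Finset Node) : Set Node) := by
    ext; simp
  rw [h1, Set.ncard_coe_finset] at h
  have h2 := Finset.card_filter_add_card_filter_not (s := cfg.checkpointers) (· ∈ cfg.honest)
  have h3 : (honestCkpt cfg).card = (cfg.checkpointers.filter (· ∈ cfg.honest)).card := by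
    unfold honestCkpt; congr
  omega

/-- Two quorums meet in at least a third of all checkpointers, and fewer than a third are
adversarial. -/
theorem exists_honest_inter (h : HonestTwoThirds cfg) {Q Q' : Finset Node}
    (hQ : Q ⊆ cfg.checkpointers) (hQ' : Q' ⊆ cfg.checkpointers)
    (hc : 2 * cfg.checkpointers.card ≤ 3 * Q.card)
    (hc' : 2 * cfg.checkpointers.card ≤ 3 * Q'.card) :
    ∃ j ∈ Q, j ∈ Q' ∧ j ∈ cfg.honest ∧ j ∈ cfg.checkpointers := by
  classical
  by_contra hno
  push Not at hno
  have h1 := honestCkpt_card h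
  have h2 : Disjoint (Q ∩ Q') (honestCkpt cfg) := by
    rw [Finset.disjoint_left]
    intro j hj hh
    rw [Finset.mem_inter] at hj
    rw [mem_honestCkpt] at hh
    exact hno j hj.1 hj.2 hh.2 hh.1
  have h3 := Finset.card_union_add_card_inter Q Q'
  have h4 : (Q ∪ Q').card ≤ cfg.checkpointers.card := Finset.card_le_card (Finset.union_subset hQ hQ')
  have h5 : ((Q ∩ Q') ∪ honestCkpt cfg).card ≤ cfg.checkpointers.card :=
    Finset.card_le_card (Finset.union_subset (Finset.inter_subset_left.trans hQ)
      (fun j hj => (mem_honestCkpt.1 hj).1))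
  rw [Finset.card_union_of_disjoint h2] at h5
  omega

theorem SentQuorum.inter (h : HonestTwoThirds cfg) {t t' : ℝ} {kind kind' : Kind}
    {n p n' p' : ℕ} {w w' : Option Chain} (hq : SentQuorum cfg ex t kind n p w)
    (hq' : SentQuorum cfg ex t' kind' n' p' w') :
    ∃ j ∈ cfg.honest, j ∈ cfg.checkpointers ∧
      (∃ s ≤ t, Sends cfg ex j s (.signed kind j n p w)) ∧
      (∃ s ≤ t', Sends cfg ex j s (.signed kind' j n' p' w')) := by
  obtain ⟨Q, h1, h2, h3⟩ := hq
  obtain ⟨Q', h1', h2', h3'⟩ := hq'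
  obtain ⟨j, hj, hj', hh, hc⟩ := exists_honest_inter h h1 h1' h2 h2'
  exact ⟨j, hh, hc, h3 j hj hh, h3' j hj' hh⟩

theorem SentQuorum.honest (h : HonestTwoThirds cfg) {t : ℝ} {kind : Kind}
    {n p : ℕ} {w : Option Chain} (hq : SentQuorum cfg ex t kind n p w) :
    ∃ j ∈ cfg.honest, j ∈ cfg.checkpointers ∧
      ∃ s ≤ t, Sends cfg ex j s (.signed kind j n p w) := by
  obtain ⟨j, hh, hc, h1, -⟩ := hq.inter h hq
  exact ⟨j, hh, hc, h1⟩

theorem sends_soft {j : Node} {s : ℝ} {n p : ℕ} {w : Option Chain}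
    (h : Sends cfg ex j s (.signed .soft j n p w)) :
    ∃ v, w = some v ∧ SoftVotes cfg ex j n p s v :=
  h.2.2

theorem sends_cert {j : Node} {s : ℝ} {n p : ℕ} {w : Option Chain}
    (h : Sends cfg ex j s (.signed .cert j n p w)) :
    ∃ v, w = some v ∧ CertVotes cfg ex j n p s v :=
  h.2.2

theorem sends_next {j : Node} {s : ℝ} {n p : ℕ} {w : Option Chain}
    (h : Sends cfg ex j s (.signed .next j n p w)) :
    ∃ s₀, Active cfg ex j n p s₀ s ∧ s₀ + 4 * cfg.Δ ≤ s ∧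
      ((∃ v, w = some v ∧ Quorum cfg ex j s .soft n p (some v)) ∨
       (w = none ∧ PrevNext cfg ex j s n p none ∧ ∀ v, ¬ Certified cfg ex j n p s v) ∨
       (w = ex.startVal j n p ∧ ¬ PrevNext cfg ex j (s₀ + 4 * cfg.Δ) n p none ∧
          ∀ v, ¬ Certified cfg ex j n p (s₀ + 4 * cfg.Δ) v)) := by
  rcases h.2.2 with ⟨s₀, hA, hs, h1⟩ | ⟨s₀, hA, hs, h1⟩
  · refine ⟨s₀, hA, hs.ge, ?_⟩
    rcases h1 with ⟨v, ⟨u, hu, _, _, _, _, hq⟩, hw⟩ | ⟨h2, h3, h4⟩ | ⟨h2, h3, h4⟩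
    · exact Or.inl ⟨v, hw, hq.mono hu⟩
    · exact Or.inr (Or.inl ⟨h4, h3, h2⟩)
    · exact Or.inr (Or.inr ⟨h4, hs ▸ h3, hs ▸ h2⟩)
  · refine ⟨s₀, hA, hs, ?_⟩
    rcases h1 with ⟨v, hq, hw⟩ | ⟨h2, h3, h4⟩
    · exact Or.inl ⟨v, hw, hq⟩
    · exact Or.inr (Or.inl ⟨h4, h2, h3⟩)

/-! ### Agreement -/

/-- An honest node in both quorums has only one value `softVal` for the period. -/
theorem SentQuorum.soft_unique (h : HonestTwoThirds cfg) {t t' : ℝ} {n p : ℕ} {v v' : Chain}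
    (hq : SentQuorum cfg ex t .soft n p (some v))
    (hq' : SentQuorum cfg ex t' .soft n p (some v')) : v = v' := by
  obtain ⟨j, -, -, ⟨s, -, h1⟩, ⟨s', -, h2⟩⟩ := hq.inter h hq'
  obtain ⟨x, hx, _, _, _, h3⟩ := sends_soft h1
  obtain ⟨x', hx', _, _, _, h4⟩ := sends_soft h2
  rw [h3] at h4
  simp_all

theorem startVal_sent (hadm : Admissible cfg ex GST) {j : Node} (hj : j ∈ cfg.honest) {n p : ℕ}
    {s : ℝ} (hs : Starts cfg ex j n p s) {v : Chain} (hv : ex.startVal j n p = some v) :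
    ∃ q, p = q + 1 ∧ Quorum cfg ex j s .next n q (some v) := by
  cases p with
  | zero => rw [hadm.start_zero j hj] at hv; simp at hv
  | succ q =>
    have := hadm.start_succ j hj n q s hs
    rw [hv, prevNext_succ] at this
    exact ⟨q, rfl, this⟩

theorem SentQuorum.next_unique (hadm : Admissible cfg ex GST) (h : HonestTwoThirds cfg)
    (hΔ : 0 < cfg.Δ) {n p : ℕ} :
    ∀ {t t' : ℝ} {v v' : Chain}, SentQuorum cfg ex t .next n p (some v) →
      SentQuorum cfg ex t' .next n p (some v') → v = v' := by
  induction p with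
  | zero =>
    have key : ∀ {t : ℝ} {v : Chain}, SentQuorum cfg ex t .next n 0 (some v) →
        ∃ u, SentQuorum cfg ex u .soft n 0 (some v) := by
      intro t v hq
      obtain ⟨j, hj, -, s, -, hs⟩ := hq.honest h
      obtain ⟨s₀, -, -, ⟨x, hx, hx2⟩ | ⟨hx, -⟩ | ⟨hx, -⟩⟩ := sends_next hs
      · exact ⟨s, by simpa [hx] using hx2.sent hadm hj⟩
      · simp at hx
      · rw [hadm.start_zero j hj] at hx; simp at hx
    intro t t' v v' hq hq'
    obtain ⟨u, hu⟩ := key hq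
    obtain ⟨u', hu'⟩ := key hq'
    exact hu.soft_unique h hu'
  | succ p ih =>
    -- Consider an honest node that soft-voted `v'` and next-voted its starting value `v`. It had no
    -- quorum for `⊥` at clock `4Δ`, hence none at `2Δ`, so its soft-vote too was for a value with a
    -- previous quorum of next-votes. The induction hypothesis identifies the two.
    have mixed : ∀ {t t' : ℝ} {v v' : Chain}, SentQuorum cfg ex t .next n (p + 1) (some v) →
        SentQuorum cfg ex t' .soft n (p + 1) (some v') → v = v' := by
      intro t t' v v' hq hq'
      obtain ⟨j, hj, -, ⟨s, -, h1⟩, ⟨s', -, h2⟩⟩ := hq.inter h hq'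
      obtain ⟨s₀, hA, -, ⟨x, hx, hx2⟩ | ⟨hx, -⟩ | ⟨hx, hnp, -⟩⟩ := sends_next h1
      · have := (hx2.sent hadm hj).soft_unique h hq'
        simp_all
      · simp at hx
      · obtain ⟨q, hq1, hq2⟩ := startVal_sent hadm hj hA.1 hx.symm
        obtain rfl : p = q := by omega
        obtain ⟨y, hy, s₁, hA₁, hs₁, hsv⟩ := sends_soft h2
        obtain rfl := hA.1.eq hA₁.1
        have hc := hadm.soft_some j hj n (p + 1) s₀ hA.1 y hsv
        have hy' : v' = y := by simpa using hy
        subst hy'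
        rcases hc with ⟨hf, -⟩ | ⟨-, hp⟩
        · rcases hf with hf | hf
          · simp at hf
          · exact absurd (hf.mono (by linarith)) hnp
        · exact ih (hq2.sent hadm hj) ((prevNext_succ.1 hp).sent hadm hj)
    intro t t' v v' hq hq'
    obtain ⟨j, hj, -, ⟨s, -, h1⟩, ⟨s', -, h2⟩⟩ := hq.inter h hq'
    obtain ⟨s₀, hA, -, ⟨x, hx, hx2⟩ | ⟨hx, -⟩ | ⟨hx, -, -⟩⟩ := sends_next h1
    · simp only [Option.some.injEq] at hx
      subst hx
      exact (mixed hq' (hx2.sent hadm hj)).symm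
    · simp at hx
    · obtain ⟨s₀', hA', -, ⟨x', hx', hx2'⟩ | ⟨hx', -⟩ | ⟨hx', -, -⟩⟩ := sends_next h2
      · simp only [Option.some.injEq] at hx'
        subst hx'
        exact mixed hq (hx2'.sent hadm hj)
      · simp at hx'
      · rw [← hx'] at hx
        simpa using hx

theorem SentQuorum.cert_soft (hadm : Admissible cfg ex GST) (h : HonestTwoThirds cfg) {t : ℝ}
    {n p : ℕ} {v : Chain} (hq : SentQuorum cfg ex t .cert n p (some v)) :
    SentQuorum cfg ex t .soft n p (some v) := by
  obtain ⟨j, hj, -, s, hs, h1⟩ := hq.honest h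
  obtain ⟨x, hx, _, _, _, _, h2⟩ := sends_cert h1
  simp only [Option.some.injEq] at hx
  subst hx
  exact (h2.sent hadm hj).mono hs

/-- If only `v` has quorums of next-votes in period `q`, then no honest node is fresh in the next
period, and all that soft-vote must vote `v`. -/
theorem soft_eq_of_locked (hadm : Admissible cfg ex GST) (h : HonestTwoThirds cfg)
    {n q : ℕ} {v : Chain} (hlock : ∀ t w, SentQuorum cfg ex t .next n q w → w = some v)
    {t : ℝ} {v' : Chain} (hq : SentQuorum cfg ex t .soft n (q + 1) (some v')) : v' = v := by
  obtain ⟨j, hj, -, s, -, h1⟩ := hq.honest h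
  obtain ⟨y, hy, s₁, hA₁, hs₁, hsv⟩ := sends_soft h1
  simp only [Option.some.injEq] at hy
  subst hy
  rcases hadm.soft_some j hj n (q + 1) s₁ hA₁.1 _ hsv with ⟨hf, -⟩ | ⟨-, hp⟩
  · rcases hf with hf | hf
    · simp at hf
    · have := hlock _ _ ((prevNext_succ.1 hf).sent hadm hj)
      simp at this
  · simpa using hlock _ _ ((prevNext_succ.1 hp).sent hadm hj)

/-- After a certificate, only its value gathers quorums of next-votes. -/
theorem SentQuorum.lock (hadm : Admissible cfg ex GST) (h : HonestTwoThirds cfg) {t : ℝ}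
    {n p : ℕ} {v : Chain} (hc : SentQuorum cfg ex t .cert n p (some v)) {q : ℕ} (hpq : p ≤ q) :
    ∀ t' w, SentQuorum cfg ex t' .next n q w → w = some v := by
  induction q, hpq using Nat.le_induction with
  | base =>
    intro t' w hq
    obtain ⟨j, hj, -, ⟨s, -, h1⟩, ⟨s', -, h2⟩⟩ := hc.inter h hq
    obtain ⟨x, hx, u, hA, hu1, hu2, hsoft⟩ := sends_cert h1
    simp only [Option.some.injEq] at hx
    subst hx
    obtain ⟨s₀, hA', hs', ⟨x, hx, hx2⟩ | ⟨-, -, hx⟩ | ⟨-, -, hx⟩⟩ := sends_next h2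
    · rw [hx, (hx2.sent hadm hj).soft_unique h (hsoft.sent hadm hj)]
    -- Cert-votes are cast up to clock `4Δ` and next-votes from `4Δ` on. A node in both quorums had
    -- therefore already cert-voted, which rules out a next-vote for `⊥` or for its starting value.
    all_goals
      obtain rfl := hA.1.eq hA'.1
      exact absurd ⟨s, by linarith, u, hA, hu1, hu2, hsoft⟩ (hx v)
  | succ q hpq ih =>
    intro t' w hq
    obtain ⟨j, hj, -, s, -, h1⟩ := hq.honest h
    obtain ⟨s₀, hA', hs', ⟨x, hx, hx2⟩ | ⟨hw, hx, -⟩ | ⟨hw, -, -⟩⟩ := sends_next h1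
    · rw [hx, soft_eq_of_locked hadm h ih (hx2.sent hadm hj)]
    · have := ih _ _ ((prevNext_succ.1 hx).sent hadm hj)
      simp at this
    · have := hadm.start_succ j hj n q s₀ hA'.1
      rw [prevNext_succ, ← hw] at this
      exact ih _ _ (this.sent hadm hj)

theorem SentQuorum.cert_unique (hadm : Admissible cfg ex GST) (h : HonestTwoThirds cfg)
    {t t' : ℝ} {n p p' : ℕ} {v v' : Chain} (hc : SentQuorum cfg ex t .cert n p (some v))
    (hc' : SentQuorum cfg ex t' .cert n p' (some v')) : v = v' := by
  wlog hpp : p ≤ p' generalizing t t' p p' v v'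
  · exact (this hc' hc (by omega)).symm
  have hs' := hc'.cert_soft hadm h
  rcases hpp.eq_or_lt with rfl | hlt
  · exact (hc.cert_soft hadm h).soft_unique h hs'
  · obtain ⟨q, rfl⟩ : ∃ q, p' = q + 1 := ⟨p' - 1, by omega⟩
    exact (soft_eq_of_locked hadm h (hc.lock hadm h (by omega : p ≤ q)) hs').symm

/-- At most one value is certified in each iteration. -/
theorem HeardCert.agree (hadm : Admissible cfg ex GST) (h : HonestTwoThirds cfg)
    {i j : Node} (hi : i ∈ cfg.honest) (hj : j ∈ cfg.honest) {t t' : ℝ} {n : ℕ} {v v' : Chain}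
    (hc : HeardCert cfg ex i t n v) (hc' : HeardCert cfg ex j t' n v') : v = v' := by
  obtain ⟨p, hp⟩ := hc
  obtain ⟨p', hp'⟩ := hc'
  exact (hp.sent hadm hi).cert_unique hadm h (hp'.sent hadm hj)

/-! ### The origin of a certified value -/

/-- A value with a quorum of votes was once soft-voted by a quorum whose honest members all found
it valid, and has had quorums of next-votes ever since. -/
theorem SentQuorum.origin (hadm : Admissible cfg ex GST) (h : HonestTwoThirds cfg) {t : ℝ} {n p : ℕ}
    {v : Chain} (hq : SentQuorum cfg ex t .soft n p (some v) ∨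
      SentQuorum cfg ex t .next n p (some v)) :
    ∃ p₀ ≤ p, SentQuorum cfg ex t .soft n p₀ (some v) ∧
      (∀ j ∈ cfg.honest, ∀ s ≤ t, Sends cfg ex j s (.signed .soft j n p₀ (some v)) →
        ∃ s₀, Starts cfg ex j n p₀ s₀ ∧ s = s₀ + 2 * cfg.Δ ∧ ex.online j s ∧
          (∀ u < s, ∀ x, ¬ HeardCert cfg ex j u n x) ∧
          KnownChain ex j s v ∧ Valid cfg ex j n s₀ s v) ∧
      ∀ q, p₀ ≤ q → q < p → SentQuorum cfg ex t .next n q (some v) := by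
  induction p with
  | zero =>
    have hq' : SentQuorum cfg ex t .soft n 0 (some v) := by
      rcases hq with hq | hq
      · exact hq
      · obtain ⟨j, hj, -, s, hs, h1⟩ := hq.honest h
        obtain ⟨s₀, hA', hs', ⟨x, hx, hx2⟩ | ⟨hw, -, -⟩ | ⟨hw, -, -⟩⟩ := sends_next h1
        · rw [hx]; exact (hx2.sent hadm hj).mono hs
        · simp at hw
        · rw [hadm.start_zero j hj] at hw; simp at hw
    refine ⟨0, le_rfl, hq', fun j hj s _ hs => ?_, fun q _ hq => by omega⟩
    obtain ⟨y, hy, s₁, hA₁, hs₁, hsv⟩ := sends_soft hs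
    simp only [Option.some.injEq] at hy
    subst hy
    refine ⟨s₁, hA₁.1, hs₁, hA₁.2.2.1, fun u hu x => hA₁.2.2.2.2 x u hu, ?_⟩
    rw [hs₁]
    rcases hadm.soft_some j hj n 0 s₁ hA₁.1 _ hsv with ⟨hf, hk, hp⟩ | ⟨-, hp⟩
    · rcases hp with hp | hp
      · exact ⟨Or.inr ⟨_, hk, rfl⟩, hp⟩
      · exact absurd hp not_prevNext_zero
    · exact absurd hp not_prevNext_zero
  | succ p ih =>
    by_cases hprev : SentQuorum cfg ex t .next n p (some v)
    · obtain ⟨p₀, hp₀, h1, h2, h3⟩ := ih (Or.inr hprev)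
      refine ⟨p₀, by omega, h1, h2, fun q hq hqp => ?_⟩
      rcases (show q ≤ p by omega).eq_or_lt with rfl | hlt
      · exact hprev
      · exact h3 q hq hlt
    · have hq' : SentQuorum cfg ex t .soft n (p + 1) (some v) := by
        rcases hq with hq | hq
        · exact hq
        · obtain ⟨j, hj, -, s, hs, h1⟩ := hq.honest h
          obtain ⟨s₀, hA', hs', ⟨x, hx, hx2⟩ | ⟨hw, -, -⟩ | ⟨hw, -, -⟩⟩ := sends_next h1
          · rw [hx]; exact (hx2.sent hadm hj).mono hs
          · simp at hw
          · have := hadm.start_succ j hj n p s₀ hA'.1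
            rw [prevNext_succ, ← hw] at this
            exact absurd ((this.sent hadm hj).mono (hA'.2.1.trans hs)) hprev
      refine ⟨p + 1, le_rfl, hq', fun j hj s hst hs => ?_, fun q _ hq => by omega⟩
      obtain ⟨y, hy, s₁, hA₁, hs₁, hsv⟩ := sends_soft hs
      simp only [Option.some.injEq] at hy
      subst hy
      refine ⟨s₁, hA₁.1, hs₁, hA₁.2.2.1, fun u hu x => hA₁.2.2.2.2 x u hu, ?_⟩
      -- This is the period in which the value is new: without a previous quorum of next-votes for
      -- it, validity is the only ground for an honest soft-vote.
      have hno : ¬ PrevNext cfg ex j s n (p + 1) (some v) := fun hp =>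
        hprev (((prevNext_succ.1 hp).sent hadm hj).mono hst)
      rw [hs₁] at hno ⊢
      rcases hadm.soft_some j hj n (p + 1) s₁ hA₁.1 _ hsv with ⟨hf, hk, hp⟩ | ⟨-, hp⟩
      · rcases hp with hp | hp
        · exact ⟨Or.inr ⟨_, hk, rfl⟩, hp⟩
        · exact absurd hp hno
      · exact absurd hp hno

/-! ### Timing of periods and iterations -/

theorem SentQuorum.next_zero (hadm : Admissible cfg ex GST) (h : HonestTwoThirds cfg) {t : ℝ}
    {n p : ℕ} {w : Option Chain} (hq : SentQuorum cfg ex t .next n p w) :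
    ∃ w', SentQuorum cfg ex t .next n 0 w' := by
  induction p generalizing w with
  | zero => exact ⟨w, hq⟩
  | succ p ih =>
    obtain ⟨j, hj, -, s, hs, h1⟩ := hq.honest h
    obtain ⟨s₀, hA', hs', -⟩ := sends_next h1
    obtain ⟨w', hw'⟩ := ready_succ.1 hA'.1.ready
    exact ih ((hw'.sent hadm hj).mono (hA'.2.1.trans hs))

/-- A node is ready for a later period only if some honest checkpointer has spent `4Δ` in the one
before. -/
theorem Ready.exists_starts (hadm : Admissible cfg ex GST) (h : HonestTwoThirds cfg) {i : Node}
    (hi : i ∈ cfg.honest) {n p : ℕ} {t : ℝ} (hr : Ready cfg ex i n (p + 1) t) :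
    ∃ j ∈ cfg.honest, j ∈ cfg.checkpointers ∧ ∃ s, Starts cfg ex j n p s ∧ s + 4 * cfg.Δ ≤ t := by
  obtain ⟨w, hw⟩ := ready_succ.1 hr
  obtain ⟨j, hj, hc, s, hs, h1⟩ := (hw.sent hadm hi).honest h
  obtain ⟨s₀, hA, hs', -⟩ := sends_next h1
  exact ⟨j, hj, hc, s₀, hA.1, hs'.trans hs⟩

theorem Ready.exists_starts_of_lt (hadm : Admissible cfg ex GST) (h : HonestTwoThirds cfg)
    {n p p' : ℕ} (hp : p < p') : ∀ {i : Node} {t : ℝ}, i ∈ cfg.honest →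
    Ready cfg ex i n p' t →
    ∃ j ∈ cfg.honest, j ∈ cfg.checkpointers ∧
      ∃ s, Starts cfg ex j n p s ∧ s + 4 * cfg.Δ * ((p' : ℝ) - p) ≤ t := by
  induction p', hp using Nat.le_induction with
  | base =>
    intro i t hi hr
    obtain ⟨j, hj, hc, s, hs, hst⟩ := hr.exists_starts hadm h hi
    exact ⟨j, hj, hc, s, hs, by push_cast; linarith⟩
  | succ q hpq ih =>
    intro i t hi hr
    obtain ⟨j, hj, hc, s, hs, hst⟩ := hr.exists_starts hadm h hi
    obtain ⟨j', hj', hc', s', hs', hst'⟩ := ih hj hs.ready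
    exact ⟨j', hj', hc', s', hs', by push_cast; linarith⟩

theorem Ready.exists_ready_zero (hadm : Admissible cfg ex GST) (h : HonestTwoThirds cfg)
    {i : Node} {n p : ℕ} {t : ℝ} (hi : i ∈ cfg.honest)
    (hr : Ready cfg ex i n p t) :
    ∃ j ∈ cfg.honest, Ready cfg ex j n 0 (t - 4 * cfg.Δ * p) := by
  rcases Nat.eq_zero_or_pos p with rfl | hp
  · exact ⟨i, hi, by simpa using hr⟩
  · obtain ⟨j, hj, -, s, hs, hst⟩ := hr.exists_starts_of_lt hadm h hp hi
    refine ⟨j, hj, hs.ready.mono ?_⟩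
    push_cast at hst
    linarith

theorem HeardCert.exists_starts (hadm : Admissible cfg ex GST) (h : HonestTwoThirds cfg)
    {i : Node} {n : ℕ} {v : Chain} {t : ℝ} (hi : i ∈ cfg.honest) (hc : HeardCert cfg ex i t n v) :
    ∃ j ∈ cfg.honest, j ∈ cfg.checkpointers ∧
      ∃ p s, Starts cfg ex j n p s ∧ s + 2 * cfg.Δ ≤ t := by
  obtain ⟨p, hp⟩ := hc
  obtain ⟨j, hj, hjc, s, hs, h1⟩ := (hp.sent hadm hi).honest h
  obtain ⟨x, -, s₀, hA, h2, -⟩ := sends_cert h1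
  exact ⟨j, hj, hjc, p, s₀, hA.1, h2.trans hs⟩

/-- A node is ready for an iteration only if the preceding one was certified a time `e` before. -/
theorem Ready.exists_heard (hadm : Admissible cfg ex GST) (h : HonestTwoThirds cfg)
    (hΔ : 0 < cfg.Δ) {i : Node} {n p : ℕ} {t : ℝ} (hi : i ∈ cfg.honest)
    (hr : Ready cfg ex i (n + 1) p t) :
    ∃ j ∈ cfg.honest, ∃ v, HeardCert cfg ex j (t - cfg.e) n v := by
  obtain ⟨j, hj, hr'⟩ := hr.exists_ready_zero hadm h hi
  obtain ⟨v, s, hv, hs⟩ := ready_zero_succ.1 hr'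
  refine ⟨j, hj, v, hv.mono ?_⟩
  have : 0 ≤ 4 * cfg.Δ * (p : ℝ) := by positivity
  linarith

theorem HeardCert.exists_pred (hadm : Admissible cfg ex GST) (h : HonestTwoThirds cfg)
    (hΔ : 0 < cfg.Δ) {i : Node} {n : ℕ} {v : Chain} {t : ℝ} (hi : i ∈ cfg.honest)
    (hc : HeardCert cfg ex i t (n + 1) v) :
    ∃ j ∈ cfg.honest, ∃ u, HeardCert cfg ex j (t - cfg.e) n u := by
  obtain ⟨j, hj, -, p, s, hs, hst⟩ := hc.exists_starts hadm h hi
  obtain ⟨j', hj', u, hu⟩ := hs.ready.exists_heard hadm h hΔ hj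
  exact ⟨j', hj', u, hu.mono (by linarith)⟩

theorem HeardCert.exists_of_lt (hadm : Admissible cfg ex GST) (h : HonestTwoThirds cfg)
    (hΔ : 0 < cfg.Δ) (he : 0 < cfg.e) {m n : ℕ} (hmn : m < n) : ∀ {i : Node} {v : Chain} {t : ℝ},
    i ∈ cfg.honest → HeardCert cfg ex i t n v →
    ∃ j ∈ cfg.honest, ∃ u, HeardCert cfg ex j (t - cfg.e) m u := by
  induction n, hmn using Nat.le_induction with
  | base => exact fun hi hc => hc.exists_pred hadm h hΔ hi
  | succ q hpq ih =>
    intro i v t hi hc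
    obtain ⟨j, hj, u, hu⟩ := hc.exists_pred hadm h hΔ hi
    obtain ⟨j', hj', u', hu'⟩ := ih hj hu
    exact ⟨j', hj', u', hu'.mono (by linarith)⟩

/-- Every earlier iteration costs at least `e` and every earlier period at least `4Δ`. Only
boundedly many iterations and periods are thus reached by a given time; this makes first times exist
and allows a finite union bound over leaders. -/
theorem Ready.le_time (hadm : Admissible cfg ex GST) (h : HonestTwoThirds cfg)
    (hΔ : 0 < cfg.Δ) {n : ℕ} : ∀ {i : Node} {p : ℕ} {t : ℝ},
    i ∈ cfg.honest → Ready cfg ex i n p t → n * cfg.e + 4 * cfg.Δ * p ≤ t := by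
  induction n with
  | zero =>
    intro i p t hi hr
    obtain ⟨j, hj, hr'⟩ := hr.exists_ready_zero hadm h hi
    have := ready_zero_zero.1 hr'
    simp; linarith
  | succ n ih =>
    intro i p t hi hr
    obtain ⟨j, hj, hr'⟩ := hr.exists_ready_zero hadm h hi
    obtain ⟨v, s, hv, hs⟩ := ready_zero_succ.1 hr'
    obtain ⟨j', hj', -, p', s', hs', hs2⟩ := hv.exists_starts hadm h hj
    have := ih hj' hs'.ready
    have h3 : 0 ≤ 4 * cfg.Δ * (p' : ℝ) := by positivity
    push_cast
    linarith

theorem HeardCert.le_time (hadm : Admissible cfg ex GST) (h : HonestTwoThirds cfg)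
    (hΔ : 0 < cfg.Δ) {i : Node} {n : ℕ} {v : Chain} {t : ℝ} (hi : i ∈ cfg.honest)
    (hc : HeardCert cfg ex i t n v) : n * cfg.e + 2 * cfg.Δ ≤ t := by
  obtain ⟨j', hj', -, p', s', hs', hs2⟩ := hc.exists_starts hadm h hi
  have := hs'.ready.le_time hadm h hΔ hj'
  have h3 : 0 ≤ 4 * cfg.Δ * (p' : ℝ) := by positivity
  linarith

/-! ### Checkpoints form a chain -/

theorem HeardCert.extends_pred (hadm : Admissible cfg ex GST) (h : HonestTwoThirds cfg)
    (hΔ : 0 < cfg.Δ) (he : 0 < cfg.e) {i : Node} {n : ℕ} {v : Chain} {t : ℝ} (hi : i ∈ cfg.honest)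
    (hc : HeardCert cfg ex i t (n + 1) v) :
    ∃ j ∈ cfg.honest, ∃ s u, HeardCert cfg ex j s n u ∧ u.drop cfg.k <:+ v.drop cfg.k := by
  obtain ⟨p, hp⟩ := hc
  obtain ⟨p₀, hp₀, hsoft, hval, hnext⟩ :=
    SentQuorum.origin hadm h (Or.inl ((hp.sent hadm hi).cert_soft hadm h))
  have key : ∃ j ∈ cfg.honest, ∃ s s₁ u, s ≤ s₁ ∧ s₁ ≤ t ∧ HeardCert cfg ex j s n u ∧
      Sends cfg ex j s₁ (.signed .soft j (n + 1) p₀ (some v)) := by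
    rcases p₀ with _ | q
    · obtain ⟨j, hj, -, s, hs, h1⟩ := hsoft.honest h
      obtain ⟨s₀, hs₀, hs₁, -⟩ := hval j hj s hs h1
      obtain ⟨u, s', hu, hs'⟩ := ready_zero_succ.1 hs₀.ready
      exact ⟨j, hj, s', s, u, by linarith, hs, hu, h1⟩
    -- A node can be carried into a later period by next-votes without having heard the previous
    -- certificate. An honest node common to the soft-voters and the next-voters of period 0 did
    -- hear it, since it started period 0.
    · obtain ⟨j', hj', -, s', hs', h1'⟩ := hsoft.honest h
      obtain ⟨s₀', hs₀', -⟩ := hval j' hj' s' hs' h1'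
      obtain ⟨w, hw⟩ := ready_succ.1 hs₀'.ready
      obtain ⟨w', hw'⟩ := (hw.sent hadm hj').next_zero hadm h
      obtain ⟨j, hj, -, ⟨r, -, hr⟩, ⟨s, hs, h1⟩⟩ := hw'.inter h hsoft
      obtain ⟨s₀, hs₀, hs₁, -⟩ := hval j hj s hs h1
      obtain ⟨r₀, hA, -⟩ := sends_next hr
      obtain ⟨u, s'', hu, hs''⟩ := ready_zero_succ.1 hA.1.ready
      -- Nodes never go back, so period 0 was started before the later one; the certificate was thus
      -- known when the value was checked for validity.
      have hlt : r₀ < s₀ := by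
        by_contra hle
        push Not at hle
        exact hA.1.2 (n + 1) (q + 1) (Or.inr ⟨rfl, by omega⟩) s₀ hle hs₀.online hs₀.ready
      exact ⟨j, hj, s'', s, u, by linarith, hs, hu, h1⟩
  obtain ⟨j, hj, s, s₁, u, h01, h1t, hu, hsend⟩ := key
  obtain ⟨x, hx, hxs, -, -, -, hv⟩ := hval j hj s₁ h1t hsend
  exact ⟨j, hj, s, u, hu, hv.1 n (by omega) u (hu.mono h01)⟩

theorem HeardCert.extends (hadm : Admissible cfg ex GST) (h : HonestTwoThirds cfg)
    (hΔ : 0 < cfg.Δ) (he : 0 < cfg.e) {m n : ℕ} (hmn : m ≤ n) : ∀ {i j : Node} {u v : Chain}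
    {s t : ℝ}, i ∈ cfg.honest → j ∈ cfg.honest → HeardCert cfg ex i s m u →
    HeardCert cfg ex j t n v → u.drop cfg.k <:+ v.drop cfg.k := by
  induction n, hmn using Nat.le_induction with
  | base =>
    intro i j u v s t hi hj hu hv
    rw [hu.agree hadm h hi hj hv]
  | succ n hmn ih =>
    intro i j u v s t hi hj hu hv
    obtain ⟨j', hj', s', u', hu', hs⟩ := hv.extends_pred hadm h hΔ he hj
    exact (ih hi hj' hu hu').trans hs

theorem HeardCert.suffix_ckpt (hadm : Admissible cfg ex GST) (h : HonestTwoThirds cfg)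
    (hΔ : 0 < cfg.Δ) (he : 0 < cfg.e) {i j : Node} {n : ℕ} {v B : Chain} {s t : ℝ}
    (hi : i ∈ cfg.honest) (hj : j ∈ cfg.honest) (hc : HeardCert cfg ex i s n v)
    (hB : IsLastCkpt cfg ex j t B)
    (hex : ∃ m u, n ≤ m ∧ HeardCert cfg ex j t m u) : v.drop cfg.k <:+ B := by
  obtain ⟨m, u, hnm, hu⟩ := hex
  rcases hB with ⟨hno, -⟩ | ⟨n', v', hn', rfl, hmax⟩
  · exact absurd hu (hno m u)
  · exact hc.extends hadm h hΔ he (hnm.trans (hmax m u hu)) hi hj hn'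

theorem ckpt_comparable (hadm : Admissible cfg ex GST) (h : HonestTwoThirds cfg)
    (hΔ : 0 < cfg.Δ) (he : 0 < cfg.e) {i j : Node} {s t : ℝ} (hi : i ∈ cfg.honest)
    (hj : j ∈ cfg.honest) :
    ex.ckpt i s <:+ ex.ckpt j t ∨ ex.ckpt j t <:+ ex.ckpt i s := by
  rcases hadm.last_ckpt i hi s with ⟨-, h1⟩ | ⟨n, v, hn, h1, -⟩
  · left; rw [h1]; exact List.nil_suffix
  rcases hadm.last_ckpt j hj t with ⟨-, h2⟩ | ⟨n', v', hn', h2, -⟩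
  · right; rw [h2]; exact List.nil_suffix
  rw [h1, h2]
  rcases le_total n n' with hle | hle
  · exact Or.inl (hn.extends hadm h hΔ he hle hi hj hn')
  · exact Or.inr (hn'.extends hadm h hΔ he hle hj hi hn)

/-! ### Safety of the finality rule and nesting of the two rules -/

theorem ckpt_mono (hadm : Admissible cfg ex GST) (h : HonestTwoThirds cfg)
    (hΔ : 0 < cfg.Δ) (he : 0 < cfg.e) {i : Node} {s t : ℝ} (hi : i ∈ cfg.honest) (hst : s ≤ t) :
    ex.ckpt i s <:+ ex.ckpt i t := by
  rcases hadm.last_ckpt i hi s with ⟨-, h1⟩ | ⟨n, v, hn, h1, -⟩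
  · rw [h1]; exact List.nil_suffix
  · rw [h1]
    exact hn.suffix_ckpt hadm h hΔ he hi hi (hadm.last_ckpt i hi t) ⟨n, v, le_rfl, hn.mono hst⟩

theorem safe_confirmedFin (hadm : Admissible cfg ex GST) (h : HonestTwoThirds cfg)
    (hΔ : 0 < cfg.Δ) (he : 0 < cfg.e) (T : ℝ) : Safe cfg (confirmedFin ex) T := by
  refine ⟨fun i hi r s _ hrs _ b hb => List.IsSuffix.trans hb (ckpt_mono hadm h hΔ he hi hrs),
    fun i hi j hj r s _ _ _ _ b hb b' hb' => ?_⟩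
  have hb : b <:+ ex.ckpt i r := hb
  have hb' : b' <:+ ex.ckpt j s := hb'
  rcases ckpt_comparable hadm h hΔ he hi hj (s := r) (t := s) with hc | hc
  · exact List.suffix_or_suffix_of_suffix (hb.trans hc) hb'
  · exact List.suffix_or_suffix_of_suffix hb (hb'.trans hc)

theorem HeardCert.knownChain (h : HonestTwoThirds cfg) {i : Node} {n : ℕ} {v : Chain} {t : ℝ}
    (hc : HeardCert cfg ex i t n v) : KnownChain ex i t v := by
  obtain ⟨p, Q, hQ1, hQ2, hQ3⟩ := hc
  have h0 : 0 < cfg.checkpointers.card := by unfold HonestTwoThirds at h; omega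
  obtain ⟨j, hj⟩ := Finset.card_pos.1 (show 0 < Q.card by omega)
  exact Or.inr ⟨_, hQ3 j hj, rfl⟩

theorem suffix_drop_of_length_le {b c : Chain} {k : ℕ} (h : b <:+ c)
    (hl : b = [] ∨ b.length + k ≤ c.length) : b <:+ c.drop k := by
  rcases hl with rfl | hl
  · exact List.nil_suffix
  · exact List.suffix_of_suffix_length_le h (List.drop_suffix k c) (by simp; omega)

theorem drop_eq_nil_or (k : ℕ) (v : Chain) : v.drop k = [] ∨ (v.drop k).length + k = v.length := by
  rcases le_total v.length k with h | h
  · exact Or.inl (List.drop_eq_nil_of_le h)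
  · right; simp; omega

/-- The certified chain is itself known and contains its checkpoint, so the held chain is at least
as long. Being `k`-deep in the former, the checkpoint is at least `k`-deep in the latter. -/
theorem ckpt_suffix_held_drop (hadm : Admissible cfg ex GST) (h : HonestTwoThirds cfg)
    {i : Node} {t : ℝ} (hi : i ∈ cfg.honest) : ex.ckpt i t <:+ (ex.held i t).drop cfg.k := by
  obtain ⟨-, hB, hmax⟩ := hadm.holds i hi t
  refine suffix_drop_of_length_le hB ?_
  rcases hadm.last_ckpt i hi t with ⟨-, h1⟩ | ⟨n, v, hn, h1, -⟩
  · exact Or.inl h1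
  · have h2 := hmax v (hn.knownChain h) (h1 ▸ List.drop_suffix _ _)
    rw [h1]
    exact (drop_eq_nil_or cfg.k v).imp_right fun h3 => by omega

theorem confirmedFin_subset_confirmedAda (hadm : Admissible cfg ex GST) (h : HonestTwoThirds cfg)
    (depth : Node → ℕ) {i : Node} (hi : i ∈ cfg.honest) (hd : depth i ≤ cfg.k) (t : ℝ) :
    confirmedFin ex i t ⊆ confirmedAda ex depth i t := by
  intro b hb
  refine List.IsSuffix.trans hb ((ckpt_suffix_held_drop hadm h hi).trans ?_)
  have : (ex.held i t).drop cfg.k = ((ex.held i t).drop (depth i)).drop (cfg.k - depth i) := by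
    rw [List.drop_drop]; congr 1; omega
  rw [this]
  exact List.drop_suffix _ _

end Agreement

/-! ### Chains that nodes hold or extend -/

section Tips

variable {Node : Type*} {cfg : Config Node} {ex : Execution Node} {GST : ℝ}

/-- The online honest node `i` may hold, or extend, the chain `c` at time `t`. -/
structure Tip (cfg : Config Node) (ex : Execution Node) (i : Node) (t : ℝ) (c : Chain) : Prop where
  honest : i ∈ cfg.honest
  online : ex.online i t
  ckpt : ex.ckpt i t <:+ c
  known : KnownChain ex i t c
  longest : ∀ d, KnownChain ex i t d → (∀ b ∈ d, b.time < t) → ex.ckpt i t <:+ d →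
    d.length ≤ c.length

theorem KnownChain.mined (hadm : Admissible cfg ex GST) {i : Node} (hi : i ∈ cfg.honest) {t : ℝ}
    {c : Chain} (h : KnownChain ex i t c) : Mined ex t c := by
  rcases h with rfl | ⟨m, hm, hc⟩
  · simp [Mined]
  · obtain ⟨r, hr, hrt⟩ := known_iff.1 hm
    exact ((hadm.authentic i hi m r hr).1 c hc).mono hrt

theorem Tip.mined (hadm : Admissible cfg ex GST) {i : Node} {t : ℝ} {c : Chain}
    (h : Tip cfg ex i t c) : Mined ex t c :=
  h.known.mined hadm h.honest

theorem tip_held (hadm : Admissible cfg ex GST) {i : Node} {t : ℝ} (hi : i ∈ cfg.honest)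
    (ho : ex.online i t) : Tip cfg ex i t (ex.held i t) := by
  obtain ⟨h1, h2, h3⟩ := hadm.holds i hi t
  exact ⟨hi, ho, h2, h1, fun d hd _ => h3 d hd⟩

theorem tip_base (hadm : Admissible cfg ex GST) {t : ℝ} (ht : t ∈ ex.H) :
    Tip cfg ex (ex.miner t) t (ex.base t) := by
  obtain ⟨h0, -, ho, h1, h2, h3⟩ := hadm.mining t ht
  exact ⟨h0, ho, h2, h1.1, fun d hd hb => h3 d ⟨hd, fun hm => (hb _ hm).ne rfl⟩⟩

theorem tip_blk (hadm : Admissible cfg ex GST) {t : ℝ} (ht : t ∈ ex.H) :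
    Tip cfg ex (ex.miner t) t (blk ex t) := by
  have h := tip_base hadm ht
  refine ⟨h.honest, h.online, h.ckpt.trans (List.suffix_cons _ _), ?_, fun d hd hb hc =>
    (h.longest d hd hb hc).trans (by simp [blk])⟩
  exact Or.inr ⟨.chain (blk ex t), hadm.own _ h.honest _ _ ⟨ht, rfl, rfl⟩, rfl⟩

theorem Known.transfer (hadm : Admissible cfg ex GST) {i j : Node} {s t : ℝ} {m : Msg Node}
    (hj : j ∈ cfg.honest) (hi : i ∈ cfg.honest) (h : Known ex j s m)
    (hst : max s GST + cfg.Δ ≤ t) (ho : ex.online i t) : Known ex i t m := by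
  obtain ⟨r, hr, hrs⟩ := known_iff.1 h
  exact hadm.deliver i hi j hj m r hr t (le_trans (by gcongr) hst) ho

theorem KnownChain.transfer (hadm : Admissible cfg ex GST) {i j : Node} {s t : ℝ} {c : Chain}
    (hj : j ∈ cfg.honest) (hi : i ∈ cfg.honest) (h : KnownChain ex j s c)
    (hst : max s GST + cfg.Δ ≤ t) (ho : ex.online i t) : KnownChain ex i t c :=
  h.imp_right fun ⟨m, hm, hc⟩ => ⟨m, hm.transfer hadm hj hi hst ho, hc⟩

theorem Quorum.transfer (hadm : Admissible cfg ex GST) {i j : Node} {s t : ℝ} {kind : Kind}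
    {n p : ℕ} {w : Option Chain} (hj : j ∈ cfg.honest) (hi : i ∈ cfg.honest)
    (h : Quorum cfg ex j s kind n p w) (hst : max s GST + cfg.Δ ≤ t) (ho : ex.online i t) :
    Quorum cfg ex i t kind n p w := by
  obtain ⟨Q, h1, h2, h3⟩ := h
  exact ⟨Q, h1, h2, fun x hx => (h3 x hx).transfer hadm hj hi hst ho⟩

theorem HeardCert.transfer (hadm : Admissible cfg ex GST) {i j : Node} {s t : ℝ} {n : ℕ}
    {v : Chain} (hj : j ∈ cfg.honest) (hi : i ∈ cfg.honest) (h : HeardCert cfg ex j s n v)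
    (hst : max s GST + cfg.Δ ≤ t) (ho : ex.online i t) : HeardCert cfg ex i t n v :=
  h.imp fun _ hp => hp.transfer hadm hj hi hst ho

/-- By time `t`, node `i` has heard of no certificate of iteration `N` or a later one. -/
def Unheard (cfg : Config Node) (ex : Execution Node) (i : Node) (t : ℝ) (N : ℕ) : Prop :=
  ∀ n, N ≤ n → ∀ v, ¬ HeardCert cfg ex i t n v

theorem Unheard.mono {i : Node} {t : ℝ} {N M : ℕ} (h : Unheard cfg ex i t N) (hNM : N ≤ M) :
    Unheard cfg ex i t M :=
  fun n hn => h n (hNM.trans hn)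

/-- A last heard iteration exists by assumption. This bounds the induction on iterations for any
given node and time. -/
theorem exists_unheard (hadm : Admissible cfg ex GST) {i : Node} (hi : i ∈ cfg.honest) (t : ℝ) :
    ∃ N, Unheard cfg ex i t N := by
  rcases hadm.last_ckpt i hi t with ⟨h, -⟩ | ⟨n, v, -, -, h⟩
  · exact ⟨0, fun n _ v => h n v⟩
  · exact ⟨n + 1, fun m hm u hu => by have := h m u hu; omega⟩

theorem ckpt_eq_of_last (hadm : Admissible cfg ex GST) (h : HonestTwoThirds cfg) {i : Node}
    (hi : i ∈ cfg.honest) {t : ℝ} {n : ℕ} {v : Chain} (hc : HeardCert cfg ex i t n v)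
    (hu : Unheard cfg ex i t (n + 1)) : ex.ckpt i t = v.drop cfg.k := by
  rcases hadm.last_ckpt i hi t with ⟨hno, -⟩ | ⟨m, u, hm, h1, hmax⟩
  · exact absurd hc (hno n v)
  · have h2 := hmax n v hc
    have h3 : m = n := by
      by_contra hne
      exact hu m (by omega) u hm
    subst h3
    rw [h1, hm.agree hadm h hi hi hc]

/-- An online honest node that has heard of a certificate has heard of all earlier ones. -/
theorem HeardCert.of_le (hadm : Admissible cfg ex GST) (h : HonestTwoThirds cfg)
    (hΔ : 0 < cfg.Δ) (he : cfg.Δ ≤ cfg.e) {i : Node} {m n : ℕ} {v : Chain} {t : ℝ}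
    (hi : i ∈ cfg.honest) (ho : ex.online i t) (ht : GST + cfg.Δ ≤ t)
    (hc : HeardCert cfg ex i t n v) (hmn : m ≤ n) : ∃ u, HeardCert cfg ex i t m u := by
  rcases hmn.eq_or_lt with rfl | hlt
  · exact ⟨v, hc⟩
  · obtain ⟨j, hj, u, hu⟩ := hc.exists_of_lt hadm h hΔ (by linarith) hlt hi
    refine ⟨u, hu.transfer hadm hj hi ?_ ho⟩
    rw [← max_add_add_right]
    exact max_le (by linarith) ht

/-- A certified value was once found valid by an honest node that held its checkpoint block. -/
theorem HeardCert.witness (hadm : Admissible cfg ex GST) (h : HonestTwoThirds cfg) {j : Node}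
    {N : ℕ} {v : Chain} {t : ℝ} (hj : j ∈ cfg.honest) (hc : HeardCert cfg ex j t N v) :
    ∃ i ∈ cfg.honest, ∃ p s, Starts cfg ex i N p s ∧ s + 2 * cfg.Δ ≤ t ∧
      (∀ u < s + 2 * cfg.Δ, ∀ x, ¬ HeardCert cfg ex i u N x) ∧
      KnownChain ex i (s + 2 * cfg.Δ) v ∧ v.drop cfg.k <:+ ex.held i s := by
  obtain ⟨p, hp⟩ := hc
  obtain ⟨p₀, -, hsoft, hval, -⟩ :=
    SentQuorum.origin hadm h (Or.inl ((hp.sent hadm hj).cert_soft hadm h))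
  obtain ⟨i, hi, -, s, hs, h1⟩ := hsoft.honest h
  obtain ⟨s₀, hs₀, rfl, -, h2, h3, h4⟩ := hval i hi s hs h1
  exact ⟨i, hi, p₀, s₀, hs₀, hs, h2, h3, h4.2⟩

/-- A quorum is complete at the time of the last receipt. -/
theorem Quorum.exists_recv (h : HonestTwoThirds cfg) {i : Node} {t : ℝ} {kind : Kind} {n p : ℕ}
    {w : Option Chain} (hq : Quorum cfg ex i t kind n p w) :
    ∃ j ∈ cfg.checkpointers, ∃ s ≤ t, ex.recv i (.signed kind j n p w) = s ∧
      Quorum cfg ex i s kind n p w := by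
  obtain ⟨Q, hQ1, hQ2, hQ3⟩ := hq
  have h0 : 0 < cfg.checkpointers.card := by unfold HonestTwoThirds at h; omega
  have hne : Q.Nonempty := Finset.card_pos.1 (by omega)
  have hex : ∀ j : Node, ∃ r : ℝ, j ∈ Q → ex.recv i (.signed kind j n p w) = r ∧ r ≤ t := by
    intro j
    by_cases hj : j ∈ Q
    · obtain ⟨r, hr⟩ := known_iff.1 (hQ3 j hj)
      exact ⟨r, fun _ => hr⟩
    · exact ⟨0, fun hj' => absurd hj' hj⟩
  choose f hf using hex
  obtain ⟨j, hj, hjmax⟩ := Finset.exists_max_image Q f hne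
  exact ⟨j, hQ1 hj, f j, (hf j hj).2, (hf j hj).1,
    ⟨Q, hQ1, hQ2, fun x hx => known_iff.2 ⟨f x, (hf x hx).1, hjmax x hx⟩⟩⟩

/-- The chain held by an honest node, even an offline one, is a longest one at a time when the
node was online. -/
theorem exists_tip_held (hadm : Admissible cfg ex GST) (h : HonestTwoThirds cfg) {i : Node}
    {u₀ t : ℝ} (hi : i ∈ cfg.honest) (hu₀ : u₀ ≤ t) (ho : ex.online i u₀) :
    ∃ u, u₀ ≤ u ∧ u ≤ t ∧ Tip cfg ex i u (ex.held i t) ∧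
      ∀ d, KnownChain ex i u d → ex.ckpt i u <:+ d → d.length ≤ (ex.held i t).length := by
  obtain ⟨h1, h2, h3⟩ := hadm.holds i hi t
  -- a time at which the held chain is known
  obtain ⟨u₁, hu₁, hu₁t, ho₁, hk₁⟩ : ∃ u₁, u₀ ≤ u₁ ∧ u₁ ≤ t ∧ ex.online i u₁ ∧
      KnownChain ex i u₁ (ex.held i t) := by
    rcases h1 with h1 | ⟨m, hm, hc⟩
    · exact ⟨u₀, le_rfl, hu₀, ho, Or.inl h1⟩
    · obtain ⟨r, hr, hrt⟩ := known_iff.1 hm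
      have hm' : Known ex i r m := known_iff.2 ⟨r, hr, le_rfl⟩
      rcases le_total u₀ r with hle | hle
      · exact ⟨r, hle, hrt, hadm.recv_online i hi m r hr, Or.inr ⟨m, hm', hc⟩⟩
      · exact ⟨u₀, le_rfl, hu₀, ho, Or.inr ⟨m, hm'.mono hle, hc⟩⟩
  -- It suffices to find an online time after `u₁` with the final checkpoint already in force. If
  -- there is a certificate, the later of `u₁` and the receipt completing its quorum serves, since
  -- messages are received only while online.
  have fin : ∀ u, u₁ ≤ u → u ≤ t → ex.online i u → ex.ckpt i u = ex.ckpt i t →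
      ∃ u, u₀ ≤ u ∧ u ≤ t ∧ Tip cfg ex i u (ex.held i t) ∧
      ∀ d, KnownChain ex i u d → ex.ckpt i u <:+ d → d.length ≤ (ex.held i t).length := by
    intro u hu hut hou he
    have hlong : ∀ d, KnownChain ex i u d → ex.ckpt i u <:+ d →
        d.length ≤ (ex.held i t).length := fun d hd hdc => h3 d (hd.mono hut) (he ▸ hdc)
    exact ⟨u, hu₁.trans hu, hut, ⟨hi, hou, he ▸ h2, hk₁.mono hu, fun d hd _ => hlong d hd⟩, hlong⟩
  rcases hadm.last_ckpt i hi t with ⟨hno, hnil⟩ | ⟨n, v, hn, hB, hmax⟩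
  · refine fin u₁ le_rfl hu₁t ho₁ ?_
    rcases hadm.last_ckpt i hi u₁ with ⟨-, hnil'⟩ | ⟨n, v, hn, -, -⟩
    · rw [hnil, hnil']
    · exact absurd (hn.mono hu₁t) (hno n v)
  · have hlast : ∀ u ≤ t, HeardCert cfg ex i u n v → ex.ckpt i u = ex.ckpt i t := by
      intro u hut hc
      rw [hB]
      refine ckpt_eq_of_last hadm h hi hc fun m hm x hx => ?_
      have := hmax m x (hx.mono hut)
      omega
    obtain ⟨p, hq⟩ := hn
    obtain ⟨j, -, s, hst, hs, hq'⟩ := hq.exists_recv h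
    have hheard : HeardCert cfg ex i s n v := ⟨p, hq'⟩
    rcases le_total u₁ s with hle | hle
    · exact fin s hle hst (hadm.recv_online i hi _ _ hs) (hlast _ hst hheard)
    · exact fin u₁ le_rfl hu₁t ho₁ (hlast _ hu₁t (hheard.mono hle))

theorem held_eq_nil_or (hadm : Admissible cfg ex GST) {i : Node} (hi : i ∈ cfg.honest) (t : ℝ) :
    ex.held i t = [] ∨ ∃ u ≤ t, ex.online i u := by
  rcases (hadm.holds i hi t).1 with h1 | ⟨m, hm, hc⟩
  · exact Or.inl h1
  · obtain ⟨r, hr, hrt⟩ := known_iff.1 hm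
    exact Or.inr ⟨r, hrt, hadm.recv_online i hi m r hr⟩

/-! ### Sharing a recent block -/

/-- The two chains share an honest block mined at time `a` or later (or the genesis block, if
`a ≤ 0`). -/
def Share (ex : Execution Node) (a : ℝ) (c₁ c₂ : Chain) : Prop :=
  ∃ d, d <:+ c₁ ∧ d <:+ c₂ ∧ ((d = [] ∧ a ≤ 0) ∨ ∃ g, 0 < g ∧ a ≤ g ∧ d = blk ex g)

theorem Share.symm {a : ℝ} {c₁ c₂ : Chain} (h : Share ex a c₁ c₂) : Share ex a c₂ c₁ := by
  obtain ⟨d, h1, h2, h3⟩ := h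
  exact ⟨d, h2, h1, h3⟩

theorem Share.mono {a a' : ℝ} {c₁ c₂ : Chain} (h : Share ex a c₁ c₂) (ha : a' ≤ a) :
    Share ex a' c₁ c₂ := by
  obtain ⟨d, h1, h2, h3⟩ := h
  refine ⟨d, h1, h2, h3.imp (fun h => ⟨h.1, ha.trans h.2⟩) ?_⟩
  rintro ⟨g, h0, hg, hd⟩
  exact ⟨g, h0, ha.trans hg, hd⟩

theorem Mined.length_le_recent {t a : ℝ} {v d : Chain} (hH : Elections ex.H) (hA : Elections ex.A)
    (hv : Mined ex t v) (hd : d <:+ v)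
    (h : (d = [] ∧ a ≤ 0) ∨ ∃ g, 0 < g ∧ a ≤ g ∧ d = blk ex g) :
    v.length ≤ d.length + (blocks ex.H ex.A (max a 0) t).ncard := by
  rcases h with ⟨rfl, ha⟩ | ⟨g, hg0, hg, rfl⟩
  · refine hv.length_le hH hA hd fun b c' hb _ => ?_
    rw [max_eq_right ha]
    exact (hv.time_pos hH hA (hb.subset (by simp))).le
  · refine (hv.length_le_blk hH hA hd).trans ?_
    gcongr
    · exact blocks_finite hH hA _ _
    · exact blocks_mono (max_le hg hg0.le) le_rfl

/-- The part of a chain below its recent blocks is contained in every chain that shares a recent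
block with it. -/
theorem Share.drop_suffix {t a : ℝ} {c₁ c₂ : Chain} {m : ℕ} (hH : Elections ex.H)
    (hA : Elections ex.A) (h : Share ex a c₁ c₂) (h₁ : Mined ex t c₁)
    (hm : (blocks ex.H ex.A (max a 0) t).ncard ≤ m) : c₁.drop m <:+ c₂ := by
  obtain ⟨d, hd1, hd2, hd⟩ := h
  have h2 := h₁.length_le_recent hH hA hd1 hd
  refine (List.suffix_of_suffix_length_le (List.drop_suffix m c₁) hd1 ?_).trans hd2
  simp
  omega

/-- A checkpoint block contained in one chain is contained in every chain that shares a recent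
block with it. -/
theorem Share.ckpt_suffix {t a : ℝ} {c₁ c₂ v : Chain} {k : ℕ} (hH : Elections ex.H)
    (hA : Elections ex.A) (h : Share ex a c₁ c₂) (hv : Mined ex t v) (hB : v.drop k <:+ c₁)
    (hk : (blocks ex.H ex.A (max a 0) t).ncard < k) : v.drop k <:+ c₂ := by
  obtain ⟨d, hd1, hd2, hd⟩ := h
  rcases le_total (v.drop k).length d.length with hle | hle
  · exact (List.suffix_of_suffix_length_le hB hd1 hle).trans hd2
  · have hdB : d <:+ v.drop k := List.suffix_of_suffix_length_le hd1 hB hle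
    have h2 := hv.length_le_recent hH hA (hdB.trans (List.drop_suffix k v)) hd
    rcases drop_eq_nil_or k v with h3 | h3
    · rw [h3]; exact List.nil_suffix
    · omega

/-! ### Counting -/

/-- Converts a fork into a bound on its duration: the drift makes twice the loners exceed all blocks
by `δ * (t₁ - t₀) - q`, whereas the fork permits this only to the extent of the `D` loners missing
from `U`. -/
theorem Typical.window_le {δ r q T t₀ t₁ D Δ : ℝ} {H A U : Set ℝ} (h : Typical H A Δ δ r q T)
    (h0 : 0 ≤ t₀) (h01 : t₀ ≤ t₁) (h1 : t₁ ≤ T)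
    (hU : 2 * U.ncard ≤ (blocks H A t₀ t₁).ncard) (hfin : U.Finite)
    (hD : (((loners H Δ ∩ Set.Ioc t₀ t₁) \ U).ncard : ℝ) ≤ D) : δ * (t₁ - t₀) ≤ q + 2 * D := by
  have h2 := h.drift t₀ t₁ h0 h01 h1
  have hlf : (loners H Δ ∩ Set.Ioc t₀ t₁).Finite :=
    (h.honest.finite t₁).subset fun x hx => ⟨hx.1.1, hx.2.2⟩
  have h3 : (loners H Δ ∩ Set.Ioc t₀ t₁).ncard ≤
      ((loners H Δ ∩ Set.Ioc t₀ t₁) \ U).ncard + U.ncard := Set.ncard_le_ncard_sdiff_add_ncard _ _ hfin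
  have h3' : ((loners H Δ ∩ Set.Ioc t₀ t₁).ncard : ℝ) ≤
      ((loners H Δ ∩ Set.Ioc t₀ t₁) \ U).ncard + U.ncard := by exact_mod_cast h3
  have hU' : 2 * (U.ncard : ℝ) ≤ (blocks H A t₀ t₁).ncard := by exact_mod_cast hU
  linarith

theorem Typical.quality_le {δ r q T t₀ t₁ D Δ : ℝ} {n : ℕ} {H A U : Set ℝ}
    (h : Typical H A Δ δ r q T)
    (h0 : 0 ≤ t₀) (h01 : t₀ ≤ t₁) (h1 : t₁ ≤ T)
    (hU : 2 * U.ncard ≤ (blocks H A t₀ t₁).ncard + n) (hfin : U.Finite)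
    (hD : (((loners H Δ ∩ Set.Ioc t₀ t₁) \ U).ncard : ℝ) ≤ D) :
    δ * (t₁ - t₀) ≤ q + 2 * D + n := by
  have h2 := h.drift t₀ t₁ h0 h01 h1
  have h3 : (loners H Δ ∩ Set.Ioc t₀ t₁).ncard ≤
      ((loners H Δ ∩ Set.Ioc t₀ t₁) \ U).ncard + U.ncard := Set.ncard_le_ncard_sdiff_add_ncard _ _ hfin
  have h3' : ((loners H Δ ∩ Set.Ioc t₀ t₁).ncard : ℝ) ≤
      ((loners H Δ ∩ Set.Ioc t₀ t₁) \ U).ncard + U.ncard := by exact_mod_cast h3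
  have hU' : 2 * (U.ncard : ℝ) ≤ (blocks H A t₀ t₁).ncard + n := by exact_mod_cast hU
  linarith

theorem ncard_loners_le {H S : Set ℝ} {a b Δ : ℝ} (hH : Elections H) (hΔ : 0 < Δ) (hab : a ≤ b)
    (hS : S ⊆ loners H Δ) (hI : S ⊆ Set.Icc a b) : (S.ncard : ℝ) ≤ (b - a) / Δ + 1 :=
  ncard_le_of_separated hΔ hab hI fun x hx y hy => loners_separated hH x (hS hx) y (hS hy)

/-- Blocks lying on a chain are confirmed, but for the last few. -/
theorem Climbing.ncard_confirmed {G V : Set ℝ} {c : Chain} {d : ℕ} {S : Set Chain}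
    (hG : Climbing ex G) (hV : V ⊆ G) (hVfin : V.Finite) (hVc : ∀ g ∈ V, blk ex g <:+ c)
    (hS : ∀ g ∈ V, blk ex g <:+ c.drop d → blk ex g ∈ S) (hfin : S.Finite) :
    V.ncard ≤ S.ncard + d := by
  set W := {g | g ∈ V ∧ blk ex g <:+ c.drop d} with hW
  have h1 : W.ncard ≤ S.ncard :=
    Set.ncard_le_ncard_of_injOn (blk ex) (fun g hg => hS g hg.1 hg.2)
      (fun x hx y hy hxy => hG.eq (hV hx.1) (hV hy.1) (congrArg List.length hxy)) hfin
  have h2 : (V \ W).ncard ≤ (Set.Ioc (c.length - d) c.length).ncard := by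
    refine Set.ncard_le_ncard_of_injOn (fun g => (blk ex g).length) ?_
      (fun x hx y hy hxy => hG.eq (hV hx.1) (hV hy.1) hxy) (Set.finite_Ioc _ _)
    intro g hg
    refine ⟨?_, (hVc g hg.1).length_le⟩
    by_contra hle
    push Not at hle
    exact hg.2 ⟨hg.1, List.suffix_of_suffix_length_le (hVc g hg.1) (List.drop_suffix d c)
      (by simpa using hle)⟩
  have h3 : (Set.Ioc (c.length - d) c.length).ncard ≤ d := by
    rw [← Finset.coe_Ioc, Set.ncard_coe_finset, Nat.card_Ioc]
    omega
  have h4 := Set.ncard_le_ncard_sdiff_add_ncard V W (hVfin.subset fun g hg => hg.1)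
  omega

theorem finite_suffixes (c : Chain) : {b : Chain | b <:+ c}.Finite := by
  refine (List.finite_toSet c.tails).subset fun b hb => ?_
  simpa using hb

end Tips

/-! ### The synchronous setting -/

section Sync

variable {Node : Type*} {cfg : Config Node} {ex : Execution Node} {δ r q T : ℝ}

/-- A synchronous execution on top of a typical run of the mining processes. -/
structure SyncRun (cfg : Config Node) (ex : Execution Node) (δ r q T : ℝ) : Prop where
  adm : Admissible cfg ex 0
  third : HonestTwoThirds cfg
  delay : 0 < cfg.Δ
  interval : cfg.Δ ≤ cfg.e
  typical : Typical ex.H ex.A cfg.Δ δ r q T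
  drift_pos : 0 < δ
  rate_nonneg : 0 ≤ r
  slack_nonneg : 0 ≤ q
  depth : r * ((q + 8) / δ + 3 * cfg.Δ) + q < cfg.k

/-- The chains of nodes that have heard of no certificate of iteration `N` are at least as long as
all chains held by honest nodes before. -/
def Grows (cfg : Config Node) (ex : Execution Node) (T : ℝ) (N : ℕ) : Prop :=
  ∀ j t d i s c, Tip cfg ex j t d → Unheard cfg ex j t N → Tip cfg ex i s c → t ≤ T → s ≤ T →
    (ex.ckpt j t <:+ c → c.length ≤ d.length) → c.length ≤ d.length

theorem SyncRun.heard_of_le (h : SyncRun cfg ex δ r q T) {i : Node} {m n : ℕ} {v : Chain} {t : ℝ}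
    (hi : i ∈ cfg.honest) (ho : ex.online i t)
    (hc : HeardCert cfg ex i t n v) (hmn : m ≤ n) : ∃ u, HeardCert cfg ex i t m u := by
  refine hc.of_le h.adm h.third h.delay h.interval hi ho ?_ hmn
  have h1 := hc.le_time h.adm h.third h.delay hi
  have h2 : 0 ≤ (n : ℝ) * cfg.e := mul_nonneg (by positivity) (h.delay.le.trans h.interval)
  linarith [h.delay]

theorem SyncRun.unheard (h : SyncRun cfg ex δ r q T) {i : Node} {n : ℕ} {t : ℝ}
    (hi : i ∈ cfg.honest) (ho : ex.online i t) (hc : ∀ v, ¬ HeardCert cfg ex i t n v) :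
    Unheard cfg ex i t n := fun m hm v hv => by
  obtain ⟨u, hu⟩ := h.heard_of_le hi ho hv hm
  exact hc u hu

theorem SyncRun.known_of_tip (h : SyncRun cfg ex δ r q T) {i j : Node} {s t : ℝ} {c : Chain}
    (hc : Tip cfg ex i s c) (hj : j ∈ cfg.honest) (ho : ex.online j t)
    (hst : max s 0 + cfg.Δ ≤ t) : KnownChain ex j t c ∧ ∀ b ∈ c, b.time < t :=
  ⟨hc.known.transfer h.adm hc.honest hj hst ho, fun b hb => by
    have := (hc.mined h.adm).time_le hb
    linarith [le_max_left s 0, h.delay]⟩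

/-- The block is delivered within `Δ`, so `Tip.longest` gives the comparison when it contains the
node's checkpoint. `Grows` removes precisely this proviso. -/
theorem SyncRun.blk_le (h : SyncRun cfg ex δ r q T) {N : ℕ} (hg : Grows cfg ex T N) {j : Node}
    {t x : ℝ} {d : Chain} (hd : Tip cfg ex j t d) (hu : Unheard cfg ex j t N) (hx : x ∈ ex.H)
    (hxt : x + cfg.Δ ≤ t) (htT : t ≤ T) : (blk ex x).length ≤ d.length := by
  have hb := tip_blk h.adm hx
  have hx0 := h.typical.honest.pos x hx
  obtain ⟨h1, h2⟩ := h.known_of_tip hb hd.honest hd.online (by rw [max_eq_left hx0.le]; exact hxt)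
  exact hg _ _ _ _ _ _ hd hu hb htT (by linarith [h.delay]) fun hc => hd.longest _ h1 h2 hc

theorem SyncRun.climbing (h : SyncRun cfg ex δ r q T) {N : ℕ} (hg : Grows cfg ex T N) :
    Climbing ex {g | g ∈ loners ex.H cfg.Δ ∧ g ≤ T ∧ Unheard cfg ex (ex.miner g) g N} := by
  refine ⟨fun x hx => hx.1.1, fun x hx y hy hxy => ?_⟩
  have := h.blk_le hg (tip_base h.adm hy.1.1) hy.2.2 hx.1.1
    (loners_separated h.typical.honest x hx.1 y hy.1 hxy) hy.2.1
  rw [length_blk y]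
  omega

theorem SyncRun.mem_of_unheard (h : SyncRun cfg ex δ r q T) {N : ℕ} {j : Node} {t x : ℝ}
    (hj : j ∈ cfg.honest) (ho : ex.online j t) (hu : Unheard cfg ex j t N)
    (hx : x ∈ loners ex.H cfg.Δ) (hxt : x + cfg.Δ ≤ t) (htT : t ≤ T) :
    x ∈ {g | g ∈ loners ex.H cfg.Δ ∧ g ≤ T ∧ Unheard cfg ex (ex.miner g) g N} := by
  refine ⟨hx, by linarith [h.delay], fun n hn v hv => ?_⟩
  have hx0 := h.typical.honest.pos x hx.1
  exact hu n hn v (hv.transfer h.adm (tip_base h.adm hx.1).honest hj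
    (by rw [max_eq_left hx0.le]; exact hxt) ho)

/-- Common prefix for the nodes that have not heard of a certificate of iteration `N`. -/
theorem SyncRun.share_of_grows (h : SyncRun cfg ex δ r q T) {N : ℕ} (hg : Grows cfg ex T N)
    {i j : Node} {s t : ℝ} {c d : Chain} (hc : Tip cfg ex i s c) (hcu : Unheard cfg ex i s N)
    (hd : Tip cfg ex j t d) (hdu : Unheard cfg ex j t N) (hst : s ≤ t) (htT : t ≤ T) :
    Share ex (s - (q + 8) / δ) c d := by
  have hΔ := h.delay
  have hH := h.typical.honest
  have hℓ : 0 ≤ (q + 8) / δ := div_nonneg (by linarith [h.slack_nonneg]) h.drift_pos.le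
  rcases lt_or_ge s 0 with hs0 | hs0
  · exact ⟨[], List.nil_suffix, List.nil_suffix, Or.inl ⟨rfl, by linarith⟩⟩
  obtain ⟨t₀, t₁, ht₀, ht₀s, hst₁, ht₁, hcommon, hcount⟩ := (h.climbing hg).fork hH
    h.typical.adv hΔ hs0 hst (hc.mined h.adm) (hd.mined h.adm)
    (fun x hx hxs => h.blk_le hg hc hcu hx.1.1 (by linarith) (hst.trans htT))
    (fun x hx hxs => h.blk_le hg hd hdu hx.1.1 (by linarith) htT)
  set G := {g | g ∈ loners ex.H cfg.Δ ∧ g ≤ T ∧ Unheard cfg ex (ex.miner g) g N} with hG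
  set U := G ∩ (Set.Ioc t₀ (s - cfg.Δ) ∪ Set.Ioc s (t₁ - cfg.Δ)) with hU
  have hUfin : U.Finite := (hH.finite T).subset fun x hx => ⟨hx.1.1.1, hx.1.2.1⟩
  -- Only loners within `Δ` before `s` or `t₁` are missing: at most two for each, hence `D = 4` and
  -- the term `8` in the window length.
  have hsub : (loners ex.H cfg.Δ ∩ Set.Ioc t₀ t₁) \ U ⊆
      (loners ex.H cfg.Δ ∩ Set.Icc (s - cfg.Δ) s) ∪
      (loners ex.H cfg.Δ ∩ Set.Icc (t₁ - cfg.Δ) t₁) := by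
    rintro x ⟨⟨hx, hx0, hx1⟩, hxU⟩
    by_contra hno
    simp only [Set.mem_union, Set.mem_inter_iff, Set.mem_Icc, not_or, not_and, not_le] at hno
    rcases le_or_gt x (s - cfg.Δ) with h1 | h1
    · exact hxU ⟨h.mem_of_unheard hc.honest hc.online hcu hx (by linarith) (hst.trans htT),
        Or.inl ⟨hx0, h1⟩⟩
    · have h2 := hno.1 hx h1.le
      rcases le_or_gt x (t₁ - cfg.Δ) with h3 | h3
      · exact hxU ⟨h.mem_of_unheard hd.honest hd.online hdu hx (by linarith) htT,
          Or.inr ⟨h2, h3⟩⟩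
      · linarith [hno.2 hx h3.le]
  have hw : ∀ y, ((loners ex.H cfg.Δ ∩ Set.Icc (y - cfg.Δ) y).ncard : ℝ) ≤ 2 := fun y => by
    have := ncard_loners_le hH hΔ (show y - cfg.Δ ≤ y by linarith)
      (Set.inter_subset_left (s := loners ex.H cfg.Δ)) Set.inter_subset_right
    rw [sub_sub_cancel, div_self hΔ.ne'] at this
    linarith
  have hfin : ∀ y, (loners ex.H cfg.Δ ∩ Set.Icc (y - cfg.Δ) y).Finite := fun y =>
    (hH.finite y).subset fun x hx => ⟨hx.1.1, hx.2.2⟩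
  have hD : (((loners ex.H cfg.Δ ∩ Set.Ioc t₀ t₁) \ U).ncard : ℝ) ≤ 4 := by
    have h1 := (Set.ncard_le_ncard hsub ((hfin s).union (hfin t₁))).trans (Set.ncard_union_le _ _)
    have h2 : (((loners ex.H cfg.Δ ∩ Set.Ioc t₀ t₁) \ U).ncard : ℝ) ≤
      (loners ex.H cfg.Δ ∩ Set.Icc (s - cfg.Δ) s).ncard +
      (loners ex.H cfg.Δ ∩ Set.Icc (t₁ - cfg.Δ) t₁).ncard := by exact_mod_cast h1
    linarith [hw s, hw t₁]
  have hlen := h.typical.window_le ht₀ (ht₀s.trans hst₁) (ht₁.trans htT) hcount hUfin hD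
  have hlen' : t₁ - t₀ ≤ (q + 8) / δ := by
    rw [le_div_iff₀ h.drift_pos]; linarith
  rcases hcommon with rfl | ⟨hgG, h1, h2⟩
  · exact ⟨[], List.nil_suffix, List.nil_suffix, Or.inl ⟨rfl, by linarith⟩⟩
  · exact ⟨_, h1, h2, Or.inr ⟨t₀, hH.pos _ hgG.1.1, by linarith, rfl⟩⟩

theorem SyncRun.blocks_lt (h : SyncRun cfg ex δ r q T) {a t : ℝ} (ha : t - a ≤ (q + 8) / δ + 3 * cfg.Δ)
    (ht : 0 ≤ t) (hat : a ≤ t) (htT : t ≤ T) :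
    (blocks ex.H ex.A (max a 0) t).ncard < cfg.k := by
  have h1 := h.typical.total (max a 0) t (le_max_right _ _) (max_le hat ht) htT
  have h2 : r * (t - max a 0) ≤ r * ((q + 8) / δ + 3 * cfg.Δ) :=
    mul_le_mul_of_nonneg_left (by linarith [le_max_left a 0]) h.rate_nonneg
  have h3 := h.depth
  exact_mod_cast (show ((blocks ex.H ex.A (max a 0) t).ncard : ℝ) < cfg.k by linarith)

/-- The induction settles one more certificate at a time. The critical case is that of `j` having
heard of iteration `N` and `i` not yet; the two chains are compared through the one held by an
honest soft-voter of the certified value. -/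
theorem SyncRun.grows (h : SyncRun cfg ex δ r q T) (N : ℕ) : Grows cfg ex T N := by
  have hadm := h.adm
  have hΔ := h.delay
  have he := hΔ.trans_le h.interval
  have hH := h.typical.honest
  have hA := h.typical.adv
  have hℓ : 0 ≤ (q + 8) / δ := div_nonneg (by linarith [h.slack_nonneg]) h.drift_pos.le
  induction N with
  | zero =>
    intro j t d i s c hd hu hc htT hsT hcmp
    refine hcmp ?_
    rcases hadm.last_ckpt j hd.honest t with ⟨-, h1⟩ | ⟨n, v, hn, -⟩
    · rw [h1]; exact List.nil_suffix
    · exact absurd hn (hu n (by omega) v)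
  | succ N ih =>
    intro j t d i s c hd hu hc htT hsT hcmp
    by_cases hjN : ∃ v, HeardCert cfg ex j t N v
    swap
    · push Not at hjN
      exact ih j t d i s c hd (h.unheard hd.honest hd.online hjN) hc htT hsT hcmp
    obtain ⟨v, hv⟩ := hjN
    have hB := ckpt_eq_of_last hadm h.third hd.honest hv hu
    by_cases hiN : Unheard cfg ex i s N
    swap
    · unfold Unheard at hiN
      push Not at hiN
      obtain ⟨n, hn, u, hu'⟩ := hiN
      refine hcmp (List.IsSuffix.trans ?_ hc.ckpt)
      rw [hB]
      exact hv.suffix_ckpt hadm h.third hΔ he hd.honest hc.honest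
        (hadm.last_ckpt i hc.honest s) ⟨n, u, hn, hu'⟩
    obtain ⟨i', hi', p, s', hs', hst, hno, hkv, hBh⟩ := hv.witness hadm h.third hd.honest
    have hs0 : 0 ≤ s' := by
      have h1 := hs'.ready.le_time hadm h.third hΔ hi'
      have : 0 ≤ (N : ℝ) * cfg.e + 4 * cfg.Δ * p := by positivity
      linarith
    have hu' : Unheard cfg ex i' s' N :=
      h.unheard hi' hs'.online (hno s' (by linarith))
    have htip := tip_held hadm hi' hs'.online
    have hcs := (hc.mined hadm).eq_nil_of_nonpos hH hA
    rcases lt_or_ge s 0 with hneg | hsnn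
    · rw [hcs hneg.le]; simp
    -- The voter `i'` knows `c` already, so its chain is at least as long as `c`. That chain
    -- contains the new checkpoint and reaches `j` in time, because soft-votes are cast `2Δ` after
    -- the start of the period.
    by_cases hcase : s + cfg.Δ ≤ s'
    · obtain ⟨h1, h2⟩ := h.known_of_tip hc hi' hs'.online (by rwa [max_eq_left hsnn])
      have h3 := ih i' s' _ i s c htip hu' hc (by linarith) hsT (htip.longest c h1 h2)
      obtain ⟨h4, h5⟩ := h.known_of_tip htip hd.honest hd.online
        (by rw [max_eq_left hs0]; linarith)
      exact h3.trans (hd.longest _ h4 h5 (hB ▸ hBh))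
    · push Not at hcase
      refine hcmp (hB ▸ ?_)
      -- Otherwise common prefix applies to nodes that have not heard of iteration `N`. Since `v` is
      -- mined by `s' + 2Δ`, fewer than `k` blocks postdate the shared one, so `c` contains the
      -- checkpoint and `hcmp` applies.
      have hsh : Share ex (s' - (q + 8) / δ - cfg.Δ) (ex.held i' s') c := by
        rcases le_total s' s with hle | hle
        · exact (h.share_of_grows ih htip hu' hc hiN hle hsT).mono (by linarith)
        · exact (h.share_of_grows ih hc hiN htip hu' hle (by linarith)).symm.mono (by linarith)
      exact hsh.ckpt_suffix hH hA (hkv.mined hadm hi') hBh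
        (h.blocks_lt (by linarith) (by linarith) (by linarith) (by linarith))

/-! ### Security of the adaptive rule -/

theorem SyncRun.length_le (h : SyncRun cfg ex δ r q T) {i j : Node} {s t : ℝ} {c d : Chain}
    (hd : Tip cfg ex j t d) (hc : Tip cfg ex i s c) (ht : t ≤ T) (hs : s ≤ T)
    (hcmp : ex.ckpt j t <:+ c → c.length ≤ d.length) : c.length ≤ d.length := by
  obtain ⟨N, hN⟩ := exists_unheard h.adm hd.honest t
  exact h.grows N j t d i s c hd hN hc ht hs hcmp

theorem SyncRun.share (h : SyncRun cfg ex δ r q T) {i j : Node} {s t : ℝ} {c d : Chain}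
    (hc : Tip cfg ex i s c) (hd : Tip cfg ex j t d) (hst : s ≤ t) (htT : t ≤ T) :
    Share ex (s - (q + 8) / δ) c d := by
  obtain ⟨N, hN⟩ := exists_unheard h.adm hd.honest t
  obtain ⟨M, hM⟩ := exists_unheard h.adm hc.honest s
  exact h.share_of_grows (h.grows (max M N)) hc (hM.mono (le_max_left _ _)) hd
    (hN.mono (le_max_right _ _)) hst htT

theorem SyncRun.blocks_le (h : SyncRun cfg ex δ r q T) {s : ℝ} (hs0 : 0 ≤ s) (hsT : s ≤ T) {m : ℕ}
    (hm : r * ((q + 8) / δ) + q ≤ m) :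
    (blocks ex.H ex.A (max (s - (q + 8) / δ) 0) s).ncard ≤ m := by
  have hℓ : 0 ≤ (q + 8) / δ := div_nonneg (by linarith [h.slack_nonneg]) h.drift_pos.le
  have h1 := h.typical.total (max (s - (q + 8) / δ) 0) s (le_max_right _ _)
    (max_le (by linarith) hs0) hsT
  have h2 : r * (s - max (s - (q + 8) / δ) 0) ≤ r * ((q + 8) / δ) :=
    mul_le_mul_of_nonneg_left (by linarith [le_max_left (s - (q + 8) / δ) 0]) h.rate_nonneg
  exact_mod_cast (show ((blocks ex.H ex.A (max (s - (q + 8) / δ) 0) s).ncard : ℝ) ≤ m by linarith)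

theorem SyncRun.drop_suffix (h : SyncRun cfg ex δ r q T) {i j : Node} {s t : ℝ} {c d : Chain}
    (hc : Tip cfg ex i s c) (hd : Tip cfg ex j t d) (hst : s ≤ t) (htT : t ≤ T) {m : ℕ}
    (hm : r * ((q + 8) / δ) + q ≤ m) : c.drop m <:+ d := by
  have hH := h.typical.honest
  have hA := h.typical.adv
  rcases lt_or_ge s 0 with hs | hs
  · rw [(hc.mined h.adm).eq_nil_of_nonpos hH hA hs.le]
    simp
  · exact (h.share hc hd hst htT).drop_suffix hH hA (hc.mined h.adm)
      (h.blocks_le hs (hst.trans htT) hm)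

theorem SyncRun.drop_suffix_of_length_le (h : SyncRun cfg ex δ r q T) {i j : Node} {s t : ℝ}
    {c d : Chain} (hc : Tip cfg ex i s c) (hd : Tip cfg ex j t d) (hsT : s ≤ T) (htT : t ≤ T)
    {m : ℕ} (hm : r * ((q + 8) / δ) + q ≤ m) (hcd : c.length ≤ d.length) :
    c.drop m <:+ d.drop m := by
  rcases le_total s t with hst | hst
  · exact List.suffix_of_suffix_length_le (h.drop_suffix hc hd hst htT hm)
      (List.drop_suffix _ _) (by simp; omega)
  · exact List.suffix_of_suffix_length_le (List.drop_suffix _ _) (h.drop_suffix hd hc hst hsT hm)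
      (by simp; omega)

theorem SyncRun.safe (h : SyncRun cfg ex δ r q T) {depth : Node → ℕ}
    (hdepth : ∀ i, r * ((q + 8) / δ) + q ≤ depth i) : Safe cfg (confirmedAda ex depth) T := by
  have hadm := h.adm
  constructor
  · intro i hi s t hs hst htT b hb
    refine List.IsSuffix.trans hb ?_
    rcases held_eq_nil_or hadm hi s with h0 | ⟨u₀, hu₀, ho⟩
    · rw [h0]; simp
    -- Safety also concerns offline nodes; the held chains are traced back to online times `u ≤ u'`,
    -- at which the common prefix applies.
    obtain ⟨u, hu, hus, htip, -⟩ := exists_tip_held hadm h.third hi hu₀ ho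
    obtain ⟨u', hu', hut, htip', hlong⟩ := exists_tip_held hadm h.third hi (hus.trans hst) htip.online
    exact h.drop_suffix_of_length_le htip htip' (by linarith) (by linarith) (hdepth i)
      (h.length_le htip' htip (by linarith) (by linarith) fun hc =>
        hlong _ (htip.known.mono hu') hc)
  · intro i hi j hj s t _ hsT _ htT b hb b' hb'
    have key : (ex.held i s).drop (depth i) <:+ (ex.held j t).drop (depth j) ∨
        (ex.held j t).drop (depth j) <:+ (ex.held i s).drop (depth i) := by
      rcases held_eq_nil_or hadm hi s with h0 | ⟨u₀, hu₀, ho⟩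
      · left; rw [h0]; simp
      rcases held_eq_nil_or hadm hj t with h0 | ⟨u₁, hu₁, ho'⟩
      · right; rw [h0]; simp
      obtain ⟨u, -, hus, htip, -⟩ := exists_tip_held hadm h.third hi hu₀ ho
      obtain ⟨u', -, hut, htip', -⟩ := exists_tip_held hadm h.third hj hu₁ ho'
      rcases le_total u u' with hle | hle
      · exact List.suffix_or_suffix_of_suffix
          (h.drop_suffix htip htip' hle (by linarith) (hdepth i)) (List.drop_suffix _ _)
      · exact List.suffix_or_suffix_of_suffix (List.drop_suffix _ _)
          (h.drop_suffix htip' htip hle (by linarith) (hdepth j))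
    have hb : b <:+ (ex.held i s).drop (depth i) := hb
    have hb' : b' <:+ (ex.held j t).drop (depth j) := hb'
    rcases key with hc | hc
    · exact List.suffix_or_suffix_of_suffix (hb.trans hc) hb'
    · exact List.suffix_or_suffix_of_suffix hb (hb'.trans hc)

theorem floor_le_natCast {x : ℝ} {n : ℕ} (h : x ≤ n) : ⌊x⌋ ≤ (n : ℤ) := by
  have := Int.floor_le_floor h
  simpa using this

/-- Chain quality puts enough marked blocks mined after `s` on the held chain. At most `depth i` of
them are unconfirmed, and the `4` pays for the loners of the last `Δ`. -/
theorem SyncRun.live (h : SyncRun cfg ex δ r q T) {depth : Node → ℕ} {D : ℝ}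
    (hdepth : ∀ i, (depth i : ℝ) ≤ D) {c' : ℝ} (hc' : q + 4 + D ≤ c') :
    Live cfg ex (confirmedAda ex depth) 0 T δ c' := by
  have hadm := h.adm
  have hΔ := h.delay
  have hH := h.typical.honest
  have hA := h.typical.adv
  intro i hi s t hs hst htT ho
  refine floor_le_natCast ?_
  have htip := tip_held hadm hi ho
  obtain ⟨N, hN⟩ := exists_unheard hadm hi t
  have hg := h.grows N
  have hG := h.climbing hg
  obtain ⟨t₀, ht₀, ht₀s, hcount⟩ := hG.quality hH hA hΔ hs (htip.mined hadm)
    (fun x hx hxs => h.blk_le hg htip hN hx.1.1 (by linarith) htT)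
  set G := {g | g ∈ loners ex.H cfg.Δ ∧ g ≤ T ∧ Unheard cfg ex (ex.miner g) g N} with hGdef
  set V := {g | g ∈ G ∧ blk ex g <:+ ex.held i t ∧ s < g} with hV
  set U := G ∩ Set.Ioc t₀ (t - cfg.Δ) with hU
  have hUfin : U.Finite := (hH.finite T).subset fun x hx => ⟨hx.1.1.1, hx.1.2.1⟩
  have hsub : (loners ex.H cfg.Δ ∩ Set.Ioc t₀ t) \ U ⊆
      loners ex.H cfg.Δ ∩ Set.Icc (t - cfg.Δ) t := by
    rintro x ⟨⟨hx, hx0, hx1⟩, hxU⟩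
    refine ⟨hx, ?_, hx1⟩
    by_contra hlt
    push Not at hlt
    exact hxU ⟨h.mem_of_unheard hi ho hN hx (by linarith) htT, hx0, hlt.le⟩
  have hD : (((loners ex.H cfg.Δ ∩ Set.Ioc t₀ t) \ U).ncard : ℝ) ≤ 2 := by
    have h1 := Set.ncard_le_ncard hsub ((hH.finite t).subset fun x hx => ⟨hx.1.1, hx.2.2⟩)
    have h2 := ncard_loners_le hH hΔ (show t - cfg.Δ ≤ t by linarith)
      (Set.inter_subset_left (s := loners ex.H cfg.Δ)) Set.inter_subset_right
    rw [sub_sub_cancel, div_self hΔ.ne'] at h2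
    have h3 : (((loners ex.H cfg.Δ ∩ Set.Ioc t₀ t) \ U).ncard : ℝ) ≤
      (loners ex.H cfg.Δ ∩ Set.Icc (t - cfg.Δ) t).ncard := by exact_mod_cast h1
    linarith
  have hlen := h.typical.quality_le ht₀ (by linarith) htT hcount hUfin hD
  have hconf := hG.ncard_confirmed (V := V) (c := ex.held i t) (d := depth i)
    (S := {b | b ∈ confirmedAda ex depth i t ∧ b ∉ confirmedAda ex depth i s ∧ HonestBlock b})
    (fun g hg => hg.1) ((hH.finite T).subset fun x hx => ⟨hx.1.1.1, hx.1.2.1⟩) (fun g hg => hg.2.1)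
    (fun g hg hgd => ⟨hgd, fun hgs => ?_, ⟨g, true⟩, ex.base g, rfl, rfl⟩)
    ((finite_suffixes _).subset fun b hb => hb.1)
  · have h1 : (V.ncard : ℝ) ≤ ({b | b ∈ confirmedAda ex depth i t ∧ b ∉ confirmedAda ex depth i s ∧
        HonestBlock b}.ncard : ℝ) + depth i := by exact_mod_cast hconf
    have h2 := hdepth i
    have h3 : δ * (t - s) ≤ δ * (t - t₀) :=
      mul_le_mul_of_nonneg_left (by linarith) h.drift_pos.le
    linarith
  · have h1 : blk ex g <:+ ex.held i s := List.IsSuffix.trans hgs (List.drop_suffix _ _)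
    have h2 := (((hadm.holds i hi s).1).mined hadm hi).blk_time_le h1
    linarith [hg.2.2]

end Sync

/-! ### Progress of the agreement protocol after stabilization -/

section Progress

variable {Node : Type*} {cfg : Config Node} {ex : Execution Node} {GST : ℝ}

/-- An execution in the partially synchronous, sized setting. -/
structure SizedRun (cfg : Config Node) (ex : Execution Node) (GST : ℝ) : Prop where
  adm : Admissible cfg ex GST
  third : HonestTwoThirds cfg
  delay : 0 < cfg.Δ
  interval : cfg.Δ ≤ cfg.e
  gst : 0 ≤ GST
  online : ∀ i ∈ cfg.honest, ∀ t, 0 ≤ t → ex.online i t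

/-- No honest node has heard of a certificate of iteration `n` by time `t`. -/
def NoCert (cfg : Config Node) (ex : Execution Node) (n : ℕ) (t : ℝ) : Prop :=
  ∀ i ∈ cfg.honest, ∀ v, ¬ HeardCert cfg ex i t n v

theorem NoCert.mono {n : ℕ} {s t : ℝ} (h : NoCert cfg ex n t) (hst : s ≤ t) : NoCert cfg ex n s :=
  fun i hi v hv => h i hi v (hv.mono hst)

/-- `Starts` asks for an attained first time. Knowledge changes only at receipts, so finitely many
candidate times suffice. -/
theorem exists_isLeast_of_finite {P : ℝ → Prop} {C : Set ℝ} {t : ℝ} (hC : C.Finite) (ht : P t)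
    (h : ∀ s ≤ t, P s → ∃ u ∈ C, u ≤ s ∧ P u) : ∃ s ≤ t, IsLeast {s | P s} s := by
  obtain ⟨u, huC, hut, hu⟩ := h t le_rfl ht
  obtain ⟨m, hm, hmin⟩ := Set.exists_min_image (C ∩ {s | P s}) id (hC.subset Set.inter_subset_left)
    ⟨u, huC, hu⟩
  have hmt : m ≤ t := (hmin u ⟨huC, hu⟩).trans hut
  refine ⟨m, hmt, hm.2, fun s hs => ?_⟩
  rcases le_total s t with hst | hst
  · obtain ⟨u', hu'C, hu's, hu'⟩ := h s hst hs
    exact (hmin u' ⟨hu'C, hu'⟩).trans hu's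
  · exact hmt.trans hst

theorem finite_recv (ex : Execution Node) (i : Node) {ι : Type*} {S : Set ι} (hS : S.Finite)
    (m : ι → Msg Node) : {s : ℝ | ∃ x ∈ S, ex.recv i (m x) = s}.Finite := by
  have : {s : ℝ | ∃ x ∈ S, ex.recv i (m x) = s} = ⋃ x ∈ S, {s : ℝ | ex.recv i (m x) = s} := by
    ext; simp
  rw [this]
  refine hS.biUnion fun x _ => Set.Subsingleton.finite fun s hs t ht => ?_
  have h1 : ((s : ℝ) : WithTop ℝ) = t := hs.symm.trans ht
  exact WithTop.coe_injective h1

/-- By agreement only `⊥` and one chain can have quorums of next-votes, so finitely many messages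
matter. -/
theorem SizedRun.exists_isLeast_quorum (h : SizedRun cfg ex GST) {i : Node} (hi : i ∈ cfg.honest)
    {n p : ℕ} {t : ℝ} {w : Option Chain} (hq : Quorum cfg ex i t .next n p w) :
    ∃ s ≤ t, IsLeast {s | ∃ w, Quorum cfg ex i s .next n p w} s := by
  set W : Set (Option Chain) := {w | ∃ u, SentQuorum cfg ex u .next n p w} with hW
  have hWfin : W.Finite := by
    have hs : (some ⁻¹' W).Subsingleton := fun v ⟨u, hv⟩ v' ⟨u', hv'⟩ =>
      hv.next_unique h.adm h.third h.delay hv'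
    refine ((hs.finite.image some).insert none).subset fun w hw => ?_
    cases w with
    | none => simp
    | some v => exact Or.inr ⟨v, hw, rfl⟩
  refine exists_isLeast_of_finite (finite_recv ex i
    ((cfg.checkpointers.finite_toSet).prod hWfin)
    (fun x => .signed .next x.1 n p x.2)) ⟨w, hq⟩ fun s hst ⟨w', hw'⟩ => ?_
  obtain ⟨j, hj, u, hu, hr, hqu⟩ := hw'.exists_recv h.third
  exact ⟨u, ⟨(j, w'), ⟨hj, s, hw'.sent h.adm hi⟩, hr⟩, hu, w', hqu⟩

theorem SizedRun.exists_isLeast_heard (h : SizedRun cfg ex GST) {i : Node} (hi : i ∈ cfg.honest)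
    {n : ℕ} {t : ℝ} {v : Chain} (hc : HeardCert cfg ex i t n v) :
    ∃ s ≤ t, IsLeast {s | ∃ v, HeardCert cfg ex i s n v} s := by
  have hΔ := h.delay
  have he : 0 ≤ cfg.e := hΔ.le.trans h.interval
  have hfin : ((cfg.checkpointers : Set Node) ×ˢ Set.Iic ⌊t / (4 * cfg.Δ)⌋₊).Finite :=
    (cfg.checkpointers.finite_toSet).prod (Set.finite_Iic _)
  refine exists_isLeast_of_finite (finite_recv ex i hfin
    (fun x => .signed .cert x.1 n x.2 (some v))) ⟨v, hc⟩ fun s hst ⟨v', hv'⟩ => ?_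
  obtain rfl := hv'.agree h.adm h.third hi hi hc
  obtain ⟨p, hp⟩ := hv'
  obtain ⟨j, hj, u, hu, hr, hqu⟩ := hp.exists_recv h.third
  refine ⟨u, ⟨(j, p), ⟨hj, ?_⟩, hr⟩, hu, v', p, hqu⟩
  obtain ⟨j', hj', -, s', hs', h1⟩ := (hp.sent h.adm hi).honest h.third
  obtain ⟨x, -, s₀, hA, h2, -⟩ := sends_cert h1
  have h3 := hA.1.ready.le_time h.adm h.third hΔ hj'
  have h4 : 0 ≤ (n : ℝ) * cfg.e := by positivity
  simp only [Set.mem_Iic]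
  refine Nat.le_floor ?_
  rw [le_div_iff₀ (by positivity)]
  linarith

theorem SizedRun.exists_isLeast_ready (h : SizedRun cfg ex GST) {i : Node} (hi : i ∈ cfg.honest)
    {n p : ℕ} {t : ℝ} (hr : Ready cfg ex i n p t) :
    ∃ s ≤ t, IsLeast {s | ex.online i s ∧ Ready cfg ex i n p s} s := by
  have hΔ := h.delay
  have he : 0 ≤ cfg.e := hΔ.le.trans h.interval
  have hset : {s | ex.online i s ∧ Ready cfg ex i n p s} = {s | Ready cfg ex i n p s} := by
    ext s
    refine ⟨fun h => h.2, fun hs => ⟨h.online i hi s ?_, hs⟩⟩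
    have := Ready.le_time h.adm h.third hΔ hi hs
    have h4 : 0 ≤ (n : ℝ) * cfg.e + 4 * cfg.Δ * p := by positivity
    linarith
  rw [hset]
  rcases p with _ | p
  · rcases n with _ | n
    · simp only [ready_zero_zero] at hr ⊢
      exact ⟨0, hr, Set.mem_ofPred.2 le_rfl, fun s hs => hs⟩
    · simp only [ready_zero_succ] at hr ⊢
      obtain ⟨v, s, hv, hs⟩ := hr
      obtain ⟨m, hm, ⟨v', hv'⟩, hmin⟩ := h.exists_isLeast_heard hi hv
      refine ⟨m + cfg.e, by linarith, ⟨v', m, hv', le_rfl⟩, ?_⟩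
      rintro u ⟨x, y, hx, hy⟩
      have : m ≤ y := hmin ⟨x, hx⟩
      linarith
  · simp only [ready_succ] at hr ⊢
    obtain ⟨w, hw⟩ := hr
    exact h.exists_isLeast_quorum hi hw

theorem SizedRun.starts (h : SizedRun cfg ex GST) {i : Node} (hi : i ∈ cfg.honest)
    {n p : ℕ} {t : ℝ} (hr : Ready cfg ex i n p t)
    (hno : ∀ n' p', Later n p n' p' → ∀ u ≤ t, ¬ Ready cfg ex i n' p' u) :
    ∃ s ≤ t, Starts cfg ex i n p s := by
  obtain ⟨s, hst, hs⟩ := h.exists_isLeast_ready hi hr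
  exact ⟨s, hst, hs, fun n' p' hl u hu _ => hno n' p' hl u (hu.trans hst)⟩

theorem SizedRun.ready_nonneg (h : SizedRun cfg ex GST) {i : Node} (hi : i ∈ cfg.honest)
    {n p : ℕ} {t : ℝ} (hr : Ready cfg ex i n p t) : 0 ≤ t := by
  have h1 := hr.le_time h.adm h.third h.delay hi
  have h2 : 0 ≤ (n : ℝ) * cfg.e + 4 * cfg.Δ * p :=
    add_nonneg (mul_nonneg (by positivity) (h.delay.le.trans h.interval))
      (mul_nonneg (by linarith [h.delay]) (by positivity))
  linarith

/-! ### Transfer of knowledge after stabilization and the advance of periods -/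

theorem SizedRun.heard_transfer (h : SizedRun cfg ex GST) {i j : Node} {s t : ℝ} {n : ℕ}
    {v : Chain} (hj : j ∈ cfg.honest) (hi : i ∈ cfg.honest) (hc : HeardCert cfg ex j s n v)
    (hst : max s GST + cfg.Δ ≤ t) : HeardCert cfg ex i t n v :=
  hc.transfer h.adm hj hi hst
    (h.online i hi t (by linarith [le_max_right s GST, h.gst, h.delay]))

theorem SizedRun.quorum_transfer (h : SizedRun cfg ex GST) {i j : Node} {s t : ℝ} {kind : Kind}
    {n p : ℕ} {w : Option Chain} (hj : j ∈ cfg.honest) (hi : i ∈ cfg.honest)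
    (hq : Quorum cfg ex j s kind n p w) (hst : max s GST + cfg.Δ ≤ t) :
    Quorum cfg ex i t kind n p w :=
  hq.transfer h.adm hj hi hst
    (h.online i hi t (by linarith [le_max_right s GST, h.gst, h.delay]))

theorem SizedRun.prevNext_transfer (h : SizedRun cfg ex GST) {i j : Node} {s t : ℝ}
    {n p : ℕ} {w : Option Chain} (hj : j ∈ cfg.honest) (hi : i ∈ cfg.honest)
    (hq : PrevNext cfg ex j s n p w) (hst : max s GST + cfg.Δ ≤ t) :
    PrevNext cfg ex i t n p w :=
  hq.imp fun _ hp => ⟨hp.1, h.quorum_transfer hj hi hp.2 hst⟩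

/-- After stabilization, all honest nodes get ready for a period within `Δ` of each other. -/
theorem SizedRun.ready_transfer (h : SizedRun cfg ex GST) {i j : Node} {s : ℝ}
    {n p : ℕ} (hj : j ∈ cfg.honest) (hi : i ∈ cfg.honest)
    (hr : Ready cfg ex j n p s) (hs : GST + cfg.e ≤ s) : Ready cfg ex i n p (s + cfg.Δ) := by
  have hΔ := h.delay
  have he := hΔ.trans_le h.interval
  rcases p with _ | p
  · rcases n with _ | n
    · rw [ready_zero_zero] at hr ⊢; linarith
    · rw [ready_zero_succ] at hr ⊢
      obtain ⟨v, u, hv, hu⟩ := hr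
      refine ⟨v, max u GST + cfg.Δ, h.heard_transfer hj hi hv le_rfl, ?_⟩
      have : max u GST ≤ s - cfg.e := max_le (by linarith) (by linarith)
      linarith
  · rw [ready_succ] at hr ⊢
    obtain ⟨w, hw⟩ := hr
    refine ⟨w, h.quorum_transfer hj hi hw ?_⟩
    rw [max_eq_left (by linarith)]

/-- Later iterations require a certificate of iteration `n`, so only its later periods remain, and
these require an honest checkpointer to have spent `4Δ` in period `p`. -/
theorem SizedRun.later_ready (h : SizedRun cfg ex GST) {i : Node} {u : ℝ} {n p n' p' : ℕ}
    (hi : i ∈ cfg.honest) (hr : Ready cfg ex i n' p' u) (hl : Later n p n' p')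
    (hno : NoCert cfg ex n u) :
    ∃ j ∈ cfg.honest, j ∈ cfg.checkpointers ∧ ∃ s, Starts cfg ex j n p s ∧ s + 4 * cfg.Δ ≤ u := by
  have hΔ := h.delay
  have he := hΔ.trans_le h.interval
  rcases hl with hlt | ⟨rfl, hlt⟩
  · obtain ⟨m, rfl⟩ : ∃ m, n' = m + 1 := ⟨n' - 1, by omega⟩
    obtain ⟨j, hj, v, hv⟩ := hr.exists_heard h.adm h.third hΔ hi
    rcases (show n ≤ m by omega).eq_or_lt with rfl | hlt'
    · exact absurd (hv.mono (by linarith)) (hno j hj v)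
    · obtain ⟨j', hj', v', hv'⟩ := hv.exists_of_lt h.adm h.third hΔ he hlt' hj
      exact absurd (hv'.mono (by linarith)) (hno j' hj' v')
  · obtain ⟨j, hj, hjc, s, hs, hsu⟩ := hr.exists_starts_of_lt h.adm h.third hlt hi
    refine ⟨j, hj, hjc, s, hs, ?_⟩
    have h1 : (p : ℝ) + 1 ≤ p' := by exact_mod_cast hlt
    nlinarith

theorem quorum_of_honestCkpt (h : HonestTwoThirds cfg) {i : Node} {t : ℝ} {kind : Kind} {n p : ℕ}
    {w : Option Chain} (hk : ∀ j ∈ honestCkpt cfg, Known ex i t (.signed kind j n p w)) :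
    Quorum cfg ex i t kind n p w :=
  ⟨honestCkpt cfg, fun _ hj => (mem_honestCkpt.1 hj).1, (honestCkpt_card h).le, hk⟩

theorem SizedRun.quorum_of_sends (h : SizedRun cfg ex GST) {s t : ℝ} {kind : Kind} {n p : ℕ}
    {w : Option Chain} (hk : ∀ j ∈ honestCkpt cfg, ∃ u ≤ s, Sends cfg ex j u (.signed kind j n p w))
    (hst : max s GST + cfg.Δ ≤ t) {i : Node} (hi : i ∈ cfg.honest) :
    Quorum cfg ex i t kind n p w := by
  refine quorum_of_honestCkpt h.third fun j hj => ?_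
  have hjh := (mem_honestCkpt.1 hj).2
  obtain ⟨u, hu, hs⟩ := hk j hj
  refine ((h.adm.own j hjh _ _ hs).mono hu).transfer h.adm hjh hi hst
    (h.online i hi t (by linarith [le_max_right s GST, h.gst, h.delay]))

/-- As long as an iteration has no certificate, its periods keep advancing. -/
theorem SizedRun.advance (h : SizedRun cfg ex GST) {n p : ℕ} {t : ℝ} (ht : GST + cfg.e ≤ t)
    (hall : ∀ i ∈ cfg.honest, Ready cfg ex i n p t) (hno : NoCert cfg ex n (t + 6 * cfg.Δ)) :
    ∀ i ∈ cfg.honest, Ready cfg ex i n (p + 1) (t + 7 * cfg.Δ) := by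
  have hΔ := h.delay
  have he := hΔ.trans_le h.interval
  have hadm := h.adm
  have h4 : max (t + 4 * cfg.Δ) GST = t + 4 * cfg.Δ := max_eq_left (by linarith)
  have h5 : max (t + 5 * cfg.Δ) GST = t + 5 * cfg.Δ := max_eq_left (by linarith)
  -- If some honest node is already ahead, some honest node has been ready for period `p + 1`, and
  -- all others follow within `Δ`. Otherwise all stay in period `p` long enough to cast the same
  -- next-vote.
  by_cases hlate : ∃ i ∈ cfg.honest, ∃ n' p', Later n p n' p' ∧
      ∃ u ≤ t + 5 * cfg.Δ, Ready cfg ex i n' p' u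
  · obtain ⟨j, hj, n', p', hl, u, hu, hr⟩ := hlate
    have : ∃ j' ∈ cfg.honest, Ready cfg ex j' n (p + 1) u := by
      rcases hl with hlt | ⟨rfl, hlt⟩
      · obtain ⟨j', hj', -, s, hs, hsu⟩ := h.later_ready hj hr
          (Or.inl hlt : Later n (p + 1) n' p') (hno.mono (by linarith))
        exact ⟨j', hj', hs.ready.mono (by linarith)⟩
      · rcases (show p + 1 ≤ p' by omega).eq_or_lt with rfl | hlt'
        · exact ⟨j, hj, hr⟩
        · obtain ⟨j', hj', -, s, hs, hsu⟩ := h.later_ready hj hr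
            (Or.inr ⟨rfl, hlt'⟩ : Later n (p + 1) n p') (hno.mono (by linarith))
          exact ⟨j', hj', hs.ready.mono (by linarith)⟩
    obtain ⟨j', hj', hr'⟩ := this
    intro i hi
    exact (h.ready_transfer hj' hi (hr'.mono hu) (by linarith)).mono (by linarith)
  push Not at hlate
  have hstart : ∀ i ∈ cfg.honest, ∃ s ≤ t, Starts cfg ex i n p s := fun i hi =>
    h.starts hi (hall i hi) fun n' p' hl u hu => hlate i hi n' p' hl u (by linarith)
  choose! ρ hρt hρ using hstart
  have hact : ∀ i ∈ cfg.honest, ∀ u, ρ i ≤ u → u ≤ t + 5 * cfg.Δ →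
      Active cfg ex i n p (ρ i) u := fun i hi u hu hut =>
    ⟨hρ i hi, hu, h.online i hi u ((h.ready_nonneg hi (hρ i hi).ready).trans hu),
      fun n' p' hl u' hu' _ => hlate i hi n' p' hl u' (by linarith),
      fun v u' hu' hv => hno i hi v (hv.mono (by linarith))⟩
  suffices hs : ∃ w, ∀ j ∈ honestCkpt cfg, ∃ u ≤ t + 5 * cfg.Δ,
      Sends cfg ex j u (.signed .next j n p w) by
    obtain ⟨w, hw⟩ := hs
    intro i hi
    exact ready_succ.2 ⟨w, h.quorum_of_sends hw (by rw [h5]; linarith) hi⟩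
  -- A soft-vote quorum known to one is known to all by `t + 5Δ` and decides the common next-vote.
  -- Failing this nobody cert-votes, and a known quorum for `⊥` decides likewise.
  by_cases hsoft : ∃ i ∈ cfg.honest, ∃ v, Quorum cfg ex i (t + 4 * cfg.Δ) .soft n p (some v)
  · obtain ⟨i, hi, v, hq⟩ := hsoft
    refine ⟨some v, fun j hj => ?_⟩
    obtain ⟨hjc, hjh⟩ := mem_honestCkpt.1 hj
    have := hρt j hjh
    refine ⟨t + 5 * cfg.Δ, le_rfl, rfl, hjc, Or.inr ⟨ρ j, hact j hjh _ (by linarith) le_rfl,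
      by linarith, Or.inl ⟨v, h.quorum_transfer hi hjh hq (by rw [h4]; linarith), rfl⟩⟩⟩
  push Not at hsoft
  have hncert : ∀ j ∈ cfg.honest, ∀ u v, ¬ Certified cfg ex j n p u v := by
    rintro j hj u v ⟨u', -, s, hA, -, hu', hq⟩
    obtain rfl := hA.1.eq (hρ j hj)
    exact hsoft j hj v (hq.mono (by linarith [hρt j hj]))
  by_cases hbot : ∃ i ∈ cfg.honest, PrevNext cfg ex i (t + 4 * cfg.Δ) n p none
  · obtain ⟨i, hi, hq⟩ := hbot
    refine ⟨none, fun j hj => ?_⟩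
    obtain ⟨hjc, hjh⟩ := mem_honestCkpt.1 hj
    have := hρt j hjh
    refine ⟨t + 5 * cfg.Δ, le_rfl, rfl, hjc, Or.inr ⟨ρ j, hact j hjh _ (by linarith) le_rfl,
      by linarith, Or.inr ⟨h.prevNext_transfer hi hjh hq (by rw [h4]; linarith),
      fun v => hncert j hjh _ v, rfl⟩⟩⟩
  push Not at hbot
  -- In the last case everyone next-votes its starting value. These are all `⊥` in the first period,
  -- and otherwise chains with quorums of next-votes, which agree by uniqueness.
  have hstv : ∃ w, ∀ j ∈ cfg.honest, ex.startVal j n p = w := by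
    rcases p with _ | p
    · exact ⟨none, fun j hj => hadm.start_zero j hj n⟩
    · have hsome : ∀ j ∈ cfg.honest, ∃ v, ex.startVal j n (p + 1) = some v := by
        intro j hj
        have h1 := hadm.start_succ j hj n p (ρ j) (hρ j hj)
        cases h2 : ex.startVal j n (p + 1) with
        | none => rw [h2] at h1; exact absurd (h1.mono (by linarith [hρt j hj])) (hbot j hj)
        | some v => exact ⟨v, rfl⟩
      obtain ⟨j₀, hj₀⟩ : (honestCkpt cfg).Nonempty :=
        Finset.card_pos.1 (by have := honestCkpt_card h.third; omega)
      have hj₀ := (mem_honestCkpt.1 hj₀).2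
      refine ⟨ex.startVal j₀ n (p + 1), fun j hj => ?_⟩
      obtain ⟨v, hv⟩ := hsome j hj
      obtain ⟨v', hv'⟩ := hsome j₀ hj₀
      have h1 := hadm.start_succ j hj n p (ρ j) (hρ j hj)
      have h2 := hadm.start_succ j₀ hj₀ n p (ρ j₀) (hρ j₀ hj₀)
      rw [hv, prevNext_succ] at h1
      rw [hv', prevNext_succ] at h2
      rw [hv, hv', (h1.sent hadm hj).next_unique hadm h.third hΔ (h2.sent hadm hj₀)]
  obtain ⟨w, hw⟩ := hstv
  refine ⟨w, fun j hj => ?_⟩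
  obtain ⟨hjc, hjh⟩ := mem_honestCkpt.1 hj
  have h1 := hρt j hjh
  exact ⟨ρ j + 4 * cfg.Δ, by linarith, rfl, hjc, Or.inl ⟨ρ j,
    hact j hjh _ (by linarith) (by linarith), rfl, Or.inr (Or.inr
    ⟨fun v => hncert j hjh _ v, fun hp => hbot j hjh (hp.mono (by linarith)), (hw j hjh).symm⟩)⟩⟩

/-! ### Rounds -/

/-- The times at which the honest checkpointers are first ready for the period `p` of iteration
`n`; they lie within `Δ` of each other. -/
structure FirstReady (cfg : Config Node) (ex : Execution Node) (n p : ℕ) (s₁ : ℝ) (ρ : Node → ℝ) :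
    Prop where
  least : ∀ i ∈ honestCkpt cfg, IsLeast {s | ex.online i s ∧ Ready cfg ex i n p s} (ρ i)
  ge : ∀ i ∈ honestCkpt cfg, s₁ ≤ ρ i
  le : ∀ i ∈ honestCkpt cfg, ρ i ≤ s₁ + cfg.Δ

theorem SizedRun.exists_firstReady (h : SizedRun cfg ex GST) {n p : ℕ} {T t : ℝ}
    (hT : GST + cfg.e ≤ T) (hno : ∀ i ∈ honestCkpt cfg, ∀ u < T, ¬ Ready cfg ex i n p u)
    (hall : ∀ i ∈ cfg.honest, Ready cfg ex i n p t) :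
    ∃ s₁ ρ, T ≤ s₁ ∧ s₁ ≤ t ∧ FirstReady cfg ex n p s₁ ρ := by
  have hex : ∀ i ∈ cfg.honest, ∃ s ≤ t, IsLeast {s | ex.online i s ∧ Ready cfg ex i n p s} s :=
    fun i hi => h.exists_isLeast_ready hi (hall i hi)
  choose! ρ hρt hρ using hex
  obtain ⟨i₁, hi₁, hmin⟩ := Finset.exists_min_image (honestCkpt cfg) ρ
    (Finset.card_pos.1 (by have := honestCkpt_card h.third; omega))
  have hh := (mem_honestCkpt.1 hi₁).2
  have hT1 : T ≤ ρ i₁ := by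
    by_contra hlt
    push Not at hlt
    exact hno i₁ hi₁ _ hlt (hρ i₁ hh).1.2
  refine ⟨ρ i₁, ρ, hT1, hρt i₁ hh, fun i hi => hρ i (mem_honestCkpt.1 hi).2, hmin, fun i hi => ?_⟩
  have hi := (mem_honestCkpt.1 hi).2
  have hr := h.ready_transfer hh hi (hρ i₁ hh).1.2 (by linarith)
  exact (hρ i hi).2 ⟨h.online i hi _ (h.ready_nonneg hi hr), hr⟩

/-- A period all of which the honest checkpointers spend together. -/
structure Round (cfg : Config Node) (ex : Execution Node) (n p : ℕ) (s₁ : ℝ) (ρ : Node → ℝ) :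
    Prop where
  starts : ∀ i ∈ honestCkpt cfg, Starts cfg ex i n p (ρ i)
  ge : ∀ i ∈ honestCkpt cfg, s₁ ≤ ρ i
  le : ∀ i ∈ honestCkpt cfg, ρ i ≤ s₁ + cfg.Δ
  active : ∀ i ∈ honestCkpt cfg, ∀ u, ρ i ≤ u → u ≤ s₁ + 4 * cfg.Δ → Active cfg ex i n p (ρ i) u

/-- Nobody can leave the period before an honest checkpointer has spent `4Δ` in it, and none starts
it before `s₁`. -/
theorem SizedRun.round (h : SizedRun cfg ex GST) {n p : ℕ} {s₁ : ℝ} {ρ : Node → ℝ}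
    (hf : FirstReady cfg ex n p s₁ ρ) (hno : NoCert cfg ex n (s₁ + 5 * cfg.Δ)) :
    Round cfg ex n p s₁ ρ := by
  have hΔ := h.delay
  have hlater : ∀ i ∈ honestCkpt cfg, ∀ n' p', Later n p n' p' → ∀ u < s₁ + 4 * cfg.Δ,
      ¬ Ready cfg ex i n' p' u := by
    intro i hi n' p' hl u hu hr
    obtain ⟨j, hj, hjc, s, hs, hsu⟩ := h.later_ready (mem_honestCkpt.1 hi).2 hr hl
      (hno.mono (by linarith))
    have hj' := mem_honestCkpt.2 ⟨hjc, hj⟩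
    have h1 := (hf.least j hj').unique hs.1
    have h2 := hf.ge j hj'
    linarith
  have hst : ∀ i ∈ honestCkpt cfg, Starts cfg ex i n p (ρ i) := fun i hi =>
    ⟨hf.least i hi, fun n' p' hl u hu _ => hlater i hi n' p' hl u (by linarith [hf.le i hi])⟩
  refine ⟨hst, hf.ge, hf.le, fun i hi u hu hu4 => ?_⟩
  have hih := (mem_honestCkpt.1 hi).2
  exact ⟨hst i hi, hu, h.online i hih u ((h.ready_nonneg hih (hst i hi).ready).trans hu),
    fun n' p' hl u' hu' _ => hlater i hi n' p' hl u' (by linarith),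
    fun v u' hu' hv => hno i hih v (hv.mono (by linarith))⟩

/-- Soft-votes are out by `s₁ + 3Δ` and known by `s₁ + 4Δ`. At that moment every clock shows between
`3Δ` and `4Δ`, so all can still cert-vote. -/
theorem SizedRun.heard_of_soft (h : SizedRun cfg ex GST) {n p : ℕ} {s₁ : ℝ} {ρ : Node → ℝ}
    (hR : Round cfg ex n p s₁ ρ) (hs : GST ≤ s₁) {v : Chain}
    (hv : ∀ i ∈ honestCkpt cfg, ex.softVal i n p = some v) :
    ∀ i ∈ cfg.honest, HeardCert cfg ex i (s₁ + 5 * cfg.Δ) n v := by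
  have hΔ := h.delay
  have h3 : max (s₁ + 3 * cfg.Δ) GST = s₁ + 3 * cfg.Δ := max_eq_left (by linarith)
  have h4 : max (s₁ + 4 * cfg.Δ) GST = s₁ + 4 * cfg.Δ := max_eq_left (by linarith)
  have hq : ∀ i ∈ cfg.honest, Quorum cfg ex i (s₁ + 4 * cfg.Δ) .soft n p (some v) := by
    intro i hi
    refine h.quorum_of_sends (s := s₁ + 3 * cfg.Δ) (fun j hj => ?_) (by rw [h3]; linarith) hi
    obtain ⟨hjc, hjh⟩ := mem_honestCkpt.1 hj
    have h1 := hR.le j hj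
    exact ⟨ρ j + 2 * cfg.Δ, by linarith, rfl, hjc, v, rfl, ρ j,
      hR.active j hj _ (by linarith) (by linarith), rfl, hv j hj⟩
  intro i hi
  refine ⟨p, h.quorum_of_sends (s := s₁ + 4 * cfg.Δ) (fun j hj => ?_) (by rw [h4]; linarith) hi⟩
  obtain ⟨hjc, hjh⟩ := mem_honestCkpt.1 hj
  have h1 := hR.le j hj
  have h2 := hR.ge j hj
  exact ⟨s₁ + 4 * cfg.Δ, le_rfl, rfl, hjc, v, rfl, ρ j, hR.active j hj _ (by linarith) le_rfl,
    by linarith, by linarith, hq j hjh⟩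

theorem sends_propose {j : Node} {s : ℝ} {n p : ℕ} {w : Option Chain}
    (h : Sends cfg ex j s (.signed .propose j n p w)) :
    ∃ v, w = some v ∧ Proposes cfg ex j n p s v :=
  h.2.2

/-- What an honest leader is known to have proposed. -/
theorem Known.proposes (hadm : Admissible cfg ex GST) {i : Node} {t : ℝ} {n p : ℕ} {v : Chain}
    (hi : i ∈ cfg.honest) (hl : ex.leader n p ∈ cfg.honest)
    (hk : Known ex i t (.signed .propose (ex.leader n p) n p (some v))) :
    ∃ s ≤ t, Proposes cfg ex (ex.leader n p) n p s v := by
  obtain ⟨r, hr, hrt⟩ := known_iff.1 hk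
  obtain ⟨s, hs, hsend⟩ := (hadm.authentic i hi _ r hr).2 _ _ n p _ rfl hl
  obtain ⟨x, hx, h1⟩ := sends_propose hsend
  simp only [Option.some.injEq] at hx
  exact ⟨s, hs.trans hrt, hx ▸ h1⟩

/-- An honest leader that knows no quorum of next-votes for `⊥` gets its proposal certified. -/
theorem SizedRun.leader_fresh (h : SizedRun cfg ex GST) {n p : ℕ} {s₁ : ℝ} {ρ : Node → ℝ}
    (hR : Round cfg ex n p s₁ ρ) (hs : GST ≤ s₁) (hno : NoCert cfg ex n (s₁ + 5 * cfg.Δ))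
    (hl : ex.leader n p ∈ cfg.honest) :
    Fresh cfg ex (ex.leader n p) (ρ (ex.leader n p)) n p := by
  have hΔ := h.delay
  have hadm := h.adm
  by_contra hf
  have hlm : ex.leader n p ∈ honestCkpt cfg := mem_honestCkpt.2 ⟨hadm.leader_mem n p, hl⟩
  set l := ex.leader n p with hldef
  have hstl := hR.starts l hlm
  obtain ⟨q, rfl⟩ : ∃ q, p = q + 1 := ⟨p - 1, by
    have : p ≠ 0 := fun h0 => hf (Or.inl h0)
    omega⟩
  have hpn := hadm.start_succ l hl n q _ hstl
  obtain ⟨v, hv⟩ : ∃ v, ex.startVal l n (q + 1) = some v := by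
    cases h2 : ex.startVal l n (q + 1) with
    | none => rw [h2] at hpn; exact absurd (Or.inr hpn) hf
    | some v => exact ⟨v, rfl⟩
  rw [hv] at hpn
  have hle := hR.le l hlm
  have hge := hR.ge l hlm
  have hml : max (ρ l) GST = ρ l := max_eq_left (by linarith)
  have hsend : Sends cfg ex l (ρ l) (.signed .propose l n (q + 1) (some v)) :=
    ⟨rfl, hadm.leader_mem n (q + 1), v, rfl, hR.active l hlm _ le_rfl (by linarith), rfl,
      Or.inr ⟨hf, hpn⟩⟩
  have huniq : ∀ i ∈ cfg.honest, ∀ t y, PrevNext cfg ex i t n (q + 1) (some y) → y = v := by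
    intro i hi t y hy
    exact ((prevNext_succ.1 hy).sent hadm hi).next_unique hadm h.third hΔ
      ((prevNext_succ.1 hpn).sent hadm hl)
  -- A leader that is not fresh proposes a value `v` with a quorum of next-votes. Proposal and
  -- quorum reach everyone by clock `2Δ`, so whether or not a node is fresh it soft-votes `v`, which
  -- gets certified, against `hno`.
  refine absurd (h.heard_of_soft hR hs (v := v) fun i hi => ?_) fun hc => hno l hl v (hc l hl)
  have hih := (mem_honestCkpt.1 hi).2
  have hgei := hR.ge i hi
  have hsti := hR.starts i hi
  have hpni : PrevNext cfg ex i (ρ i + 2 * cfg.Δ) n (q + 1) (some v) :=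
    h.prevNext_transfer hl hih hpn (by rw [hml]; linarith)
  have hki : Known ex i (ρ i + 2 * cfg.Δ) (.signed .propose l n (q + 1) (some v)) :=
    (hadm.own l hl _ _ hsend).transfer hadm hl hih (by rw [hml]; linarith)
      (h.online i hih _ (by linarith [h.ready_nonneg hih hsti.ready]))
  cases hsv : ex.softVal i n (q + 1) with
  | none =>
    refine absurd ?_ (hadm.soft_none i hih n (q + 1) _ hsti hsv v)
    by_cases hfi : Fresh cfg ex i (ρ i + 2 * cfg.Δ) n (q + 1)
    · exact Or.inl ⟨hfi, hki, Or.inr hpni⟩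
    · exact Or.inr ⟨hfi, hpni⟩
  | some y =>
    rcases hadm.soft_some i hih n (q + 1) _ hsti y hsv with ⟨-, hk, -⟩ | ⟨-, hp⟩
    · obtain ⟨s, -, hA, -, ⟨hfl, -⟩ | ⟨-, hp⟩⟩ := hk.proposes hadm hih hl
      · obtain rfl := hA.1.eq hstl
        exact absurd hfl hf
      · rw [huniq _ hl _ y hp]
    · rw [huniq i hih _ y hp]

/-- If an honest leader knows a quorum of next-votes for `⊥`, then nothing but the chain it holds
is soft-voted. -/
theorem SizedRun.soft_eq_held (h : SizedRun cfg ex GST) {n p : ℕ} {s₁ : ℝ} {ρ : Node → ℝ}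
    (hR : Round cfg ex n p s₁ ρ) (hs : GST ≤ s₁) (hl : ex.leader n p ∈ cfg.honest)
    (hf : Fresh cfg ex (ex.leader n p) (ρ (ex.leader n p)) n p) {i : Node}
    (hi : i ∈ honestCkpt cfg) :
    Fresh cfg ex i (ρ i + 2 * cfg.Δ) n p ∧
    (∀ y, ex.softVal i n p = some y → y = ex.held (ex.leader n p) (ρ (ex.leader n p))) ∧
    (Valid cfg ex i n (ρ i) (ρ i + 2 * cfg.Δ) (ex.held (ex.leader n p) (ρ (ex.leader n p))) →
      ex.softVal i n p = some (ex.held (ex.leader n p) (ρ (ex.leader n p)))) := by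
  have hΔ := h.delay
  have hadm := h.adm
  have hlm : ex.leader n p ∈ honestCkpt cfg := mem_honestCkpt.2 ⟨hadm.leader_mem n p, hl⟩
  set l := ex.leader n p with hldef
  have hstl := hR.starts l hlm
  have hle := hR.le l hlm
  have hge := hR.ge l hlm
  have hml : max (ρ l) GST = ρ l := max_eq_left (by linarith)
  have hih := (mem_honestCkpt.1 hi).2
  have hgei := hR.ge i hi
  have hsti := hR.starts i hi
  have hfi : Fresh cfg ex i (ρ i + 2 * cfg.Δ) n p :=
    hf.imp_right fun hp => h.prevNext_transfer hl hih hp (by rw [hml]; linarith)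
  have hy : ∀ y, ex.softVal i n p = some y → y = ex.held l (ρ l) := by
    intro y hsv
    rcases hadm.soft_some i hih n p _ hsti y hsv with ⟨-, hk, -⟩ | ⟨hnf, -⟩
    · obtain ⟨s, -, hA, -, ⟨-, hv⟩ | ⟨hnf, -⟩⟩ := hk.proposes hadm hih hl
      · obtain rfl := hA.1.eq hstl
        exact hv
      · obtain rfl := hA.1.eq hstl
        exact absurd hf hnf
    · exact absurd hfi hnf
  refine ⟨hfi, hy, fun hval => ?_⟩
  have hsend : Sends cfg ex l (ρ l) (.signed .propose l n p (some (ex.held l (ρ l)))) :=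
    ⟨rfl, hadm.leader_mem n p, _, rfl, hR.active l hlm _ le_rfl (by linarith), rfl,
      Or.inl ⟨hf, rfl⟩⟩
  have hki : Known ex i (ρ i + 2 * cfg.Δ) (.signed .propose l n p (some (ex.held l (ρ l)))) :=
    (hadm.own l hl _ _ hsend).transfer hadm hl hih (by rw [hml]; linarith)
      (h.online i hih _ (by linarith [h.ready_nonneg hih hsti.ready]))
  cases hsv : ex.softVal i n p with
  | none =>
    exact absurd (Or.inl ⟨hfi, hki, Or.inl hval⟩) (hadm.soft_none i hih n p _ hsti hsv _)
  | some y => rw [hy y hsv]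

/-- The time within which an iteration passes through `R` more periods. -/
noncomputable def span (cfg : Config Node) (R : ℕ) : ℝ := 7 * cfg.Δ * (R + 1)

/-- An iteration without certificate soon reaches a period with an honest leader. -/
theorem SizedRun.exists_round (h : SizedRun cfg ex GST) {n p₀ R : ℕ} {T : ℝ}
    (hT : GST + cfg.e ≤ T) (hready : ∃ i ∈ cfg.honest, Ready cfg ex i n p₀ T)
    (hno : NoCert cfg ex n (T + span cfg R))
    (hlead : ∀ p : ℕ, n * cfg.e + 4 * cfg.Δ * p ≤ T + 4 * cfg.Δ →
      ∃ m < R, ex.leader n (p + m) ∈ cfg.honest) :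
    ∃ p, p₀ < p ∧ ∃ s₁ ρ, T ≤ s₁ ∧ s₁ + 5 * cfg.Δ ≤ T + span cfg R ∧ Round cfg ex n p s₁ ρ ∧
      ex.leader n p ∈ cfg.honest := by
  have hΔ := h.delay
  have he := hΔ.trans_le h.interval
  -- Beyond the largest period reached by time `T`, every period begins after `T` for all honest
  -- nodes. The honest leader is sought among the `R` periods from `p₁ + 1` on.
  obtain ⟨p₁, hp₁, ⟨i₁, hi₁, hr₁⟩, hmax⟩ : ∃ p₁ ≥ p₀, (∃ i ∈ cfg.honest, Ready cfg ex i n p₁ T) ∧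
      ∀ i ∈ cfg.honest, ∀ p > p₁, ¬ Ready cfg ex i n p T := by
    classical
    have hfin : {p | ∃ i ∈ cfg.honest, Ready cfg ex i n p T}.Finite := by
      refine (Set.finite_Iic ⌊T / (4 * cfg.Δ)⌋₊).subset ?_
      rintro p ⟨i, hi, hr⟩
      have h3 := hr.le_time h.adm h.third hΔ hi
      have h4 : 0 ≤ (n : ℝ) * cfg.e := by positivity
      simp only [Set.mem_Iic]
      refine Nat.le_floor ?_
      rw [le_div_iff₀ (by positivity)]
      linarith
    obtain ⟨p₁, hp₁, hm⟩ := Set.exists_max_image _ id hfin ⟨p₀, hready⟩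
    exact ⟨p₁, hm p₀ hready, hp₁, fun i hi p hp hr => absurd (hm p ⟨i, hi, hr⟩) (by simpa using hp)⟩
  have hle₁ := hr₁.le_time h.adm h.third hΔ hi₁
  obtain ⟨m, hm, hlm⟩ := hlead (p₁ + 1) (by push_cast; linarith)
  have hspan : ∀ j : ℕ, j ≤ R → T + cfg.Δ + 7 * cfg.Δ * j + 6 * cfg.Δ ≤ T + span cfg R := by
    intro j hj
    have : (j : ℝ) ≤ R := by exact_mod_cast hj
    unfold span
    nlinarith
  have hadv : ∀ j : ℕ, j ≤ R → ∀ i ∈ cfg.honest,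
      Ready cfg ex i n (p₁ + j) (T + cfg.Δ + 7 * cfg.Δ * j) := by
    intro j
    induction j with
    | zero =>
      intro _ i hi
      simpa using h.ready_transfer hi₁ hi hr₁ hT
    | succ j ih =>
      intro hj i hi
      have hp : 0 ≤ 7 * cfg.Δ * (j : ℝ) := by positivity
      have := h.advance (by linarith) (ih (by omega))
        (hno.mono (by have := hspan j (by omega); linarith)) i hi
      refine this.mono ?_
      push_cast
      linarith
  have hall := hadv (m + 1) (by omega)
  have hsp := hspan (m + 1) (by omega)
  have hp : p₁ + (m + 1) = p₁ + 1 + m := by omega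
  rw [hp] at hall
  obtain ⟨s₁, ρ, hTs, hst, hf⟩ := h.exists_firstReady hT (fun i hi u hu hr =>
    hmax i (mem_honestCkpt.1 hi).2 (p₁ + 1 + m) (by omega) (hr.mono hu.le)) hall
  exact ⟨p₁ + 1 + m, by omega, s₁, ρ, hTs, by linarith,
    h.round hf (hno.mono (by linarith)), hlm⟩

end Progress

/-! ### Recovery after stabilization -/

section Recovery

variable {Node : Type*} {cfg : Config Node} {ex : Execution Node} {GST δ r q T : ℝ} {R : ℕ}

/-- If an iteration lasts long after time `T` and is certified in the end, then after time `T` some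
honest node holds a chain that contains the new checkpoint. -/
theorem SizedRun.exists_holder (h : SizedRun cfg ex GST) {N : ℕ} {T : ℝ} (hT : GST + cfg.e ≤ T)
    (hno : NoCert cfg ex N (T + cfg.Δ + span cfg R))
    (hlead : ∀ p : ℕ, N * cfg.e + 4 * cfg.Δ * p ≤ T + 5 * cfg.Δ →
      ∃ m < R, ex.leader N (p + m) ∈ cfg.honest)
    {j : Node} (hj : j ∈ cfg.honest) {t : ℝ} {v : Chain} (hc : HeardCert cfg ex j t N v) :
    ∃ i ∈ cfg.honest, ∃ s, T ≤ s ∧ s + cfg.Δ ≤ t ∧ (∀ x, ¬ HeardCert cfg ex i s N x) ∧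
      v.drop cfg.k <:+ ex.held i s := by
  have hΔ := h.delay
  have hadm := h.adm
  have htt : T + cfg.Δ + span cfg R ≤ t := by
    by_contra hlt
    push Not at hlt
    exact hno j hj v (hc.mono hlt.le)
  obtain ⟨p, hp⟩ := hc
  have hcert := hp.sent hadm hj
  have hsoftp := hcert.cert_soft hadm h.third
  obtain ⟨p₀, hp₀, hsoft, hval, hnext⟩ := SentQuorum.origin hadm h.third (Or.inl hsoftp)
  obtain ⟨i, hi, -, s, hs, h1⟩ := hsoft.honest h.third
  obtain ⟨s₀, hs₀, rfl, -, h2, h3, h4⟩ := hval i hi s hs h1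
  rcases le_or_gt T s₀ with hTs | hsT
  · exact ⟨i, hi, s₀, hTs, by linarith, fun x => h2 s₀ (by linarith) x, h4.2⟩
  have hr : Ready cfg ex i N p₀ (T + cfg.Δ) := hs₀.ready.mono (by linarith)
  obtain ⟨p', hp', s₁, ρ, hTs, hsw, hR, hl⟩ := h.exists_round (by linarith) ⟨i, hi, hr⟩ hno
    (fun p hp => hlead p (by linarith))
  have hGs : GST ≤ s₁ := by linarith [hΔ.trans_le h.interval]
  have hno' : NoCert cfg ex N (s₁ + 5 * cfg.Δ) := hno.mono hsw
  -- As `p'` is not a first period, freshness means a quorum for `⊥` in the period before, and only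
  -- the leader's own chain can gather soft-votes in period `p'`.
  have hf := h.leader_fresh hR hGs hno' hl
  have hlm : ex.leader N p' ∈ honestCkpt cfg := mem_honestCkpt.2 ⟨hadm.leader_mem N p', hl⟩
  set l := ex.leader N p' with hldef
  by_cases hw : v = ex.held l (ρ l)
  · have hge := hR.ge l hlm
    have hle := hR.le l hlm
    refine ⟨l, hl, ρ l, by linarith, by linarith, fun x hx => hno l hl x (hx.mono (by linarith)), ?_⟩
    rw [← hw]
    exact List.drop_suffix _ _
  exfalso
  have hnosoft : ∀ u, ¬ SentQuorum cfg ex u .soft N p' (some v) := by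
    intro u hu
    obtain ⟨j', hj', hjc', s', -, hs'⟩ := hu.honest h.third
    obtain ⟨y, hy, _, _, _, hsv⟩ := sends_soft hs'
    simp only [Option.some.injEq] at hy
    subst hy
    exact hw ((h.soft_eq_held hR hGs hl hf (mem_honestCkpt.2 ⟨hjc', hj'⟩)).2.1 _ hsv)
  -- Suppose the leader does not hold `v`. If `v` is certified after `p'`, it needs next-votes in
  -- `p'`, but without soft-votes for `v`, and with the quorum for `⊥` known to all, none can be
  -- cast. Certification in `p'` needs soft-votes for `v`. Certification before `p'` would have
  -- locked out the quorum for `⊥`.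
  rcases lt_trichotomy p' p with hlt | rfl | hlt
  · obtain ⟨j', hj', hjc', s', -, hs'⟩ := (hnext p' hp'.le hlt).honest h.third
    have hjm := mem_honestCkpt.2 ⟨hjc', hj'⟩
    obtain ⟨s₂, hA, -, ⟨x, hx, hx2⟩ | ⟨hx, -⟩ | ⟨-, hnp, -⟩⟩ := sends_next hs'
    · rw [← hx] at hx2
      exact hnosoft _ (hx2.sent hadm hj')
    · simp at hx
    · obtain rfl := hA.1.eq (hR.starts j' hjm)
      rcases (h.soft_eq_held hR hGs hl hf hjm).1 with h0 | hpn
      · omega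
      · exact hnp (hpn.mono (by linarith))
  · exact hnosoft _ hsoftp
  · obtain ⟨q', rfl⟩ : ∃ q', p' = q' + 1 := ⟨p' - 1, by omega⟩
    rcases hf with h0 | hpn
    · simp at h0
    · have := hcert.lock hadm h.third (show p ≤ q' by omega) _ _
        ((prevNext_succ.1 hpn).sent hadm hl)
      simp at this

/-- A certificate that arrives shortly after time `g` may undo the growth of the chains at `g`. -/
def Wasted (cfg : Config Node) (ex : Execution Node) (R : ℕ) (g : ℝ) : Prop :=
  ∃ N, ¬ NoCert cfg ex N (g + 2 * cfg.Δ + span cfg R) ∧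
    ∃ i ∈ cfg.honest, ∀ v, ¬ HeardCert cfg ex i g N v

/-- A sized execution on top of typical mining processes and leaders. -/
structure FinRun (cfg : Config Node) (ex : Execution Node) (GST δ r q T : ℝ) (R : ℕ) : Prop
    extends SizedRun cfg ex GST where
  typical : Typical ex.H ex.A cfg.Δ δ r q T
  drift_pos : 0 < δ
  rate_nonneg : 0 ≤ r
  slack_nonneg : 0 ≤ q
  lead : ∀ n p : ℕ, n * cfg.e + 4 * cfg.Δ * p ≤ T + 10 * cfg.Δ →
    ∃ m < R, ex.leader n (p + m) ∈ cfg.honest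
  long : 2 * cfg.Δ * (7 * R + 10) ≤ cfg.e
  waste : 8 * (7 * R + 11) ≤ δ * cfg.e
  depth : r * (2 * (q + 8 + 2 * (7 * R + 11)) / δ + cfg.Δ) + q ≤ cfg.k

theorem FinRun.unheard (h : FinRun cfg ex GST δ r q T R) {i : Node} {n : ℕ} {t : ℝ}
    (hi : i ∈ cfg.honest) (ht : GST + cfg.Δ ≤ t) (hc : ∀ v, ¬ HeardCert cfg ex i t n v) :
    Unheard cfg ex i t n := fun m hm v hv => by
  obtain ⟨u, hu⟩ := hv.of_le h.adm h.third h.delay h.interval hi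
    (h.online i hi t (by linarith [h.gst, h.delay])) ht hm
  exact hc u hu

theorem FinRun.known_of_tip (h : FinRun cfg ex GST δ r q T R) {i j : Node} {s t : ℝ} {c : Chain}
    (hc : Tip cfg ex i s c) (hj : j ∈ cfg.honest) (hs : GST ≤ s)
    (hst : s + cfg.Δ ≤ t) : KnownChain ex j t c ∧ ∀ b ∈ c, b.time < t :=
  ⟨hc.known.transfer h.adm hc.honest hj (by rwa [max_eq_left hs])
    (h.online j hj t (by linarith [h.gst, h.delay])), fun b hb => by
    have := (hc.mined h.adm).time_le hb
    linarith [h.delay]⟩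

/-- The same induction on certificates as in synchrony, but without common prefix. Since `s` is not
wasted, a certificate unknown to `i` at `s` comes so late that its checkpoint lies in a chain held
at `s + Δ` or later; by induction that chain is at least as long as `c`. -/
theorem FinRun.length_le (h : FinRun cfg ex GST δ r q T R) (N : ℕ) :
    ∀ {j : Node} {t : ℝ} {d : Chain} {i : Node} {s : ℝ} {c : Chain}, Tip cfg ex j t d →
      Unheard cfg ex j t N → Tip cfg ex i s c → GST + cfg.e ≤ s → ¬ Wasted cfg ex R s →
      s + cfg.Δ ≤ t → t ≤ T → c.length ≤ d.length := by
  have hadm := h.adm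
  have hΔ := h.delay
  have he := hΔ.trans_le h.interval
  induction N with
  | zero =>
    intro j t d i s c hd hu hc hs _ hst _
    obtain ⟨h1, h2⟩ := h.known_of_tip hc hd.honest (by linarith) hst
    refine hd.longest c h1 h2 ?_
    rcases hadm.last_ckpt j hd.honest t with ⟨-, h1⟩ | ⟨n, v, hn, -⟩
    · rw [h1]; exact List.nil_suffix
    · exact absurd hn (hu n (by omega) v)
  | succ N ih =>
    intro j t d i s c hd hu hc hs hw hst htT
    have hint := h.interval
    by_cases hjN : ∃ v, HeardCert cfg ex j t N v
    swap
    · push Not at hjN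
      exact ih hd (h.unheard hd.honest (by linarith) hjN) hc hs hw hst htT
    obtain ⟨v, hv⟩ := hjN
    have hB := ckpt_eq_of_last hadm h.third hd.honest hv hu
    by_cases hiN : Unheard cfg ex i s N
    swap
    · unfold Unheard at hiN
      push Not at hiN
      obtain ⟨n, hn, u, hu'⟩ := hiN
      obtain ⟨h1, h2⟩ := h.known_of_tip hc hd.honest (by linarith) hst
      refine hd.longest c h1 h2 (List.IsSuffix.trans ?_ hc.ckpt)
      rw [hB]
      exact hv.suffix_ckpt hadm h.third hΔ he hd.honest hc.honest
        (hadm.last_ckpt i hc.honest s) ⟨n, u, hn, hu'⟩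
    have hno : NoCert cfg ex N (s + cfg.Δ + cfg.Δ + span cfg R) := by
      by_contra hno
      refine hw ⟨N, ?_, i, hc.honest, hiN N le_rfl⟩
      rwa [show s + 2 * cfg.Δ = s + cfg.Δ + cfg.Δ by ring]
    obtain ⟨i', hi', s', hs', hst', hno', hBh⟩ := h.exists_holder (by linarith) hno
      (fun p hp => h.lead N p (by linarith)) hd.honest hv
    have htip := tip_held hadm hi' (h.online i' hi' s' (by linarith [h.gst]))
    have h3 := ih htip (h.unheard hi' (by linarith) hno') hc hs hw hs' (by linarith)
    obtain ⟨h4, h5⟩ := h.known_of_tip htip hd.honest (by linarith) hst'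
    exact h3.trans (hd.longest _ h4 h5 (hB ▸ hBh))

/-- The loners that let all chains grow. -/
def useful (cfg : Config Node) (ex : Execution Node) (GST T : ℝ) (R : ℕ) : Set ℝ :=
  {g | g ∈ loners ex.H cfg.Δ ∧ GST + cfg.e ≤ g ∧ g ≤ T ∧ ¬ Wasted cfg ex R g}

theorem FinRun.blk_le (h : FinRun cfg ex GST δ r q T R) {j : Node} {t x : ℝ} {d : Chain}
    (hd : Tip cfg ex j t d) (hx : x ∈ useful cfg ex GST T R) (hxt : x + cfg.Δ ≤ t) (ht : t ≤ T) :
    (blk ex x).length ≤ d.length := by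
  obtain ⟨N, hN⟩ := exists_unheard h.adm hd.honest t
  exact h.length_le N hd hN (tip_blk h.adm hx.1.1) hx.2.1 hx.2.2.2 hxt ht

theorem FinRun.climbing (h : FinRun cfg ex GST δ r q T R) :
    Climbing ex (useful cfg ex GST T R) := by
  refine ⟨fun x hx => hx.1.1, fun x hx y hy hxy => ?_⟩
  have := h.blk_le (tip_base h.adm hy.1.1) hx
    (loners_separated h.typical.honest x hx.1 y hy.1 hxy) hy.2.2.1
  rw [length_blk y]
  omega

/-- A certificate heard anywhere shortly after `g₂` is heard everywhere `Δ` later, and a certificate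
of an earlier iteration was heard `e` before it. -/
theorem FinRun.wasted_close (h : FinRun cfg ex GST δ r q T R) {g₁ g₂ : ℝ} {N₁ N₂ : ℕ}
    (hg₁ : GST + cfg.e ≤ g₁) (hN : N₁ ≤ N₂)
    (h₁ : ∃ i ∈ cfg.honest, ∀ v, ¬ HeardCert cfg ex i g₁ N₁ v)
    (h₂ : ¬ NoCert cfg ex N₂ (g₂ + 2 * cfg.Δ + span cfg R)) :
    g₁ ≤ g₂ + 3 * cfg.Δ + span cfg R - (if N₁ < N₂ then cfg.e else 0) := by
  have hΔ := h.delay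
  have he := hΔ.trans_le h.interval
  have hint := h.interval
  obtain ⟨i, hi, hno⟩ := h₁
  unfold NoCert at h₂
  push Not at h₂
  obtain ⟨j, hj, v, hv⟩ := h₂
  by_contra hlt
  push Not at hlt
  split_ifs at hlt with hc
  · obtain ⟨j', hj', u, hu⟩ := hv.exists_of_lt h.adm h.third hΔ he hc hj
    exact hno u (h.heard_transfer hj' hi hu (by rw [← max_add_add_right]; exact max_le (by linarith) (by linarith)))
  · obtain rfl : N₁ = N₂ := by omega
    exact hno v (h.heard_transfer hj hi hv (by rw [← max_add_add_right]; exact max_le (by linarith) (by linarith)))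

/-- Few loners are wasted. -/
theorem FinRun.ncard_wasted_le (h : FinRun cfg ex GST δ r q T R) {a b : ℝ}
    (ha : GST + cfg.e ≤ a) (hab : a ≤ b) :
    (({g | g ∈ loners ex.H cfg.Δ ∧ Wasted cfg ex R g} ∩ Set.Icc a b).ncard : ℝ) ≤
      δ / 4 * (b - a) + (7 * R + 11) := by
  classical
  have hΔ := h.delay
  have he := hΔ.trans_le h.interval
  have hH := h.typical.honest
  set B : ℝ := 7 * R + 11 with hB
  have hBpos : 0 < B := by positivity
  set W : ℝ := 3 * cfg.Δ + span cfg R with hW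
  have hWeq : W = cfg.Δ * (7 * R + 10) := by rw [hW, span]; ring
  have hWpos : 0 < W := by rw [hWeq]; positivity
  have hlong : 2 * W ≤ cfg.e := by rw [hWeq]; linarith [h.long]
  set S := {g | g ∈ loners ex.H cfg.Δ ∧ Wasted cfg ex R g} ∩ Set.Icc a b with hS
  have hSfin : S.Finite := (hH.finite b).subset fun x hx => ⟨hx.1.1.1, hx.2.2⟩
  -- wasted loners within half an interval of each other are close to each other
  have close : ∀ x ∈ S, ∀ y ∈ S, x ≤ y → y < x + cfg.e / 2 → y ≤ x + W := by
    rintro x ⟨⟨-, N, hx1, hx2⟩, hxa⟩ y ⟨⟨-, M, hy1, hy2⟩, hya⟩ hxy hlt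
    rcases lt_or_ge N M with hNM | hNM
    · have := h.wasted_close (by linarith [hxa.1]) hNM.le hx2 hy1
      rw [if_pos hNM] at this
      linarith
    · have := h.wasted_close (by linarith [hya.1]) hNM hy2 hx1
      split_ifs at this <;> linarith
  -- Time is cut into pieces of length `e / 2`. The wasted loners of one piece lie within `W = Δ *
  -- (7 * R + 10)` of each other, so there are at most `7 * R + 11` of them.
  set f : ℝ → ℕ := fun x => ⌊(x - a) / (cfg.e / 2)⌋₊ with hf
  have hfib : ∀ n ∈ hSfin.toFinset.image f, (hSfin.toFinset.filter (fun x => f x = n)).card ≤ 7 * R + 11 := by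
    intro n hn
    set F := hSfin.toFinset.filter (fun x => f x = n) with hF
    rcases F.eq_empty_or_nonempty with h0 | hne
    · rw [h0]; simp
    obtain ⟨x, hx, hmin⟩ := Finset.exists_min_image F id hne
    have hmem : ∀ y ∈ F, y ∈ S ∧ f y = n := fun y hy => by simpa [hF] using hy
    have hnear : ∀ y ∈ F, y < x + cfg.e / 2 := by
      intro y hy
      have h1 := (hmem x hx).2
      have h2 := (hmem y hy).2
      have h3 : 0 ≤ (x - a) / (cfg.e / 2) := div_nonneg (by linarith [(hmem x hx).1.2.1]) (by linarith)
      have h4 := Nat.floor_le h3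
      have h5 := Nat.lt_floor_add_one ((y - a) / (cfg.e / 2))
      simp only [hf] at h1 h2
      rw [h1] at h4
      rw [h2] at h5
      rw [le_div_iff₀ (by linarith)] at h4
      rw [div_lt_iff₀ (by linarith)] at h5
      linarith
    have hsub : (F : Set ℝ) ⊆ Set.Icc x (x + W) := fun y hy =>
      ⟨hmin y hy, close x (hmem x hx).1 y (hmem y hy).1 (hmin y hy) (hnear y hy)⟩
    have := ncard_loners_le hH hΔ (show x ≤ x + W by linarith)
      (fun y hy => (hmem y hy).1.1.1 : (F : Set ℝ) ⊆ loners ex.H cfg.Δ) hsub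
    rw [Set.ncard_coe_finset, add_sub_cancel_left, hWeq, mul_div_cancel_left₀ _ hΔ.ne'] at this
    exact_mod_cast (show (F.card : ℝ) ≤ 7 * R + 11 by linarith)
  have hcard := Finset.card_le_mul_card_image hSfin.toFinset (7 * R + 11) hfib
  have himg : ((hSfin.toFinset.image f).card : ℝ) ≤ (b - a) / (cfg.e / 2) + 1 := by
    have h0 : 0 ≤ (b - a) / (cfg.e / 2) := div_nonneg (by linarith) (by linarith)
    have hsub : hSfin.toFinset.image f ⊆ Finset.range (⌊(b - a) / (cfg.e / 2)⌋₊ + 1) := by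
      intro n hn
      simp only [Finset.mem_image, Set.Finite.mem_toFinset] at hn
      obtain ⟨x, hx, rfl⟩ := hn
      rw [Finset.mem_range]
      have : f x ≤ ⌊(b - a) / (cfg.e / 2)⌋₊ := by
        simp only [hf]
        gcongr
        exact hx.2.2
      omega
    have h1 := Finset.card_le_card hsub
    rw [Finset.card_range] at h1
    calc ((hSfin.toFinset.image f).card : ℝ) ≤ ((⌊(b - a) / (cfg.e / 2)⌋₊ + 1 : ℕ) : ℝ) := by
          exact_mod_cast h1
      _ = (⌊(b - a) / (cfg.e / 2)⌋₊ : ℝ) + 1 := by push_cast; ring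
      _ ≤ _ := by gcongr; exact Nat.floor_le h0
  have hSc : (S.ncard : ℝ) ≤ B * ((b - a) / (cfg.e / 2) + 1) := by
    rw [Set.ncard_eq_toFinset_card S hSfin]
    calc (hSfin.toFinset.card : ℝ) ≤ (((7 * R + 11) * (hSfin.toFinset.image f).card : ℕ) : ℝ) := by
          exact_mod_cast hcard
      _ = B * ((hSfin.toFinset.image f).card : ℝ) := by push_cast; ring
      _ ≤ _ := by gcongr
  have hle : B / (cfg.e / 2) ≤ δ / 4 := by
    rw [div_le_iff₀ (by linarith)]
    linarith [h.waste]
  calc (S.ncard : ℝ) ≤ B * ((b - a) / (cfg.e / 2) + 1) := hSc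
    _ = B / (cfg.e / 2) * (b - a) + B := by ring
    _ ≤ δ / 4 * (b - a) + B := by
        have := mul_le_mul_of_nonneg_right hle (show 0 ≤ b - a by linarith)
        linarith

/-- The loners of an interval that are not useful. -/
theorem FinRun.ncard_useless_le (h : FinRun cfg ex GST δ r q T R) {a b P : ℝ} {U : Set ℝ} {n : ℕ}
    {E : Fin n → ℝ} (ha : 0 ≤ a) (hab : a ≤ b) (hbT : b ≤ T)
    (hP : (a < GST + cfg.e → (GST + cfg.e) / cfg.Δ + 1 ≤ P) ∧ 0 ≤ P)
    (hU : ∀ x ∈ useful cfg ex GST T R, a < x → x ≤ b → x ∉ U →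
      ∃ y, x ∈ Set.Icc (E y - cfg.Δ) (E y)) :
    (((loners ex.H cfg.Δ ∩ Set.Ioc a b) \ U).ncard : ℝ) ≤
      2 * n + P + δ / 4 * (b - a) + (7 * R + 11) := by
  have hΔ := h.delay
  have he := hΔ.trans_le h.interval
  have hH := h.typical.honest
  have hfin : ∀ (S : Set ℝ) y, S ⊆ loners ex.H cfg.Δ → (∀ x ∈ S, x ≤ y) → S.Finite := fun S y hS hy =>
    (hH.finite y).subset fun x hx => ⟨(hS hx).1, hy x hx⟩
  set L := loners ex.H cfg.Δ with hL
  -- A loner is lost for one of three reasons: it is too close to an end point, too early, or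
  -- wasted.
  set S₁ := ⋃ y, L ∩ Set.Icc (E y - cfg.Δ) (E y) with hS₁
  set S₂ := (L ∩ Set.Ioc a b) ∩ {x | x < GST + cfg.e} with hS₂
  set S₃ := {g | g ∈ L ∧ Wasted cfg ex R g} ∩ Set.Icc (max a (GST + cfg.e)) b with hS₃
  have hsub : (L ∩ Set.Ioc a b) \ U ⊆ S₁ ∪ S₂ ∪ S₃ := by
    rintro x ⟨⟨hx, hxa, hxb⟩, hxU⟩
    rcases lt_or_ge x (GST + cfg.e) with h1 | h1
    · exact Or.inl (Or.inr ⟨⟨hx, hxa, hxb⟩, h1⟩)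
    · by_cases hw : Wasted cfg ex R x
      · exact Or.inr ⟨⟨hx, hw⟩, max_le hxa.le h1, hxb⟩
      · obtain ⟨y, hy⟩ := hU x ⟨hx, h1, hxb.trans hbT, hw⟩ hxa hxb hxU
        exact Or.inl (Or.inl (Set.mem_iUnion.2 ⟨y, hx, hy⟩))
  have hf₁ : S₁.Finite := Set.finite_iUnion fun y =>
    hfin _ (E y) Set.inter_subset_left fun x hx => hx.2.2
  have hf₂ : S₂.Finite := hfin _ b (fun x hx => hx.1.1) fun x hx => hx.1.2.2
  have hf₃ : S₃.Finite := hfin _ b (fun x hx => hx.1.1) fun x hx => hx.2.2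
  have c₁ : (S₁.ncard : ℝ) ≤ 2 * n := by
    have h1 : S₁.ncard ≤ ∑ y, (L ∩ Set.Icc (E y - cfg.Δ) (E y)).ncard := by
      have := Set.ncard_iUnion_le_of_fintype (fun y => L ∩ Set.Icc (E y - cfg.Δ) (E y))
      exact this
    have h2 : ∀ y, ((L ∩ Set.Icc (E y - cfg.Δ) (E y)).ncard : ℝ) ≤ 2 := fun y => by
      have := ncard_loners_le hH hΔ (show E y - cfg.Δ ≤ E y by linarith)
        (Set.inter_subset_left (s := L)) Set.inter_subset_right
      rw [sub_sub_cancel, div_self hΔ.ne'] at this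
      linarith
    calc (S₁.ncard : ℝ) ≤ ((∑ y, (L ∩ Set.Icc (E y - cfg.Δ) (E y)).ncard : ℕ) : ℝ) := by
          exact_mod_cast h1
      _ = ∑ y, ((L ∩ Set.Icc (E y - cfg.Δ) (E y)).ncard : ℝ) := by push_cast; rfl
      _ ≤ ∑ y : Fin n, (2 : ℝ) := Finset.sum_le_sum fun y _ => h2 y
      _ = 2 * n := by simp; ring
  have c₂ : (S₂.ncard : ℝ) ≤ P := by
    rcases lt_or_ge a (GST + cfg.e) with h1 | h1
    · have := ncard_loners_le hH hΔ (show 0 ≤ GST + cfg.e by linarith [h.gst])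
        (fun x hx => hx.1.1 : S₂ ⊆ L) (fun x hx => ⟨by linarith [hx.1.2.1], hx.2.le⟩)
      rw [sub_zero] at this
      linarith [hP.1 h1]
    · have : S₂ = ∅ := by
        ext x
        simp only [Set.mem_empty_iff_false, iff_false]
        rintro ⟨⟨-, hx, -⟩, hx2⟩
        exact absurd hx2 (not_lt.2 (h1.trans hx.le))
      rw [this]
      simpa using hP.2
  have c₃ : (S₃.ncard : ℝ) ≤ δ / 4 * (b - a) + (7 * R + 11) := by
    rcases le_or_gt (max a (GST + cfg.e)) b with h1 | h1
    · have h2 := h.ncard_wasted_le (le_max_right a (GST + cfg.e)) h1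
      have h3 : δ / 4 * (b - max a (GST + cfg.e)) ≤ δ / 4 * (b - a) :=
        mul_le_mul_of_nonneg_left (by linarith [le_max_left a (GST + cfg.e)])
          (by linarith [h.drift_pos])
      linarith
    · have : S₃ = ∅ := by rw [hS₃, Set.Icc_eq_empty (not_le.2 h1), Set.inter_empty]
      rw [this]
      have h3 : 0 ≤ δ / 4 * (b - a) := mul_nonneg (by linarith [h.drift_pos]) (by linarith)
      simp only [Set.ncard_empty, Nat.cast_zero]
      positivity
  have h1 := (Set.ncard_le_ncard hsub ((hf₁.union hf₂).union hf₃)).trans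
    ((Set.ncard_union_le _ _).trans (Nat.add_le_add_right (Set.ncard_union_le _ _) _))
  have h2 : (((L ∩ Set.Ioc a b) \ U).ncard : ℝ) ≤ S₁.ncard + S₂.ncard + S₃.ncard := by
    exact_mod_cast h1
  linarith

end Recovery

/-! ### Liveness of the finality rule -/

section Liveness

variable {Node : Type*} {cfg : Config Node} {ex : Execution Node} {GST δ r q T : ℝ} {R : ℕ}

/-- Enough time has passed since stabilization for the chains to agree again. -/
def Recovered (cfg : Config Node) (GST δ q : ℝ) (R : ℕ) (s : ℝ) : Prop :=
  2 * (q + 10 + 2 * (7 * R + 11) + 2 * ((GST + cfg.e) / cfg.Δ)) < δ * (s - (GST + cfg.e))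

theorem FinRun.recovered_mono (h : FinRun cfg ex GST δ r q T R) {s t : ℝ}
    (hs : Recovered cfg GST δ q R s) (hst : s ≤ t) : Recovered cfg GST δ q R t := by
  have := mul_le_mul_of_nonneg_left hst h.drift_pos.le
  unfold Recovered at hs ⊢
  linarith

theorem FinRun.recovered_ge (h : FinRun cfg ex GST δ r q T R) {s : ℝ}
    (hs : Recovered cfg GST δ q R s) : GST + cfg.e ≤ s := by
  have hΔ := h.delay
  have h1 : 0 ≤ (GST + cfg.e) / cfg.Δ :=
    div_nonneg (by linarith [h.gst, hΔ.trans_le h.interval]) hΔ.le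
  have h2 := h.slack_nonneg
  have h3 : 0 < δ * (s - (GST + cfg.e)) := lt_of_le_of_lt (by positivity) hs
  linarith [(pos_iff_pos_of_mul_pos h3).1 h.drift_pos]

/-- Common prefix after recovery. -/
theorem FinRun.share (h : FinRun cfg ex GST δ r q T R) {i j : Node} {s t : ℝ} {c d : Chain}
    (hs : Recovered cfg GST δ q R s) (hc : Tip cfg ex i s c) (hd : Tip cfg ex j t d)
    (hst : s ≤ t) (htT : t ≤ T) :
    Share ex (s - 2 * (q + 8 + 2 * (7 * R + 11)) / δ) c d := by
  have hΔ := h.delay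
  have hδ := h.drift_pos
  have hH := h.typical.honest
  have hG0 : 0 ≤ GST + cfg.e := by linarith [h.gst, hΔ.trans_le h.interval]
  have hs0 : 0 ≤ s := hG0.trans (h.recovered_ge hs)
  obtain ⟨t₀, t₁, ht₀, ht₀s, hst₁, ht₁, hcommon, hcount⟩ := h.climbing.fork hH
    h.typical.adv hΔ hs0 hst (hc.mined h.adm) (hd.mined h.adm)
    (fun x hx hxs => h.blk_le hc hx (by linarith) (hst.trans htT))
    (fun x hx hxs => h.blk_le hd hx (by linarith) htT)
  set G := useful cfg ex GST T R with hG
  set U := G ∩ (Set.Ioc t₀ (s - cfg.Δ) ∪ Set.Ioc s (t₁ - cfg.Δ)) with hU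
  have hUfin : U.Finite := (hH.finite T).subset fun x hx => ⟨hx.1.1.1, hx.1.2.2.1⟩
  have hmiss : ∀ x ∈ G, t₀ < x → x ≤ t₁ → x ∉ U →
      ∃ y : Fin 2, x ∈ Set.Icc (![s, t₁] y - cfg.Δ) (![s, t₁] y) := by
    intro x hx hx0 hx1 hxU
    rcases le_or_gt x (s - cfg.Δ) with h1 | h1
    · exact absurd ⟨hx, Or.inl ⟨hx0, h1⟩⟩ hxU
    rcases le_or_gt x s with h2 | h2
    · exact ⟨0, h1.le, h2⟩
    rcases le_or_gt x (t₁ - cfg.Δ) with h3 | h3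
    · exact absurd ⟨hx, Or.inr ⟨h2, h3⟩⟩ hxU
    · exact ⟨1, h3.le, hx1⟩
  rcases hcommon with rfl | ⟨hgG, h1, h2⟩
  -- Without a common useful block the window would reach from time 0 past `s`. The loners before
  -- `GST + e` cost at most `(GST + e) / Δ + 1`, which `Recovered` outweighs.
  · exfalso
    have hdiv : 0 ≤ (GST + cfg.e) / cfg.Δ := div_nonneg hG0 hΔ.le
    have hD := h.ncard_useless_le (P := (GST + cfg.e) / cfg.Δ + 1) (n := 2) ht₀
      (ht₀s.trans hst₁) (ht₁.trans htT) ⟨fun _ => le_rfl, by linarith⟩ hmiss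
    have hlen := h.typical.window_le ht₀ (ht₀s.trans hst₁) (ht₁.trans htT) hcount hUfin hD
    have h3 : δ * s ≤ δ * t₁ := mul_le_mul_of_nonneg_left hst₁ hδ.le
    have h4 : 0 ≤ δ * (GST + cfg.e) := mul_nonneg hδ.le hG0
    unfold Recovered at hs
    push_cast at hlen
    linarith
  · have hD := h.ncard_useless_le (P := 0) (n := 2) ht₀
      (ht₀s.trans hst₁) (ht₁.trans htT)
      ⟨fun hlt => absurd hlt (not_lt.2 hgG.2.1), le_rfl⟩ hmiss
    have hlen := h.typical.window_le ht₀ (ht₀s.trans hst₁) (ht₁.trans htT) hcount hUfin hD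
    refine ⟨_, h1, h2, Or.inr ⟨t₀, hH.pos _ hgG.1.1, ?_, rfl⟩⟩
    have : s - t₀ ≤ 2 * (q + 8 + 2 * (7 * R + 11)) / δ := by
      rw [le_div_iff₀ hδ]
      have h3 : δ * s ≤ δ * t₁ := mul_le_mul_of_nonneg_left hst₁ hδ.le
      push_cast at hlen
      linarith
    linarith

/-- After recovery, all honest checkpointers find the chain held by an honest leader valid. -/
theorem FinRun.valid (h : FinRun cfg ex GST δ r q T R) {n p : ℕ} {s₁ : ℝ} {ρ : Node → ℝ}
    (hR : Round cfg ex n p s₁ ρ) (hs : Recovered cfg GST δ q R s₁) (hT : s₁ + cfg.Δ ≤ T)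
    {l i : Node} (hl : l ∈ honestCkpt cfg) (hi : i ∈ honestCkpt cfg) :
    Valid cfg ex i n (ρ i) (ρ i + 2 * cfg.Δ) (ex.held l (ρ l)) := by
  have hΔ := h.delay
  have hint := h.interval
  have hadm := h.adm
  have hlh := (mem_honestCkpt.1 hl).2
  have hih := (mem_honestCkpt.1 hi).2
  have h1 := hR.ge l hl
  have h2 := hR.le l hl
  have h3 := hR.ge i hi
  have h4 := hR.le i hi
  have hge := h.recovered_ge hs
  constructor
  -- Having entered the iteration, the leader knows the preceding certificate. So its own checkpoint
  -- extends all earlier ones, and it lies at least `k`-deep in the chain held.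
  · intro m hm u hu
    obtain ⟨n, rfl⟩ : ∃ n', n = n' + 1 := ⟨n - 1, by omega⟩
    obtain ⟨j, hj, v, hv⟩ := (hR.starts l hl).ready.exists_heard hadm h.third hΔ hlh
    have hvl := h.heard_transfer hj hlh hv (t := ρ l)
      (by rw [← max_add_add_right]; exact max_le (by linarith) (by linarith))
    exact (hu.suffix_ckpt hadm h.third hΔ (hΔ.trans_le hint) hih hlh (hadm.last_ckpt l hlh (ρ l))
      ⟨n, v, by omega, hvl⟩).trans (ckpt_suffix_held_drop hadm h.third hlh)
  · have htl := tip_held hadm hlh (hR.starts l hl).online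
    have hti := tip_held hadm hih (hR.starts i hi).online
    have hℓ : 0 ≤ 2 * (q + 8 + 2 * (7 * R + 11)) / δ := by
      have := h.slack_nonneg
      have := h.drift_pos
      positivity
    -- The starting times differ by at most `Δ`, so the chains share a block with at most `k` blocks
    -- mined since; the part `k`-deep in the leader's chain lies below it.
    have hsh : Share ex (ρ l - cfg.Δ - 2 * (q + 8 + 2 * (7 * R + 11)) / δ) (ex.held l (ρ l))
        (ex.held i (ρ i)) := by
      rcases le_total (ρ l) (ρ i) with hle | hle
      · exact (h.share (h.recovered_mono hs h1) htl hti hle (by linarith)).mono (by linarith)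
      · exact (h.share (h.recovered_mono hs h3) hti htl hle (by linarith)).symm.mono (by linarith)
    refine hsh.drop_suffix h.typical.honest h.typical.adv (htl.mined hadm) ?_
    set a := ρ l - cfg.Δ - 2 * (q + 8 + 2 * (7 * R + 11)) / δ with ha
    have hρ : 0 ≤ ρ l := by linarith [h.gst]
    have h5 := h.typical.total (max a 0) (ρ l) (le_max_right _ _)
      (max_le (by linarith) hρ) (by linarith)
    have h6 : r * (ρ l - max a 0) ≤ r * (2 * (q + 8 + 2 * (7 * R + 11)) / δ + cfg.Δ) :=
      mul_le_mul_of_nonneg_left (by linarith [le_max_left a 0]) h.rate_nonneg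
    have h7 := h.depth
    exact_mod_cast (show ((blocks ex.H ex.A (max a 0) (ρ l)).ncard : ℝ) ≤ cfg.k by linarith)

/-- After recovery, an honest leader that may propose its own chain has it certified. -/
theorem FinRun.not_noCert_of_round (h : FinRun cfg ex GST δ r q T R) {n p : ℕ} {s₁ : ℝ}
    {ρ : Node → ℝ} (hR : Round cfg ex n p s₁ ρ) (hs : Recovered cfg GST δ q R s₁)
    (hT : s₁ + cfg.Δ ≤ T) (hl : ex.leader n p ∈ cfg.honest) :
    ¬ NoCert cfg ex n (s₁ + 5 * cfg.Δ) := by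
  intro hno
  have hGs : GST ≤ s₁ := by linarith [h.recovered_ge hs, h.interval, h.delay]
  have hlm : ex.leader n p ∈ honestCkpt cfg := mem_honestCkpt.2 ⟨h.adm.leader_mem n p, hl⟩
  have hf := h.leader_fresh hR hGs hno hl
  exact hno _ hl _ (h.heard_of_soft hR hGs (fun i hi =>
    (h.soft_eq_held hR hGs hl hf hi).2.2 (h.valid hR hs hT hlm hi)) _ hl)

theorem FinRun.iteration_ends (h : FinRun cfg ex GST δ r q T R) {n p₀ : ℕ} {t : ℝ}
    (ht : Recovered cfg GST δ q R t) (htT : t + span cfg R ≤ T)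
    (hready : ∃ i ∈ cfg.honest, Ready cfg ex i n p₀ t) : ¬ NoCert cfg ex n (t + span cfg R) := by
  intro hno
  have hΔ := h.delay
  have hsp : 0 ≤ span cfg R := by unfold span; positivity
  obtain ⟨p, -, s₁, ρ, hts, hsT, hR, hl⟩ := h.exists_round (h.recovered_ge ht) hready hno
    (fun p hp => h.lead n p (by linarith))
  exact h.not_noCert_of_round hR (h.recovered_mono ht hts) (by linarith) hl (hno.mono hsT)

/-- Iterations keep ending. -/
theorem FinRun.iterations_end (h : FinRun cfg ex GST δ r q T R) {n : ℕ} {t : ℝ}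
    (ht : Recovered cfg GST δ q R t) (hn : ∀ m, n = m + 1 → ¬ NoCert cfg ex m t) (j : ℕ) :
    t + (j + 1) * (cfg.e + span cfg R) ≤ T →
    ¬ NoCert cfg ex (n + j) (t + (j + 1) * (cfg.e + span cfg R)) := by
  have hΔ := h.delay
  have he := hΔ.trans_le h.interval
  have hsp : 0 ≤ span cfg R := by unfold span; positivity
  induction j with
  | zero =>
    intro hT
    simp only [Nat.cast_zero, zero_add, one_mul, add_zero] at hT ⊢
    rw [← add_assoc] at hT ⊢
    refine h.iteration_ends (p₀ := 0) (h.recovered_mono ht (by linarith)) hT ?_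
    rcases n with _ | n
    · obtain ⟨i, hi⟩ : (honestCkpt cfg).Nonempty :=
        Finset.card_pos.1 (by have := honestCkpt_card h.third; omega)
      refine ⟨i, (mem_honestCkpt.1 hi).2, ready_zero_zero.2 ?_⟩
      linarith [h.recovered_ge ht, h.gst]
    · have := hn n rfl
      unfold NoCert at this
      push Not at this
      obtain ⟨i, hi, v, hv⟩ := this
      exact ⟨i, hi, ready_zero_succ.2 ⟨v, t, hv, le_rfl⟩⟩
  | succ j ih =>
    intro hT
    push_cast at hT ⊢
    have h1 := ih (by linarith)
    unfold NoCert at h1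
    push Not at h1
    obtain ⟨i, hi, v, hv⟩ := h1
    have h2 := h.iteration_ends (p₀ := 0) (n := n + (j + 1))
      (t := t + (j + 1) * (cfg.e + span cfg R) + cfg.e)
      (h.recovered_mono ht (by nlinarith [show (0 : ℝ) ≤ j from Nat.cast_nonneg j])) (by linarith)
      ⟨i, hi, ready_zero_succ.2 ⟨v, _, hv, le_rfl⟩⟩
    rwa [show t + (j + 1) * (cfg.e + span cfg R) + cfg.e + span cfg R =
      t + ((j : ℝ) + 1 + 1) * (cfg.e + span cfg R) by ring] at h2

theorem NoCert.of_le (h : FinRun cfg ex GST δ r q T R) {m n : ℕ} {t : ℝ}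
    (hm : NoCert cfg ex m t) (hmn : m ≤ n) : NoCert cfg ex n t := by
  rcases hmn.eq_or_lt with rfl | hlt
  · exact hm
  intro i hi v hv
  have he := h.delay.trans_le h.interval
  obtain ⟨j, hj, u, hu⟩ := hv.exists_of_lt h.adm h.third h.delay he hlt hi
  exact hm j hj u (hu.mono (by linarith))

/-- If the leader of the first period of an iteration is honest, then a chain that it recently held
gets certified. -/
theorem FinRun.leader_certified (h : FinRun cfg ex GST δ r q T R) {n : ℕ} {s₁ : ℝ}
    {ρ : Node → ℝ} (hf : FirstReady cfg ex n 0 s₁ ρ) (hs : Recovered cfg GST δ q R s₁)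
    (hT : s₁ + cfg.Δ ≤ T) (hl : ex.leader n 0 ∈ cfg.honest) :
    ∃ s, s₁ ≤ s ∧ s ≤ s₁ + cfg.Δ ∧ ∀ i ∈ cfg.honest,
      HeardCert cfg ex i (s₁ + 6 * cfg.Δ) n (ex.held (ex.leader n 0) s) := by
  have hΔ := h.delay
  have hadm := h.adm
  have hGs : GST ≤ s₁ := by linarith [h.recovered_ge hs, h.interval]
  have hcert : ¬ NoCert cfg ex n (s₁ + 5 * cfg.Δ) := fun hno =>
    h.not_noCert_of_round (h.round hf hno) hs hT hl hno
  unfold NoCert at hcert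
  push Not at hcert
  obtain ⟨j, hj, v, p, hp⟩ := hcert
  have hsent := hp.sent hadm hj
  obtain ⟨j', hj', -, s', hs', hsend⟩ := hsent.honest h.third
  obtain ⟨x, -, s₀, hA, hs₀, -⟩ := sends_cert hsend
  -- A cert-vote in a later period comes at least `4Δ + 2Δ` after `s₁`, too late for a certificate
  -- heard by `s₁ + 5Δ`.
  have hp0 : p = 0 := by
    by_contra hne
    obtain ⟨j'', hj'', hc'', u, hu, hus⟩ := hA.1.ready.exists_starts_of_lt hadm h.third
      (Nat.pos_of_ne_zero hne) hj'
    have hm := mem_honestCkpt.2 ⟨hc'', hj''⟩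
    have h1 := (hf.least j'' hm).unique hu.1
    have h2 := hf.ge j'' hm
    have h3 : (1 : ℝ) ≤ p := by exact_mod_cast Nat.pos_of_ne_zero hne
    push_cast at hus
    nlinarith
  subst hp0
  obtain ⟨i, hi, -, u, hu, husend⟩ := (hsent.cert_soft hadm h.third).honest h.third
  obtain ⟨y, hy, u₀, hAu, hu₀, hsv⟩ := sends_soft husend
  simp only [Option.some.injEq] at hy
  subst hy
  obtain ⟨s, hst, hprop⟩ : ∃ s ≤ u₀ + 2 * cfg.Δ, Proposes cfg ex (ex.leader n 0) n 0 s v := by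
    rcases hadm.soft_some i hi n 0 u₀ hAu.1 v hsv with ⟨-, hk, -⟩ | ⟨-, hpn⟩
    · exact hk.proposes hadm hi hl
    · exact absurd hpn not_prevNext_zero
  obtain ⟨hAl, -, ⟨-, hv⟩ | ⟨hnf, -⟩⟩ := hprop
  swap
  · exact absurd (Or.inl rfl) hnf
  have hlm : ex.leader n 0 ∈ honestCkpt cfg := mem_honestCkpt.2 ⟨hadm.leader_mem n 0, hl⟩
  have hse := (hf.least _ hlm).unique hAl.1.1
  refine ⟨s, hse ▸ hf.ge _ hlm, hse ▸ hf.le _ hlm, fun i' hi' => hv ▸ ?_⟩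
  exact h.heard_transfer hj hi' ⟨0, hp⟩ (by rw [max_eq_left (by linarith)]; linarith)

/-- Within a bounded time a chain recently held by an honest node gets certified. -/
theorem FinRun.exists_certified (h : FinRun cfg ex GST δ r q T R) {R' : ℕ} {t : ℝ}
    (hlead : ∀ n : ℕ, n * cfg.e ≤ T + 2 * cfg.e → ∃ j < R', ex.leader (n + j) 0 ∈ cfg.honest)
    (ht : Recovered cfg GST δ q R t) (hT : t + (R' + 1) * (cfg.e + span cfg R) ≤ T) :
    ∃ l ∈ cfg.honest, ∃ s n, t ≤ s ∧ s ≤ T ∧ ∀ i ∈ cfg.honest,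
      HeardCert cfg ex i (t + (R' + 1) * (cfg.e + span cfg R)) n (ex.held l s) := by
  classical
  have hΔ := h.delay
  have he := hΔ.trans_le h.interval
  have hint := h.interval
  have hadm := h.adm
  have hsp : 7 * cfg.Δ ≤ span cfg R := by
    unfold span
    nlinarith [show (0 : ℝ) ≤ R from Nat.cast_nonneg R]
  have hge := h.recovered_ge ht
  have hex : ∃ n, NoCert cfg ex n t := by
    obtain ⟨n, hn⟩ := exists_nat_gt (t / cfg.e)
    rw [div_lt_iff₀ he] at hn
    refine ⟨n, fun i hi v hv => ?_⟩
    have := hv.le_time hadm h.third hΔ hi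
    linarith
  set n₀ := Nat.find hex with hn₀
  have hno : NoCert cfg ex n₀ t := Nat.find_spec hex
  have hpred : ∀ m, n₀ = m + 1 → ¬ NoCert cfg ex m t := fun m hm =>
    Nat.find_min hex (by omega)
  have hn₀e : ((n₀ + 1 : ℕ) : ℝ) * cfg.e ≤ T + 2 * cfg.e := by
    have htT : t ≤ T := by nlinarith [show (0 : ℝ) ≤ R' from Nat.cast_nonneg R']
    rcases hm : n₀ with _ | m
    · push_cast
      linarith [h.gst]
    · have h1 := hpred m hm
      unfold NoCert at h1
      push Not at h1
      obtain ⟨i, hi, v, hv⟩ := h1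
      have := hv.le_time hadm h.third hΔ hi
      push_cast
      linarith
  -- Iteration `n₀` may have begun before `t`. Later iterations start after `t` because `n₀` has no
  -- certificate at `t`, so the honest leader of a first period is sought from `n₀ + 1` on.
  obtain ⟨j, hj, hl⟩ := hlead (n₀ + 1) hn₀e
  rw [show n₀ + 1 + j = n₀ + j + 1 by omega] at hl
  have hjR : ((j : ℝ) + 1) ≤ R' := by exact_mod_cast hj
  have hτ : ((j : ℝ) + 1) * (cfg.e + span cfg R) + (cfg.e + span cfg R) ≤
      (R' + 1) * (cfg.e + span cfg R) := by nlinarith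
  have hj0 : 0 ≤ ((j : ℝ) + 1) * (cfg.e + span cfg R) :=
    mul_nonneg (by positivity) (by linarith)
  have hend := h.iterations_end ht hpred j (by linarith)
  unfold NoCert at hend
  push Not at hend
  obtain ⟨i, hi, v, hv⟩ := hend
  set τ := t + ((j : ℝ) + 1) * (cfg.e + span cfg R) with hτdef
  have hall : ∀ i' ∈ cfg.honest, Ready cfg ex i' (n₀ + j + 1) 0 (τ + cfg.e + cfg.Δ) := fun i' hi' =>
    h.ready_transfer hi hi' (ready_zero_succ.2 ⟨v, _, hv, le_rfl⟩) (by linarith [h.gst])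
  obtain ⟨s₁, ρ, hts, hsτ, hf⟩ := h.exists_firstReady hge (fun i' hi' u hu hr => by
    obtain ⟨j', hj', v', hv'⟩ := hr.exists_heard hadm h.third hΔ (mem_honestCkpt.1 hi').2
    exact hno.of_le h (show n₀ ≤ n₀ + j by omega) j' hj' v' (hv'.mono (by linarith))) hall
  obtain ⟨s, h1, h2, h3⟩ := h.leader_certified hf (h.recovered_mono ht hts) (by linarith) hl
  exact ⟨_, hl, s, n₀ + j + 1, hts.trans h1, by linarith,
    fun i' hi' => (h3 i' hi').mono (by linarith)⟩

/-- Chain quality after recovery. -/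
theorem FinRun.quality (h : FinRun cfg ex GST δ r q T R) {l : Node} {t s : ℝ} {c : Chain}
    (ht : Recovered cfg GST δ q R t) (hts : t ≤ s) (hsT : s ≤ T) (hc : Tip cfg ex l s c) :
    δ / 2 * (s - t) ≤ q + 4 + 2 * (7 * R + 11) +
      {g | g ∈ useful cfg ex GST T R ∧ blk ex g <:+ c ∧ t < g}.ncard := by
  have hΔ := h.delay
  have hδ := h.drift_pos
  have hH := h.typical.honest
  have hG0 : 0 ≤ GST + cfg.e := by linarith [h.gst, hΔ.trans_le h.interval]
  have hge := h.recovered_ge ht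
  obtain ⟨t₀, ht₀, ht₀t, hcount⟩ := h.climbing.quality hH h.typical.adv hΔ (r := t)
    (by linarith) (hc.mined h.adm) (fun x hx hxs => h.blk_le hc hx (by linarith) hsT)
  have hUfin : (useful cfg ex GST T R ∩ Set.Ioc t₀ (s - cfg.Δ)).Finite :=
    (hH.finite T).subset fun x hx => ⟨hx.1.1.1, hx.1.2.2.1⟩
  have hmiss : ∀ x ∈ useful cfg ex GST T R, t₀ < x → x ≤ s →
      x ∉ useful cfg ex GST T R ∩ Set.Ioc t₀ (s - cfg.Δ) →
      ∃ y : Fin 1, x ∈ Set.Icc ((fun _ => s) y - cfg.Δ) ((fun _ => s) y) := by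
    intro x hx hx0 hx1 hxU
    refine ⟨0, ?_, hx1⟩
    by_contra hlt
    push Not at hlt
    exact hxU ⟨hx, hx0, hlt.le⟩
  rcases lt_or_ge t₀ (GST + cfg.e) with hlt | hle
  · have hdiv : 0 ≤ (GST + cfg.e) / cfg.Δ := div_nonneg hG0 hΔ.le
    have hD := h.ncard_useless_le (P := (GST + cfg.e) / cfg.Δ + 1) ht₀
      (ht₀t.trans hts) hsT ⟨fun _ => le_rfl, by linarith⟩ hmiss
    have hlen := h.typical.quality_le ht₀ (ht₀t.trans hts) hsT hcount hUfin hD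
    have h3 : δ * t₀ ≤ δ * (GST + cfg.e) := mul_le_mul_of_nonneg_left hlt.le hδ.le
    have hq := h.slack_nonneg
    have hRn : (0 : ℝ) ≤ R := Nat.cast_nonneg R
    unfold Recovered at ht
    push_cast at hlen
    linarith
  · have hD := h.ncard_useless_le (P := 0) ht₀
      (ht₀t.trans hts) hsT ⟨fun hlt => absurd hlt (not_lt.2 hle), le_rfl⟩ hmiss
    have hlen := h.typical.quality_le ht₀ (ht₀t.trans hts) hsT hcount hUfin hD
    have h3 : δ * t₀ ≤ δ * t := mul_le_mul_of_nonneg_left ht₀t hδ.le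
    push_cast at hlen
    linarith

/-- Within the last `X` of the interval, a chain held by an honest node at some time after `s - X`
is certified. Chain quality applies to it, and all but its last `k` blocks become confirmed. -/
theorem FinRun.live (h : FinRun cfg ex GST δ r q T R) {R' : ℕ} {t₀ c' : ℝ}
    (hlead : ∀ n : ℕ, n * cfg.e ≤ T + 2 * cfg.e → ∃ j < R', ex.leader (n + j) 0 ∈ cfg.honest)
    (ht₀ : Recovered cfg GST δ q R t₀)
    (hc' : δ / 2 * ((R' + 1) * (cfg.e + span cfg R)) + q + 4 + 2 * (7 * R + 11) + cfg.k ≤ c') :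
    Live cfg ex (confirmedFin ex) t₀ T (δ / 2) c' := by
  have hadm := h.adm
  have hΔ := h.delay
  have hδ := h.drift_pos
  have he := hΔ.trans_le h.interval
  have hH := h.typical.honest
  have hq := h.slack_nonneg
  intro i hi t s ht hts hsT ho
  refine floor_le_natCast ?_
  set X := ((R' : ℝ) + 1) * (cfg.e + span cfg R) with hX
  -- Over intervals shorter than `X` the asserted number is not positive.
  rcases lt_or_ge (s - t) X with hlt | hge
  · have h1 : δ / 2 * (s - t) ≤ δ / 2 * X := by gcongr
    have h2 : (0 : ℝ) ≤ 2 * (7 * R + 11) + cfg.k := by positivity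
    refine le_trans ?_ (Nat.cast_nonneg _)
    linarith
  have hrt := h.recovered_mono ht₀ ht
  have hrX := h.recovered_mono hrt (show t ≤ s - X by linarith)
  obtain ⟨l, hl, s', n, hs', hsT', hheard⟩ := h.exists_certified hlead hrX (by linarith)
  rw [← hX, sub_add_cancel] at hheard
  have hs0 : 0 ≤ s' := by linarith [h.recovered_ge hrX, h.gst]
  have htip := tip_held hadm hl (h.online l hl s' hs0)
  have hqual := h.quality hrt (by linarith) hsT' htip
  set V := {g | g ∈ useful cfg ex GST T R ∧ blk ex g <:+ ex.held l s' ∧ t < g} with hV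
  have hheld : (ex.held l s').drop cfg.k <:+ ex.ckpt i s :=
    (hheard i hi).suffix_ckpt hadm h.third hΔ he hi hi (hadm.last_ckpt i hi s)
      ⟨n, _, le_rfl, hheard i hi⟩
  have hconf := h.climbing.ncard_confirmed (V := V) (c := ex.held l s') (d := cfg.k)
    (S := {b | b ∈ confirmedFin ex i s ∧ b ∉ confirmedFin ex i t ∧ HonestBlock b})
    (fun g hg => hg.1) ((hH.finite T).subset fun x hx => ⟨hx.1.1.1, hx.1.2.2.1⟩)
    (fun g hg => hg.2.1)
    (fun g hg hgd => ⟨hgd.trans hheld, fun hgs => ?_, ⟨g, true⟩, ex.base g, rfl, rfl⟩)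
    ((finite_suffixes _).subset fun b hb => hb.1)
  · have h1 : (V.ncard : ℝ) ≤ ({b | b ∈ confirmedFin ex i s ∧ b ∉ confirmedFin ex i t ∧
        HonestBlock b}.ncard : ℝ) + cfg.k := by exact_mod_cast hconf
    have h2 : δ / 2 * (s - X - t) ≤ δ / 2 * (s' - t) := by gcongr
    linarith
  · have h1 : blk ex g <:+ ex.held i t := List.IsSuffix.trans hgs (hadm.holds i hi t).2.1
    have h2 := (((hadm.holds i hi t).1).mined hadm hi).blk_time_le h1
    linarith [hg.2.2]

end Liveness

/-! ### Statistics of time slots -/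

/-- The `m`-th time slot contains exactly one election, and the next one none. -/
def Lone (H : Set ℝ) (Δ : ℝ) (m : ℕ) : Prop :=
  count H (m * Δ) ((m + 1) * Δ) = 1 ∧ count H ((m + 1) * Δ) ((m + 2) * Δ) = 0

open Classical in
/-- The number of lone slots among every other slot, `n` in all, from the `i`-th one on. -/
noncomputable def loneCount (H : Set ℝ) (Δ : ℝ) (i n : ℕ) : ℕ :=
  ((Finset.range n).filter fun j => Lone H Δ (i + 2 * j)).card

/-- In all long windows of time slots up to a horizon there are many lone slots and not too many
elections. -/
structure TypicalSlots (H A : Set ℝ) (Δ y u v : ℝ) (n₀ M : ℕ) : Prop where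
  lone : ∀ i ≤ M, ∀ n, n₀ ≤ n → n ≤ M → y * n ≤ loneCount H Δ i n
  honest : ∀ i ≤ M, ∀ n, n₀ ≤ n → n ≤ M → count H (i * Δ) ((i + 2 * n : ℕ) * Δ) ≤ u * n
  adv : ∀ i ≤ M, ∀ n, n₀ ≤ n → n ≤ M → count A (i * Δ) ((i + 2 * n : ℕ) * Δ) ≤ v * n

section Slots

variable {H A : Set ℝ} {Δ : ℝ}

theorem card_lone_window (H : Set ℝ) (Δ : ℝ) (i n : ℕ) :
    open Classical in
    ((Finset.range (2 * n)).filter fun j => Lone H Δ (i + j)).card =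
      loneCount H Δ i n + loneCount H Δ (i + 1) n := by
  classical
  unfold loneCount
  simp only [Finset.card_filter]
  induction n with
  | zero => simp
  | succ n ih =>
    rw [show 2 * (n + 1) = 2 * n + 1 + 1 by ring, Finset.sum_range_succ, Finset.sum_range_succ, ih,
      Finset.sum_range_succ, Finset.sum_range_succ, show i + (2 * n + 1) = i + 1 + 2 * n by ring]
    ring

theorem Elections.ncard_Icc_le_count (hH : Elections H) {a b : ℝ} {i j : ℕ}
    (hi : i = 0 ∨ i * Δ < a) (hj : b ≤ j * Δ) :
    (H ∩ Set.Icc a b).ncard ≤ count H (i * Δ) (j * Δ) := by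
  refine Set.ncard_le_ncard (fun x hx => ⟨hx.1, ?_, hx.2.2.trans hj⟩)
    ((hH.finite (j * Δ)).subset fun x hx => ⟨hx.1, hx.2.2⟩)
  rcases hi with rfl | hi
  · simpa using hH.pos x hx.1
  · exact hi.trans_le hx.2.1

theorem Elections.count_mono (hH : Elections H) {a b b' : ℝ} (hb : b ≤ b') :
    count H a b ≤ count H a b' :=
  Set.ncard_le_ncard (fun _ hx => ⟨hx.1, hx.2.1, hx.2.2.trans hb⟩)
    ((hH.finite b').subset fun _ hx => ⟨hx.1, hx.2.2⟩)

/-- Lone slots inside an interval contain different loners. -/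
theorem card_lone_le_loners (hH : Elections H) (hΔ : 0 < Δ) {a b : ℝ} {F : Finset ℕ}
    (hF : ∀ m ∈ F, Lone H Δ m ∧ a ≤ m * Δ ∧ (m + 1) * Δ ≤ b) :
    F.card ≤ (loners H Δ ∩ Set.Ioc a b).ncard := by
  have hex : ∀ m : ℕ, ∃ x, m ∈ F → x ∈ H ∧ m * Δ < x ∧ x ≤ (m + 1) * Δ := by
    intro m
    by_cases hm : m ∈ F
    · obtain ⟨x, hx⟩ := Set.ncard_eq_one.1 (hF m hm).1.1
      have : x ∈ H ∩ Set.Ioc (m * Δ) ((m + 1) * Δ) := hx ▸ rfl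
      exact ⟨x, fun _ => ⟨this.1, this.2.1, this.2.2⟩⟩
    · exact ⟨0, fun h => absurd h hm⟩
  choose f hf using hex
  rw [← Set.ncard_coe_finset]
  refine Set.ncard_le_ncard_of_injOn f (fun m hm => ?_) ?_
    ((hH.finite b).subset fun x hx => ⟨hx.1.1, hx.2.2⟩)
  · have h1 := hf m hm
    have h2 := hF m hm
    exact ⟨⟨h1.1, m, h1.2.1, h1.2.2, h2.1.1, h2.1.2⟩, h2.2.1.trans_lt h1.2.1, h1.2.2.trans h2.2.2⟩
  · have key : ∀ m ∈ F, ∀ m' ∈ F, f m = f m' → ¬ m < m' := by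
      intro m hm m' hm' he hlt
      have h1 := (hf m hm).2.2
      have h2 := (hf m' hm').2.1
      have h3 : ((m : ℝ) + 1) * Δ ≤ m' * Δ := by
        gcongr
        exact_mod_cast hlt
      rw [he] at h1
      linarith
    intro m hm m' hm' he
    rcases lt_trichotomy m m' with h | h | h
    · exact absurd h (key m hm m' hm' he)
    · exact h
    · exact absurd h (key m' hm' m hm he.symm)

theorem TypicalSlots.typical {y u v δ T : ℝ} {n₀ M : ℕ} (h : TypicalSlots H A Δ y u v n₀ M)
    (hH : Elections H) (hA : Elections A) (hΔ : 0 < Δ) (hδ : 0 ≤ δ) (hu : 0 ≤ u) (hv : 0 ≤ v)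
    (hy : u + v + 2 * δ * Δ ≤ 4 * y) (hM : T / Δ + n₀ + 4 ≤ M) :
    Typical H A Δ δ ((u + v) / (2 * Δ)) (4 * y * (n₀ + 2) + 6) T := by
  classical
  have hδΔ : 0 ≤ δ * Δ := mul_nonneg hδ hΔ.le
  -- the window of slots around an interval
  have window : ∀ a b, 0 ≤ a → a ≤ b → b ≤ T → ∃ i j n : ℕ, i ≤ j ∧ j ≤ i + 2 * n ∧
      2 * n ≤ j - i + 1 ∧ (i = 0 ∨ i * Δ < a) ∧ a ≤ (i + 1) * Δ ∧ b ≤ j * Δ ∧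
      (j = 0 ∨ (j - 1) * Δ < b) ∧ i + n + n₀ + 2 ≤ M := by
    intro a b ha hab hbT
    have ha' : 0 ≤ a / Δ := div_nonneg ha hΔ.le
    have hb' : 0 ≤ b / Δ := div_nonneg (ha.trans hab) hΔ.le
    have hij : ⌈a / Δ⌉₊ ≤ ⌈b / Δ⌉₊ := Nat.ceil_le_ceil (by gcongr)
    have hj : (⌈b / Δ⌉₊ : ℝ) < b / Δ + 1 := Nat.ceil_lt_add_one hb'
    have hjM : (⌈b / Δ⌉₊ : ℝ) + n₀ + 3 ≤ M := by
      have : b / Δ ≤ T / Δ := by gcongr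
      linarith
    have hjM' : ⌈b / Δ⌉₊ + n₀ + 3 ≤ M := by exact_mod_cast hjM
    -- For `a > 0` the first index is the slot containing `a`. The number of slots is rounded up to
    -- the even number `2 * n`.
    refine ⟨⌈a / Δ⌉₊ - 1, ⌈b / Δ⌉₊, (⌈b / Δ⌉₊ - (⌈a / Δ⌉₊ - 1) + 1) / 2, by omega, by omega,
      by omega, ?_, ?_, ?_, ?_, by omega⟩
    · rcases Nat.eq_zero_or_pos (⌈a / Δ⌉₊ - 1) with h0 | h0
      · exact Or.inl h0
      · right
        have : ⌈a / Δ⌉₊ - 1 < ⌈a / Δ⌉₊ := by omega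
        rw [Nat.lt_ceil, lt_div_iff₀ hΔ] at this
        exact this
    · have h1 := Nat.le_ceil (a / Δ)
      have h2 : (⌈a / Δ⌉₊ : ℝ) ≤ ((⌈a / Δ⌉₊ - 1 : ℕ) : ℝ) + 1 := by
        exact_mod_cast (by omega : ⌈a / Δ⌉₊ ≤ ⌈a / Δ⌉₊ - 1 + 1)
      have h3 := h1.trans h2
      rwa [div_le_iff₀ hΔ] at h3
    · have h1 := Nat.le_ceil (b / Δ)
      rwa [div_le_iff₀ hΔ] at h1
    · right
      rw [← lt_div_iff₀ hΔ]
      linarith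
  -- elections in a window of at least the minimal length
  have total : ∀ a b, 0 ≤ a → ∀ i j n : ℕ, j ≤ i + 2 * n → (i = 0 ∨ i * Δ < a) → b ≤ j * Δ →
      i + n + n₀ + 2 ≤ M → ((blocks H A a b).ncard : ℝ) ≤ (u + v) * (max n n₀ : ℕ) := by
    intro a b ha i j n hjn hi hj hiM
    have hle : (j : ℝ) * Δ ≤ (i + 2 * max n n₀ : ℕ) * Δ := by
      gcongr
      have := le_max_left n n₀
      omega
    have h1 := ncard_blocks_le hH hA a b
    have h2 := hH.ncard_Icc_le_count hi hj
    have h3 := hA.ncard_Icc_le_count hi hj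
    have h4 := hH.count_mono (a := i * Δ) hle
    have h5 := hA.count_mono (a := i * Δ) hle
    have h6 := h.honest i (by omega) (max n n₀) (le_max_right _ _) (by omega)
    have h7 := h.adv i (by omega) (max n n₀) (le_max_right _ _) (by omega)
    have h8 : ((blocks H A a b).ncard : ℝ) ≤ count H (i * Δ) ((i + 2 * max n n₀ : ℕ) * Δ) +
        count A (i * Δ) ((i + 2 * max n n₀ : ℕ) * Δ) := by
      exact_mod_cast h1.trans (add_le_add (h2.trans h4) (h3.trans h5))
    linarith
  have hy0 : 0 ≤ y := by linarith
  refine ⟨hH, hA, fun a b ha hab hbT => ?_, fun a b ha hab hbT => ?_⟩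
  · obtain ⟨i, j, n, hij, hjn, hnj, hi, hai, hj, hbj, hiM⟩ := window a b ha hab hbT
    have hN := total a b ha i j n hjn hi hj hiM
    have hba : b - a ≤ 2 * Δ * n := by
      have h0 : (j : ℝ) ≤ i + 2 * n := by exact_mod_cast hjn
      have h1 : (j : ℝ) * Δ ≤ (i + 2 * n) * Δ := by gcongr
      have h2 : i * Δ ≤ a := by
        rcases hi with rfl | hi
        · simpa using ha
        · exact hi.le
      linarith
    have hdel : δ * (b - a) ≤ 2 * δ * Δ * n := by
      calc δ * (b - a) ≤ δ * (2 * Δ * n) := by gcongr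
        _ = _ := by ring
    rcases lt_or_ge n n₀ with hn | hn
    · rw [max_eq_right hn.le] at hN
      have h1 : 2 * δ * Δ * n ≤ 2 * δ * Δ * n₀ := by
        have : (n : ℝ) ≤ n₀ := by exact_mod_cast hn.le
        have h2 : 0 ≤ 2 * δ * Δ := by linarith
        gcongr
      have h2 : (u + v + 2 * δ * Δ) * n₀ ≤ 4 * y * n₀ := by gcongr
      have h3 : (0 : ℝ) ≤ (loners H Δ ∩ Set.Ioc a b).ncard := Nat.cast_nonneg _
      linarith
    · rw [max_eq_left hn] at hN
      set F := ((Finset.range (2 * n)).filter fun m => Lone H Δ (i + m)).image (i + ·) with hF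
      have hFcard : F.card = loneCount H Δ i n + loneCount H Δ (i + 1) n := by
        rw [hF, Finset.card_image_of_injective _ (add_right_injective i), card_lone_window]
      -- The slots `i`, `j - 1` and, through rounding, `j` may stick out of the interval; these
      -- three account for the `6` in the slack.
      have hsub : (F \ ({i, j - 1, j} : Finset ℕ)).card ≤ (loners H Δ ∩ Set.Ioc a b).ncard := by
        refine card_lone_le_loners hH hΔ fun m hm => ?_
        simp only [hF, Finset.mem_sdiff, Finset.mem_image, Finset.mem_filter, Finset.mem_range,
          Finset.mem_insert, Finset.mem_singleton, not_or] at hm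
        obtain ⟨⟨m', ⟨hm', hlone⟩, rfl⟩, h1, h2, h3⟩ := hm
        refine ⟨hlone, hai.trans ?_, ?_⟩
        · gcongr
          exact_mod_cast (by omega : i + 1 ≤ i + m')
        · have hb1 : ((j : ℝ) - 1) * Δ < b := hbj.resolve_left (by omega)
          refine le_trans ?_ hb1.le
          gcongr
          have : ((i + m' + 2 : ℕ) : ℝ) ≤ j := by exact_mod_cast (by omega : i + m' + 2 ≤ j)
          push_cast at this ⊢
          linarith
      have h3 : F.card ≤ (F \ ({i, j - 1, j} : Finset ℕ)).card + 3 := by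
        have := Finset.card_le_card_sdiff_add_card (s := F) (t := ({i, j - 1, j} : Finset ℕ))
        have h4 := Finset.card_le_three (a := i) (b := j - 1) (c := j)
        omega
      have h4 : (loneCount H Δ i n : ℝ) + loneCount H Δ (i + 1) n ≤
          (loners H Δ ∩ Set.Ioc a b).ncard + 3 := by
        exact_mod_cast (by omega : loneCount H Δ i n + loneCount H Δ (i + 1) n ≤ _ + 3)
      have h5 := h.lone i (by omega) n hn (by omega)
      have h6 := h.lone (i + 1) (by omega) n hn (by omega)
      have h7 : (u + v + 2 * δ * Δ) * n ≤ 4 * y * n := by gcongr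
      have h8 : 0 ≤ 4 * y * (n₀ + 2) := by positivity
      linarith
  · obtain ⟨i, j, n, hij, hjn, hnj, hi, hai, hj, hbj, hiM⟩ := window a b ha hab hbT
    have hN := total a b ha i j n hjn hi hj hiM
    have hn : (n : ℝ) ≤ (b - a) / (2 * Δ) + 2 := by
      have h1 : ((2 * n : ℕ) : ℝ) + i ≤ j + 1 := by exact_mod_cast (by omega : 2 * n + i ≤ j + 1)
      have h2 : (j : ℝ) * Δ ≤ b + Δ := by
        rcases hbj with rfl | hbj
        · simpa using (by linarith : 0 ≤ b + Δ)
        · linarith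
      have h3 : (((2 * n : ℕ) : ℝ) + i) * Δ ≤ (j + 1) * Δ := by gcongr
      push_cast at h3
      rw [← sub_le_iff_le_add, le_div_iff₀ (by positivity)]
      nlinarith
    have hmax : ((max n n₀ : ℕ) : ℝ) ≤ (b - a) / (2 * Δ) + 2 + n₀ := by
      have h0 : 0 ≤ (b - a) / (2 * Δ) := div_nonneg (by linarith) (by positivity)
      rcases le_total n n₀ with hc | hc
      · rw [max_eq_right hc]; linarith
      · rw [max_eq_left hc]
        have : (0 : ℝ) ≤ n₀ := Nat.cast_nonneg _
        linarith
    have h1 : (u + v) * ((max n n₀ : ℕ) : ℝ) ≤ (u + v) * ((b - a) / (2 * Δ) + 2 + n₀) := by gcongr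
    have h2 : (u + v) * ((n₀ : ℝ) + 2) ≤ 4 * y * (n₀ + 2) := by
      gcongr
      linarith
    calc ((blocks H A a b).ncard : ℝ) ≤ (u + v) * ((b - a) / (2 * Δ) + 2 + n₀) := hN.trans h1
      _ = (u + v) / (2 * Δ) * (b - a) + (u + v) * (n₀ + 2) := by ring
      _ ≤ _ := by linarith

end Slots

/-! ### Concentration for Poisson processes -/

section Poisson

variable {Ω : Type*} [MeasurableSpace Ω] {μ : Measure Ω} {rate : ℝ≥0} {S : Ω → Set ℝ}

theorem IsPoisson.elections (h : IsPoisson μ rate S) (ω : Ω) : Elections (S ω) :=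
  ⟨h.pos ω, h.finite ω⟩

theorem hasSum_exp_mul_poisson (r : ℝ≥0) (s : ℝ) :
    HasSum (fun n : ℕ => Real.exp (-r) * (r : ℝ) ^ n / n.factorial * Real.exp (s * n))
      (Real.exp (r * (Real.exp s - 1))) := by
  have h := (NormedSpace.expSeries_div_hasSum_exp (𝔸 := ℝ) ((r : ℝ) * Real.exp s)).mul_left
    (Real.exp (-r))
  rw [← Real.exp_eq_exp_ℝ, ← Real.exp_add] at h
  have h1 : -(r : ℝ) + r * Real.exp s = r * (Real.exp s - 1) := by ring
  rw [h1] at h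
  refine h.congr_fun fun n => ?_
  rw [mul_pow, ← Real.exp_nat_mul, mul_comm s]
  ring

/-- Chernoff bound for the number of points of a Poisson process. -/
theorem IsPoisson.measure_count_ge [IsProbabilityMeasure μ] (h : IsPoisson μ rate S)
    {a b s u c : ℝ} (ha : 0 ≤ a) (hab : a ≤ b) (hs : 0 ≤ s)
    (hc : rate * (b - a) * (Real.exp s - 1) + c ≤ s * u) :
    μ {ω | u ≤ count (S ω) a b} ≤ ENNReal.ofReal (Real.exp (-c)) := by
  have hmeas : Measurable fun ω => count (S ω) a b := h.measurable a b
  set r : ℝ≥0 := rate * (b - a).toNNReal with hr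
  have hrv : (r : ℝ) = rate * (b - a) := by
    rw [hr]; push_cast; rw [Real.coe_toNNReal _ (by linarith)]
  have hsum := hasSum_exp_mul_poisson r s
  have hint' : Integrable (fun n : ℕ => Real.exp (s * n)) (poissonMeasure r) := by
    rw [integrable_poissonMeasure_iff]
    refine hsum.summable.congr fun n => ?_
    rw [Real.norm_of_nonneg (Real.exp_pos _).le]
  have hint : Integrable (fun ω => Real.exp (s * (count (S ω) a b : ℝ))) μ := by
    have h1 := hint'
    rw [← h.law a b ha hab] at h1
    exact h1.comp_measurable hmeas
  have hmgf : mgf (fun ω => (count (S ω) a b : ℝ)) μ s = Real.exp (r * (Real.exp s - 1)) := by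
    have h1 : mgf (fun ω => (count (S ω) a b : ℝ)) μ s =
        ∫ n, Real.exp (s * (n : ℕ)) ∂(μ.map fun ω => count (S ω) a b) := by
      rw [integral_map hmeas.aemeasurable .of_discrete]
      rfl
    rw [h1, h.law a b ha hab, integral_poissonMeasure]
    simp only [smul_eq_mul]
    exact hsum.tsum_eq
  have h2 := measure_ge_le_exp_mul_mgf (X := fun ω => (count (S ω) a b : ℝ)) u hs hint
  rw [hmgf, ← Real.exp_add, hrv] at h2
  rw [measureReal_def] at h2
  refine (ENNReal.le_ofReal_iff_toReal_le (measure_ne_top _ _) (Real.exp_pos _).le).2 (h2.trans ?_)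
  gcongr
  linarith

theorem IsPoisson.iIndepFun_slots (h : IsPoisson μ rate S) {Δ : ℝ} (hΔ : 0 < Δ) :
    iIndepFun (fun (n : ℕ) ω => count (S ω) (n * Δ) ((n + 1) * Δ)) μ := by
  have := h.indep (fun n => n * Δ) (by simp) fun m n hmn => by
    simp only
    gcongr
  simpa using this

theorem IsPoisson.measure_count_eq (h : IsPoisson μ rate S) {a b : ℝ} (ha : 0 ≤ a) (hab : a ≤ b)
    (k : ℕ) : μ {ω | count (S ω) a b = k} =
      ENNReal.ofReal (Real.exp (-(rate * (b - a))) * (rate * (b - a)) ^ k / k.factorial) := by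
  have h1 : μ {ω | count (S ω) a b = k} = μ.map (fun ω => count (S ω) a b) {k} := by
    rw [Measure.map_apply (h.measurable a b) (measurableSet_singleton k)]
    rfl
  rw [h1, h.law a b ha hab, poissonMeasure_singleton]
  push_cast
  rw [Real.coe_toNNReal _ (by linarith)]

/-- The probability that a slot is lone. -/
noncomputable def loneProb (x : ℝ) : ℝ := x * Real.exp (-(2 * x))

theorem IsPoisson.measure_biInter_lone (h : IsPoisson μ rate S) {Δ : ℝ} (hΔ : 0 < Δ) (i : ℕ)
    (s : Finset ℕ) : μ (⋂ j ∈ s, {ω | Lone (S ω) Δ (i + 2 * j)}) =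
      ∏ _j ∈ s, ENNReal.ofReal (loneProb (rate * Δ)) := by
  -- Being lone concerns a slot and its successor, so at every other position the pairs of slots are
  -- disjoint.
  have hinj : Function.Injective fun x : ℕ × Fin 2 => i + 2 * x.1 + x.2 := by
    rintro ⟨j, b⟩ ⟨j', b'⟩ hjb
    simp only at hjb
    have h1 := b.2
    have h2 := b'.2
    have h3 : j = j' := by omega
    subst h3
    simp only [Prod.mk.injEq, true_and]
    exact Fin.ext (by omega)
  have hind := (h.iIndepFun_slots hΔ).precomp hinj
  have hmul := hind.measure_inter_preimage_eq_mul (s ×ˢ Finset.univ)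
    (sets := fun x => {if x.2 = 0 then 1 else 0}) (fun x _ => measurableSet_singleton _)
  have hset : (⋂ j ∈ s, {ω | Lone (S ω) Δ (i + 2 * j)}) =
      ⋂ x ∈ s ×ˢ (Finset.univ : Finset (Fin 2)),
        (fun ω => count (S ω) ((i + 2 * x.1 + x.2 : ℕ) * Δ) (((i + 2 * x.1 + x.2 : ℕ) + 1) * Δ)) ⁻¹'
          {if x.2 = 0 then 1 else 0} := by
    ext ω
    simp only [Set.mem_iInter, Set.mem_ofPred_eq, Finset.mem_product, Finset.mem_univ, and_true,
      Set.mem_preimage, Set.mem_singleton_iff, Prod.forall, Lone]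
    refine forall_congr' fun j => ?_
    rw [Fin.forall_fin_two]
    simp only [Fin.val_zero, add_zero, if_true, Fin.val_one, one_ne_zero, if_false]
    rw [← imp_and]
    push_cast
    rw [show (i : ℝ) + 2 * j + 1 + 1 = i + 2 * j + 2 by ring]
  rw [hset]
  refine hmul.trans ?_
  rw [Finset.prod_product]
  refine Finset.prod_congr rfl fun j _ => ?_
  have key : ∀ (m k : ℕ), μ ((fun ω => count (S ω) (m * Δ) ((m + 1) * Δ)) ⁻¹' {k}) =
      ENNReal.ofReal (Real.exp (-(rate * Δ)) * (rate * Δ) ^ k / k.factorial) := by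
    intro m k
    have := h.measure_count_eq (a := m * Δ) (b := (m + 1) * Δ) (by positivity) (by nlinarith) k
    rw [show ((m : ℝ) + 1) * Δ - m * Δ = Δ by ring] at this
    exact this
  rw [Fin.prod_univ_two]
  simp only [Fin.val_zero, if_true, Fin.val_one, one_ne_zero, if_false]
  rw [key, key, ← ENNReal.ofReal_mul (by positivity)]
  congr 1
  simp only [pow_one, Nat.factorial_one, Nat.cast_one, div_one, pow_zero, Nat.factorial_zero,
    mul_one, loneProb]
  rw [show -(2 * ((rate : ℝ) * Δ)) = -(rate * Δ) + -(rate * Δ) by ring, Real.exp_add]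
  ring

theorem IsPoisson.measurableSet_lone (h : IsPoisson μ rate S) (Δ : ℝ) (m : ℕ) :
    MeasurableSet {ω | Lone (S ω) Δ m} :=
  ((h.measurable _ _) (measurableSet_singleton 1)).inter
    ((h.measurable _ _) (measurableSet_singleton 0))

theorem IsPoisson.measure_lone (h : IsPoisson μ rate S) {Δ : ℝ} (hΔ : 0 < Δ) (m : ℕ) :
    μ {ω | Lone (S ω) Δ m} = ENNReal.ofReal (loneProb (rate * Δ)) := by
  simpa using h.measure_biInter_lone hΔ m {0}

theorem IsPoisson.iIndepSet_lone [IsProbabilityMeasure μ] (h : IsPoisson μ rate S) {Δ : ℝ}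
    (hΔ : 0 < Δ) (i : ℕ) :
    iIndepSet (fun j => {ω | Lone (S ω) Δ (i + 2 * j)}) μ := by
  rw [iIndepSet_iff_meas_biInter fun j => h.measurableSet_lone Δ _]
  intro s
  rw [h.measure_biInter_lone hΔ]
  exact Finset.prod_congr rfl fun j _ => (h.measure_lone hΔ _).symm

/-- Hoeffding's inequality for the number of lone slots. -/
theorem IsPoisson.measure_loneCount_lt [IsProbabilityMeasure μ] (h : IsPoisson μ rate S) {Δ ε : ℝ}
    (hΔ : 0 < Δ) (hε : 0 ≤ ε) (i : ℕ) {n : ℕ} (hn : 0 < n) :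
    μ {ω | (loneCount (S ω) Δ i n : ℝ) < (loneProb (rate * Δ) - ε) * n} ≤
      ENNReal.ofReal (Real.exp (-(2 * ε ^ 2 * n))) := by
  classical
  set P := loneProb (rate * Δ) with hP
  have hP0 : 0 ≤ P := mul_nonneg (by positivity) (Real.exp_pos _).le
  set X : ℕ → Ω → ℝ := fun j => {ω | Lone (S ω) Δ (i + 2 * j)}.indicator fun _ => 1 with hX
  have hXm : ∀ j, Measurable (X j) := fun j =>
    measurable_const.indicator (h.measurableSet_lone Δ _)
  have hind : iIndepFun X μ := (h.iIndepSet_lone hΔ i).iIndepFun_indicator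
  have hmean : ∀ j, μ[X j] = P := fun j => by
    rw [hX, integral_indicator_const _ (h.measurableSet_lone Δ _), measureReal_def,
      h.measure_lone hΔ, ENNReal.toReal_ofReal hP0]
    simp
  have hsub : ∀ j, HasSubgaussianMGF (fun ω => P - X j ω) ((‖(1 : ℝ) - 0‖₊ / 2) ^ 2) μ := fun j => by
    have h1 := (hasSubgaussianMGF_of_mem_Icc (a := 0) (b := 1) (hXm j).aemeasurable
      (ae_of_all μ fun ω => ?_)).neg
    · rw [hmean j] at h1
      refine h1.congr (ae_of_all _ fun ω => ?_)
      simp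
    · simp only [hX, Set.indicator_apply]
      split_ifs <;> simp
  have hind' : iIndepFun (fun j ω => P - X j ω) μ :=
    hind.comp (fun _ x => P - x) fun _ => by fun_prop
  have h1 := HasSubgaussianMGF.measure_sum_range_ge_le_of_iIndepFun hind' (n := n)
    (fun j _ => hsub j) (ε := ε * n) (by positivity)
  have hcount : ∀ ω, (loneCount (S ω) Δ i n : ℝ) = ∑ j ∈ Finset.range n, X j ω := fun ω => by
    rw [loneCount, Finset.card_filter]
    push_cast
    refine Finset.sum_congr rfl fun j _ => ?_
    simp [hX, Set.indicator_apply]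
  -- A variable with values in `[0, 1]` is sub-Gaussian with parameter `1 / 4`.
  have hexp : -(ε * n) ^ 2 / (2 * n * (((‖(1 : ℝ) - 0‖₊ / 2) ^ 2 : ℝ≥0) : ℝ)) =
      -(2 * ε ^ 2 * n) := by
    have hn' : (n : ℝ) ≠ 0 := by positivity
    push_cast
    simp only [sub_zero, norm_one]
    field_simp
  rw [hexp] at h1
  refine (measure_mono fun ω hω => ?_).trans
    ((ENNReal.le_ofReal_iff_toReal_le (measure_ne_top _ _) (Real.exp_pos _).le).2 h1)
  simp only [Set.mem_ofPred_eq, hcount] at hω ⊢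
  rw [Finset.sum_sub_distrib]
  simp only [Finset.sum_const, Finset.card_range, nsmul_eq_mul]
  linarith

end Poisson

/-! ### Probabilities of atypical behaviour -/

section Union

variable {Ω : Type*} [MeasurableSpace Ω] {μ : Measure Ω}

theorem measure_exists_le {ι : Type*} (s : Finset ι) {E : ι → Set Ω} {b : ℝ}
    (h : ∀ i ∈ s, μ (E i) ≤ ENNReal.ofReal b) :
    μ {ω | ∃ i ∈ s, ω ∈ E i} ≤ ENNReal.ofReal (s.card * b) := by
  have h1 : {ω | ∃ i ∈ s, ω ∈ E i} = ⋃ i ∈ s, E i := by ext; simp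
  rw [h1]
  calc μ (⋃ i ∈ s, E i) ≤ ∑ i ∈ s, μ (E i) := measure_biUnion_finset_le _ _
    _ ≤ ∑ _i ∈ s, ENNReal.ofReal b := Finset.sum_le_sum h
    _ = ENNReal.ofReal (s.card * b) := by
      rw [Finset.sum_const, nsmul_eq_mul, ENNReal.ofReal_mul (by positivity), ENNReal.ofReal_natCast]

theorem measure_exists_pair_le {M N : ℕ} {P : ℕ → ℕ → Ω → Prop} {b : ℝ}
    (h : ∀ i ≤ M, ∀ n ≤ N, μ {ω | P i n ω} ≤ ENNReal.ofReal b) :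
    μ {ω | ∃ i ≤ M, ∃ n ≤ N, P i n ω} ≤ ENNReal.ofReal ((M + 1) * (N + 1) * b) := by
  have h1 := measure_exists_le (μ := μ) (Finset.range (M + 1) ×ˢ Finset.range (N + 1))
    (E := fun x => {ω | P x.1 x.2 ω}) fun x hx => by
      simp only [Finset.mem_product, Finset.mem_range] at hx
      exact h x.1 (by omega) x.2 (by omega)
  rw [Finset.card_product, Finset.card_range, Finset.card_range] at h1
  push_cast at h1
  refine (measure_mono ?_).trans h1
  rintro ω ⟨i, hi, n, hn, hP⟩
  exact ⟨(i, n), by simp only [Finset.mem_product, Finset.mem_range]; omega, hP⟩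

theorem measure_le_ofReal_add {E F G : Set Ω} {x y : ℝ} (hG : G ⊆ E ∪ F) (hx : 0 ≤ x) (hy : 0 ≤ y)
    (hE : μ E ≤ ENNReal.ofReal x) (hF : μ F ≤ ENNReal.ofReal y) :
    μ G ≤ ENNReal.ofReal (x + y) := by
  rw [ENNReal.ofReal_add hx hy]
  exact (measure_mono hG).trans ((measure_union_le _ _).trans (add_le_add hE hF))

end Union

/-- Supplies the Chernoff exponent for exceeding the mean: `exp s - 1 ≤ s + s ^ 2` for small `s`,
and `s` is chosen so that the quadratic term uses up at most half of `s * (u - x)`. -/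
theorem exists_exponent {x u : ℝ} (hx : 0 ≤ x) (hxu : x < u) :
    ∃ s c, 0 < s ∧ 0 < c ∧ x * (Real.exp s - 1) + c ≤ s * u := by
  set s := min 1 ((u - x) / (2 * (x + 1))) with hs
  have hs0 : 0 < s := lt_min one_pos (div_pos (by linarith) (by positivity))
  have hs1 : s ≤ 1 := min_le_left _ _
  have hs2 : s * (2 * (x + 1)) ≤ u - x := by
    rw [← le_div_iff₀ (by positivity)]
    exact min_le_right _ _
  have h1 := Real.abs_exp_sub_one_sub_id_le (x := s) (by rw [abs_of_pos hs0]; exact hs1)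
  have h2 := (abs_le.1 h1).2
  refine ⟨s, s * (u - x) / 2, hs0, by have := sub_pos.2 hxu; positivity, ?_⟩
  have h3 : x * (Real.exp s - 1) ≤ x * (s + s ^ 2) := by gcongr; linarith
  have h4 : s * (s * (2 * (x + 1))) ≤ s * (u - x) := by gcongr
  nlinarith [sq_nonneg s]

section Oracle

variable {Node Ω : Type*} [MeasurableSpace Ω] {cfg : Config Node} {β lam : ℝ} {μ : Measure Ω}
  {H A : Ω → Set ℝ} {L : Ω → ℕ × ℕ → Node}

theorem IsPoisson.measure_count_window_ge [IsProbabilityMeasure μ] {rate : ℝ≥0} {S : Ω → Set ℝ}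
    (h : IsPoisson μ rate S) {Δ s u c : ℝ} (hΔ : 0 < Δ) (hs : 0 ≤ s)
    (hc : rate * (2 * Δ) * (Real.exp s - 1) + c ≤ s * u) (i n : ℕ) :
    μ {ω | u * n ≤ count (S ω) (i * Δ) ((i + 2 * n : ℕ) * Δ)} ≤
      ENNReal.ofReal (Real.exp (-(c * n))) := by
  refine h.measure_count_ge (by positivity) (by push_cast; nlinarith [mul_nonneg (Nat.cast_nonneg (α := ℝ) n) hΔ.le]) hs ?_
  have := mul_le_mul_of_nonneg_left hc (Nat.cast_nonneg (α := ℝ) n)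
  push_cast
  linarith

theorem IsPoisson.measure_not_typicalSlots [IsProbabilityMeasure μ] {rate rate' : ℝ≥0}
    (hH : IsPoisson μ rate H) (hA : IsPoisson μ rate' A) {Δ ε s u s' v c : ℝ} (hΔ : 0 < Δ)
    (hε : 0 ≤ ε) (hs : 0 ≤ s) (hs' : 0 ≤ s') (hc0 : 0 ≤ c)
    (hc : rate * (2 * Δ) * (Real.exp s - 1) + c ≤ s * u)
    (hc' : rate' * (2 * Δ) * (Real.exp s' - 1) + c ≤ s' * v) (hcε : c ≤ 2 * ε ^ 2)
    {n₀ : ℕ} (hn₀ : 0 < n₀) (M : ℕ) :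
    μ {ω | ¬ TypicalSlots (H ω) (A ω) Δ (loneProb (rate * Δ) - ε) u v n₀ M} ≤
      ENNReal.ofReal ((M + 1) * (M + 1) * (3 * Real.exp (-(c * n₀)))) := by
  have hmono : ∀ n : ℕ, n₀ ≤ n → Real.exp (-(c * n)) ≤ Real.exp (-(c * n₀)) := fun n hn => by
    gcongr
  set b := Real.exp (-(c * n₀)) with hb
  have hb0 : 0 ≤ b := (Real.exp_pos _).le
  have h1 := measure_exists_pair_le (μ := μ) (M := M) (N := M) (b := 3 * b)
    (P := fun i n ω => n₀ ≤ n ∧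
      ((loneCount (H ω) Δ i n : ℝ) < (loneProb (rate * Δ) - ε) * n ∨
        u * n ≤ count (H ω) (i * Δ) ((i + 2 * n : ℕ) * Δ) ∨
        v * n ≤ count (A ω) (i * Δ) ((i + 2 * n : ℕ) * Δ))) fun i _ n _ => by
    rcases lt_or_ge n n₀ with hlt | hge
    · have : {ω | n₀ ≤ n ∧ ((loneCount (H ω) Δ i n : ℝ) < (loneProb (rate * Δ) - ε) * n ∨
        u * n ≤ count (H ω) (i * Δ) ((i + 2 * n : ℕ) * Δ) ∨
        v * n ≤ count (A ω) (i * Δ) ((i + 2 * n : ℕ) * Δ))} = ∅ := by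
        ext ω
        simp [hlt]
      rw [this]
      simp
    have e1 : μ {ω | (loneCount (H ω) Δ i n : ℝ) < (loneProb (rate * Δ) - ε) * n} ≤
        ENNReal.ofReal b := by
      refine (hH.measure_loneCount_lt hΔ hε i (hn₀.trans_le hge)).trans
        (ENNReal.ofReal_le_ofReal (le_trans ?_ (hmono n hge)))
      gcongr
    have e2 := (hH.measure_count_window_ge hΔ hs hc i n).trans
      (ENNReal.ofReal_le_ofReal (hmono n hge))
    have e3 := (hA.measure_count_window_ge hΔ hs' hc' i n).trans
      (ENNReal.ofReal_le_ofReal (hmono n hge))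
    rw [show 3 * b = b + (b + b) by ring]
    exact measure_le_ofReal_add (fun ω hω => hω.2) hb0 (by positivity) e1
      (measure_le_ofReal_add (fun ω hω => hω) hb0 hb0 e2 e3)
  refine (measure_mono fun ω hω => ?_).trans h1
  by_contra hno
  simp only [Set.mem_ofPred_eq, not_exists, not_and, not_or, not_le, not_lt] at hno
  exact hω ⟨fun i hi n hn hnM => (hno i hi n hnM hn).1,
    fun i hi n hn hnM => (hno i hi n hnM hn).2.1.le,
    fun i hi n hn hnM => (hno i hi n hnM hn).2.2.le⟩

/-! ### Runs of adversarial leaders -/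

theorem IsOracle.measure_leader_adv (h : IsOracle cfg β lam μ H A L) (hthird : HonestTwoThirds cfg)
    (q : ℕ × ℕ) : μ {ω | L ω q ∉ cfg.honest} ≤ ENNReal.ofReal (1 / 3) := by
  classical
  set B := cfg.checkpointers.filter (· ∉ cfg.honest) with hB
  have hcard : 3 * B.card < cfg.checkpointers.card := by
    have h1 : {i | i ∈ cfg.checkpointers ∧ i ∉ cfg.honest} = (B : Set Node) := by
      ext; simp [hB]
    unfold HonestTwoThirds at hthird
    rwa [h1, Set.ncard_coe_finset] at hthird
  have hsub : {ω | L ω q ∉ cfg.honest} ⊆ {ω | ∃ j ∈ B, ω ∈ {ω | L ω q = j}} := fun ω hω =>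
    ⟨L ω q, by simpa [hB] using ⟨h.leader_mem ω q, hω⟩, rfl⟩
  have hpos : (0 : ℝ) < cfg.checkpointers.card := by exact_mod_cast (by omega)
  refine (measure_mono hsub).trans ((measure_exists_le B (b := (cfg.checkpointers.card : ℝ)⁻¹)
    fun j hj => ?_).trans (ENNReal.ofReal_le_ofReal ?_))
  · rw [h.leader_law q j (Finset.mem_filter.1 hj).1, ENNReal.ofReal_inv_of_pos hpos,
      ENNReal.ofReal_natCast]
  · rw [← div_eq_mul_inv, div_le_div_iff₀ hpos (by norm_num)]
    have : (3 * B.card : ℝ) < cfg.checkpointers.card := by exact_mod_cast hcard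
    linarith

theorem IsOracle.measure_leaders_adv (h : IsOracle cfg β lam μ H A L)
    (hthird : HonestTwoThirds cfg) {R : ℕ} {g : ℕ → ℕ × ℕ} (hg : g.Injective) :
    μ {ω | ∀ m < R, L ω (g m) ∉ cfg.honest} ≤ ENNReal.ofReal ((1 / 3) ^ R) := by
  have hind := iIndepFun.precomp hg h.leader_indep
  have hmul := hind.measure_inter_preimage_eq_mul (Finset.range R)
    (sets := fun _ => cfg.honestᶜ) (fun _ _ => MeasurableSpace.measurableSet_top)
  have hset : {ω | ∀ m < R, L ω (g m) ∉ cfg.honest} =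
      ⋂ m ∈ Finset.range R, (fun ω => L ω (g m)) ⁻¹' cfg.honestᶜ := by
    ext ω
    simp
  rw [hset]
  refine hmul.trans_le ?_
  calc ∏ m ∈ Finset.range R, μ ((fun ω => L ω (g m)) ⁻¹' cfg.honestᶜ)
      ≤ ∏ _m ∈ Finset.range R, ENNReal.ofReal (1 / 3) :=
        Finset.prod_le_prod' fun m _ => h.measure_leader_adv hthird (g m)
    _ = ENNReal.ofReal ((1 / 3) ^ R) := by
        rw [Finset.prod_const, Finset.card_range, ENNReal.ofReal_pow (by norm_num)]

/-- Honest leaders turn up soon among consecutive periods and among consecutive iterations. -/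
structure TypicalLeaders (honest : Set Node) (l : ℕ × ℕ → Node) (R R' M : ℕ) : Prop where
  period : ∀ n ≤ M, ∀ p ≤ M, ∃ m < R, l (n, p + m) ∈ honest
  iteration : ∀ n ≤ M, ∃ j < R', l (n + j, 0) ∈ honest

theorem IsOracle.measure_not_typicalLeaders (h : IsOracle cfg β lam μ H A L)
    (hthird : HonestTwoThirds cfg) (R R' M : ℕ) :
    μ {ω | ¬ TypicalLeaders cfg.honest (L ω) R R' M} ≤
      ENNReal.ofReal ((M + 1) * (M + 1) * (1 / 3) ^ R + (M + 1) * (1 / 3) ^ R') := by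
  have h1 := measure_exists_pair_le (μ := μ) (M := M) (N := M)
    (P := fun n p ω => ∀ m < R, L ω (n, p + m) ∉ cfg.honest) (b := (1 / 3) ^ R)
    fun n _ p _ => h.measure_leaders_adv hthird fun x y hxy => by simpa using hxy
  have h2 := measure_exists_pair_le (μ := μ) (M := M) (N := 0)
    (P := fun n _ ω => ∀ j < R', L ω (n + j, 0) ∉ cfg.honest) (b := (1 / 3) ^ R')
    fun n _ p _ => h.measure_leaders_adv hthird fun x y hxy => by simpa using hxy
  simp only [CharP.cast_eq_zero, zero_add, mul_one] at h2
  refine measure_le_ofReal_add (fun ω hω => ?_) (by positivity) (by positivity) h1 h2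
  by_contra hno
  simp only [Set.mem_union, Set.mem_ofPred_eq, not_or, not_exists, not_and, not_forall,
    not_not] at hno
  refine hω ⟨fun n hn p hp => ?_, fun n hn => ?_⟩
  · obtain ⟨m, hm, hl⟩ := hno.1 n hn p hp
    exact ⟨m, hm, hl⟩
  · obtain ⟨m, hm, hl⟩ := hno.2 n hn 0 le_rfl
    exact ⟨m, hm, hl⟩

end Oracle

/-! ### From typical runs to security -/

section Scale

variable {Node : Type*} {cfg : Config Node} {ex : Execution Node}

theorem Live.mono {confirmed : Node → ℝ → Set Chain} {t₀ T c₁ c₁' c₂ c₂' : ℝ}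
    (h : Live cfg ex confirmed t₀ T c₁ c₁') (hc : c₂ ≤ c₁) (hc' : c₁' ≤ c₂') :
    Live cfg ex confirmed t₀ T c₂ c₂' := by
  intro i hi r s hr hrs hs ho
  refine le_trans (Int.floor_le_floor ?_) (h i hi r s hr hrs hs ho)
  have := mul_le_mul_of_nonneg_right hc (sub_nonneg.2 hrs)
  linarith

/-- The parameters leave enough room for the deviations `q` of a typical run and for the bounds `R`
and `M` on the waiting time for an honest leader and on the number of slots. -/
structure Scale (Δ e δ r q K T : ℝ) (R M : ℕ) : Prop where
  delay : 0 < Δ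
  interval : Δ ≤ e
  drift_pos : 0 < δ
  rate_nonneg : 0 ≤ r
  slack_nonneg : 0 ≤ q
  long : 2 * Δ * (7 * R + 10) ≤ e
  waste : 8 * (7 * R + 11) ≤ δ * e
  depth : r * (2 * (q + 8 + 2 * (7 * R + 11)) / δ + 3 * Δ) + q < K
  horizon : |T| / Δ + 10 ≤ M

variable {Δ e δ r q K T : ℝ} {R R' M : ℕ}

theorem Scale.live_confirmedFin (h : Scale Δ e δ r q K T R M) (hΔ : cfg.Δ = Δ) (he : cfg.e = e)
    (hK : K ≤ cfg.k) (hthird : HonestTwoThirds cfg) {l : ℕ × ℕ → Node} {GST : ℝ}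
    (hex : PartialSyncSized cfg ex l GST) (htyp : Typical ex.H ex.A Δ δ r q T)
    (hlead : TypicalLeaders cfg.honest l R R' M) {t₀ c' : ℝ}
    (ht₀ : 2 * (q + 10 + 2 * (7 * R + 11) + 2 * ((GST + e) / Δ)) < δ * (t₀ - (GST + e)))
    (hc' : δ * ((R' + 1) * e) + q + 4 + 2 * (7 * R + 11) + cfg.k ≤ c') :
    Live cfg ex (confirmedFin ex) t₀ T (δ / 2) c' := by
  subst hΔ he
  have hΔ := h.delay
  have hint := h.interval
  have he := hΔ.trans_le hint
  obtain ⟨hG, hadm, hon, hl⟩ := hex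
  have hTM : T / cfg.Δ + 10 ≤ M := by
    have h1 : T / cfg.Δ ≤ |T| / cfg.Δ := by gcongr; exact le_abs_self T
    linarith [h.horizon]
  have hT : T + 10 * cfg.Δ ≤ M * cfg.Δ := by
    have h1 := mul_le_mul_of_nonneg_right hTM hΔ.le
    rwa [add_mul, div_mul_cancel₀ _ hΔ.ne'] at h1
  have hrun : FinRun cfg ex GST δ r q T R := by
    refine ⟨⟨hadm, hthird, hΔ, hint, hG, hon⟩, htyp, h.drift_pos, h.rate_nonneg, h.slack_nonneg,
      fun n p hnp => ?_, h.long, h.waste, ?_⟩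
    · have hp0 : 0 ≤ 4 * cfg.Δ * (p : ℝ) := by positivity
      have hn0 : 0 ≤ (n : ℝ) * cfg.e := by positivity
      have hn : (n : ℝ) ≤ M := by
        have h1 : (n : ℝ) * cfg.Δ ≤ n * cfg.e := by gcongr
        have h2 : (n : ℝ) * cfg.Δ ≤ M * cfg.Δ := by linarith
        exact le_of_mul_le_mul_right h2 hΔ
      have hp : (p : ℝ) ≤ M := by
        have h1 : 0 ≤ cfg.Δ * (p : ℝ) := by positivity
        have h2 : (p : ℝ) * cfg.Δ ≤ M * cfg.Δ := by linarith
        exact le_of_mul_le_mul_right h2 hΔ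
      obtain ⟨m, hm, hl'⟩ := hlead.period n (by exact_mod_cast hn) p (by exact_mod_cast hp)
      exact ⟨m, hm, by rw [hl]; exact hl'⟩
    · have h1 := h.depth
      have h2 : r * (2 * (q + 8 + 2 * (7 * R + 11)) / δ + cfg.Δ) ≤
          r * (2 * (q + 8 + 2 * (7 * R + 11)) / δ + 3 * cfg.Δ) :=
        mul_le_mul_of_nonneg_left (by linarith) h.rate_nonneg
      linarith
  refine hrun.live (R' := R') (fun n hn => ?_) ht₀ (le_trans ?_ hc')
  · have hnM : (n : ℝ) ≤ M := by
      rcases le_or_gt (n : ℝ) 2 with h2 | h2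
      · have := div_nonneg (abs_nonneg T) hΔ.le
        linarith [h.horizon]
      · have h1 : ((n : ℝ) - 2) * cfg.Δ ≤ (n - 2) * cfg.e := by
          gcongr
        have h3 : (n : ℝ) * cfg.Δ ≤ M * cfg.Δ := by linarith
        exact le_of_mul_le_mul_right h3 hΔ
    obtain ⟨j, hj, hl'⟩ := hlead.iteration n (by exact_mod_cast hnM)
    exact ⟨j, hj, by rw [hl]; exact hl'⟩
  · have hsp : span cfg R ≤ cfg.e := by
      have h1 := h.long
      have h2 : 0 ≤ cfg.Δ * (R : ℝ) := by positivity
      unfold span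
      linarith
    have h3 : δ / 2 * (((R' : ℝ) + 1) * (cfg.e + span cfg R)) ≤
        δ / 2 * ((R' + 1) * (cfg.e + cfg.e)) := by
      have := h.drift_pos
      gcongr
    linarith

theorem Scale.security_confirmedAda (h : Scale Δ e δ r q K T R M) (hΔ : cfg.Δ = Δ) (he : cfg.e = e)
    (hK : K ≤ cfg.k) (hthird : HonestTwoThirds cfg)
    (hex : SyncUnsized cfg ex) (htyp : Typical ex.H ex.A Δ δ r q T) {depth : Node → ℕ} {D c' : ℝ}
    (hKd : ∀ i, K ≤ depth i) (hdD : ∀ i, (depth i : ℝ) ≤ D) (hc' : q + 4 + D ≤ c') :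
    Safe cfg (confirmedAda ex depth) T ∧ Live cfg ex (confirmedAda ex depth) 0 T (δ / 2) c' := by
  subst hΔ he
  have hΔ := h.delay
  have hδ := h.drift_pos
  have hr := h.rate_nonneg
  have hq := h.slack_nonneg
  have hd : r * ((q + 8) / δ + 3 * cfg.Δ) + q < K := by
    refine lt_of_le_of_lt ?_ h.depth
    have : (0 : ℝ) ≤ 7 * R + 11 := by positivity
    gcongr
    linarith
  have hrun : SyncRun cfg ex δ r q T :=
    ⟨hex, hthird, hΔ, h.interval, htyp, hδ, hr, hq, hd.trans_le hK⟩
  refine ⟨hrun.safe fun i => ?_, (hrun.live hdD hc').mono (by linarith) le_rfl⟩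
  have h1 : r * ((q + 8) / δ) ≤ r * ((q + 8) / δ + 3 * cfg.Δ) := by
    gcongr
    linarith
  linarith [hKd i]

end Scale

/-! ### Negligible functions -/

theorem superpolynomialDecay_exp_neg_rpow {c α : ℝ} (hc : 0 < c) (hα : 0 < α) :
    SuperpolynomialDecay atTop (fun κ : ℕ => (κ : ℝ)) fun κ => Real.exp (-(c * (κ : ℝ) ^ α)) := by
  intro n
  have h1 := (tendsto_rpow_mul_exp_neg_mul_atTop_nhds_zero (n / α) c hc).comp
    ((tendsto_rpow_atTop hα).comp tendsto_natCast_atTop_atTop)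
  refine h1.congr fun κ => ?_
  have hκ : (0 : ℝ) ≤ κ := Nat.cast_nonneg κ
  simp only [Function.comp_apply]
  rw [← Real.rpow_mul hκ, mul_div_cancel₀ _ hα.ne', Real.rpow_natCast, neg_mul]

/-- Since `1 / 3 ≤ exp (-1)`; the factor 3 absorbs the rounding. -/
theorem one_third_pow_floor_le (t : ℝ) :
    ((1 : ℝ) / 3) ^ ⌊t⌋₊ ≤ 3 * Real.exp (-t) := by
  have h3 : Real.exp 1 ≤ 3 := by linarith [Real.exp_one_lt_d9]
  have h1 : (1 : ℝ) / 3 ≤ Real.exp (-1) := by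
    rw [Real.exp_neg, one_div]
    exact inv_anti₀ (Real.exp_pos 1) h3
  have h2 := Nat.lt_floor_add_one t
  calc ((1 : ℝ) / 3) ^ ⌊t⌋₊ ≤ Real.exp (-1) ^ ⌊t⌋₊ := by gcongr
    _ = Real.exp (⌊t⌋₊ * -1) := by rw [← Real.exp_nat_mul]
    _ ≤ Real.exp (1 + -t) := by gcongr; linarith
    _ = Real.exp 1 * Real.exp (-t) := Real.exp_add _ _
    _ ≤ 3 * Real.exp (-t) := by gcongr

/-- The bound on the probability of an atypical run. -/
noncomputable def failure (c : ℝ) (n₀ R R' M : ℕ) : ℝ :=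
  (M + 1) * (M + 1) * (3 * Real.exp (-(c * n₀))) +
    ((M + 1) * (M + 1) * (1 / 3) ^ R + (M + 1) * (1 / 3) ^ R')

theorem failure_nonneg (c : ℝ) (n₀ R R' M : ℕ) : 0 ≤ failure c n₀ R R' M := by
  unfold failure
  positivity

theorem superpolynomialDecay_failure {c ζ η α : ℝ} (hc : 0 < c) (hζ : 0 < ζ) (hη : 0 < η)
    (hα : 0 < α) (D d : ℕ) :
    SuperpolynomialDecay atTop (fun κ : ℕ => (κ : ℝ)) fun κ =>
      failure c (⌊ζ * κ⌋₊ + 1) ⌊η * Real.sqrt κ⌋₊ ⌊(κ : ℝ) ^ α⌋₊ (D * (κ + 1) ^ d) := by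
  have e1 := superpolynomialDecay_exp_neg_rpow (mul_pos hc hζ) one_pos
  have e2 := superpolynomialDecay_exp_neg_rpow hη (show (0 : ℝ) < 1 / 2 by norm_num)
  have e3 := superpolynomialDecay_exp_neg_rpow one_pos hα
  have e := (((e1.add e2).add e3).const_mul 3).polynomial_mul
    (((Polynomial.C (D : ℝ)) * (Polynomial.X + 1) ^ d + 1) ^ 2)
  refine e.trans_abs_le fun κ => ?_
  have hκ : (0 : ℝ) ≤ κ := Nat.cast_nonneg κ
  rw [abs_of_nonneg (failure_nonneg _ _ _ _ _)]
  refine le_trans ?_ (le_abs_self _)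
  set P : ℝ := D * (κ + 1) ^ d + 1 with hP
  have hP1 : 1 ≤ P := by rw [hP]; linarith [show (0 : ℝ) ≤ D * (κ + 1) ^ d by positivity]
  simp only [Polynomial.eval_pow, Polynomial.eval_add, Polynomial.eval_mul, Polynomial.eval_C,
    Polynomial.eval_X, Polynomial.eval_one, Pi.add_apply, ← hP, Real.rpow_one, one_mul]
  have h1 : Real.exp (-(c * ((⌊ζ * κ⌋₊ + 1 : ℕ) : ℝ))) ≤ Real.exp (-(c * ζ * κ)) := by
    have := Nat.lt_floor_add_one (ζ * κ)
    have h2 := mul_le_mul_of_nonneg_left this.le hc.le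
    push_cast
    refine Real.exp_le_exp.2 ?_
    linarith
  have h2 := one_third_pow_floor_le (η * Real.sqrt κ)
  have h3 := one_third_pow_floor_le ((κ : ℝ) ^ α)
  rw [Real.sqrt_eq_rpow] at h2 ⊢
  unfold failure
  push_cast
  rw [← hP]
  push_cast at h1
  have h4 : P * ((1 : ℝ) / 3) ^ ⌊(κ : ℝ) ^ α⌋₊ ≤ P * P * (3 * Real.exp (-(κ : ℝ) ^ α)) := by
    calc P * ((1 : ℝ) / 3) ^ ⌊(κ : ℝ) ^ α⌋₊ ≤ P * (3 * Real.exp (-(κ : ℝ) ^ α)) := by gcongr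
      _ ≤ P * P * (3 * Real.exp (-(κ : ℝ) ^ α)) := by
        gcongr
        nlinarith
  calc P * P * (3 * Real.exp (-(c * (⌊ζ * κ⌋₊ + 1)))) +
        (P * P * (1 / 3) ^ ⌊η * (κ : ℝ) ^ (1 / 2 : ℝ)⌋₊ + P * (1 / 3) ^ ⌊(κ : ℝ) ^ α⌋₊)
      ≤ P * P * (3 * Real.exp (-(c * ζ * κ))) +
        (P * P * (3 * Real.exp (-(η * (κ : ℝ) ^ (1 / 2 : ℝ)))) +
          P * P * (3 * Real.exp (-(κ : ℝ) ^ α))) := by gcongr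
    _ = _ := by ring

/-! ### The choice of the constants -/

theorem Scale.slack_lt {Δ e δ r q K T : ℝ} {R M : ℕ} (h : Scale Δ e δ r q K T R M) : q < K := by
  have h1 := h.delay
  have h2 := h.drift_pos
  have h3 := h.rate_nonneg
  have h4 := h.slack_nonneg
  have h5 : 0 ≤ r * (2 * (q + 8 + 2 * (7 * R + 11)) / δ + 3 * Δ) := by positivity
  linarith [h.depth]

universe w₁ w₂

/-- In the regime of honest majority, discounted for delays, runs are typical except with
exponentially small probability. -/
theorem exists_typical {β lam Δ : ℝ} (hβ0 : 0 ≤ β) (hβ : β < 1 / 2) (hlam : 0 < lam) (hΔ : 0 < Δ)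
    (hregime : lam * Δ - convergenceRate β lam Δ < convergenceRate β lam Δ) :
    ∃ δ r c Y : ℝ, 0 < δ ∧ 0 ≤ r ∧ 0 < c ∧ 0 < Y ∧
      ∀ {Node : Type w₁} {cfg : Config Node} {Ω : Type w₂} [MeasurableSpace Ω] (μ : Measure Ω)
        [IsProbabilityMeasure μ] {H A : Ω → Set ℝ} {L : Ω → ℕ × ℕ → Node},
        IsOracle cfg β lam μ H A L → ∀ n₀ M : ℕ, 0 < n₀ → ∃ E : Set Ω,
          μ E ≤ ENNReal.ofReal ((M + 1) * (M + 1) * (3 * Real.exp (-(c * n₀)))) ∧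
          ∀ ω ∉ E, ∀ T, T / Δ + n₀ + 4 ≤ M →
            Typical (H ω) (A ω) Δ δ r (Y * (n₀ + 2) + 6) T := by
  have hx : 0 < (1 - β) * lam := mul_pos (by linarith) hlam
  have hx' : 0 ≤ β * lam := by positivity
  set ye := convergenceRate β lam Δ with hye
  -- A quarter of the margin in the regime assumption. With `ε` lost in each of the three estimates
  -- and `δ = ε / Δ`, the condition `u + v + 2 * δ * Δ ≤ 4 * y` reduces to `ye ≤ loneProb`.
  set ε := (2 * ye - lam * Δ) / 4 with hεdef
  have hε : 0 < ε := by rw [hεdef]; linarith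
  -- A convergence opportunity needs both neighbouring slots empty, a lone slot only the following
  -- one.
  have hlone : ye ≤ loneProb ((1 - β) * lam * Δ) := by
    have h0 : 0 < (1 - β) * lam * Δ := by positivity
    unfold loneProb
    rw [hye, convergenceRate]
    refine mul_le_mul_of_nonneg_left (Real.exp_le_exp.2 ?_) h0.le
    linarith
  have hlamΔ : 0 < lam * Δ := by positivity
  obtain ⟨s, c₁, hs, hc₁, h1⟩ := exists_exponent (x := (1 - β) * lam * (2 * Δ))
    (u := (1 - β) * lam * (2 * Δ) + ε) (by positivity) (by linarith)
  obtain ⟨s', c₂, hs', hc₂, h2⟩ := exists_exponent (x := β * lam * (2 * Δ))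
    (u := β * lam * (2 * Δ) + ε) (by positivity) (by linarith)
  set c := min (min c₁ c₂) (2 * ε ^ 2) with hc
  have hcc₁ : c ≤ c₁ := (min_le_left _ _).trans (min_le_left _ _)
  have hcc₂ : c ≤ c₂ := (min_le_left _ _).trans (min_le_right _ _)
  have hcε : c ≤ 2 * ε ^ 2 := min_le_right _ _
  have hc0 : 0 < c := lt_min (lt_min hc₁ hc₂) (by positivity)
  refine ⟨ε / Δ, ((1 - β) * lam * (2 * Δ) + ε + (β * lam * (2 * Δ) + ε)) / (2 * Δ), c,
    4 * (loneProb ((1 - β) * lam * Δ) - ε), by positivity, by positivity, hc0, by linarith, ?_⟩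
  intro Node cfg Ω _ μ _ H A L hO n₀ M hn₀
  have e1 : ((((1 - β) * lam).toNNReal : ℝ≥0) : ℝ) = (1 - β) * lam := Real.coe_toNNReal _ hx.le
  have e2 : (((β * lam).toNNReal : ℝ≥0) : ℝ) = β * lam := Real.coe_toNNReal _ hx'
  have h3 := hO.poisson_honest.measure_not_typicalSlots hO.poisson_adv
    (u := (1 - β) * lam * (2 * Δ) + ε) (v := β * lam * (2 * Δ) + ε) hΔ hε.le hs.le hs'.le hc0.le
    (by rw [e1]; linarith) (by rw [e2]; linarith) hcε hn₀ M
  rw [e1] at h3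
  refine ⟨_, h3, fun ω hω T hT => ?_⟩
  have h4 := not_not.1 hω
  refine h4.typical (hO.poisson_honest.elections ω) (hO.poisson_adv.elections ω) hΔ (by positivity)
    (by positivity) (by positivity) ?_ hT
  have e3 : 2 * (ε / Δ) * Δ = 2 * ε := by field_simp
  rw [e3]
  linarith

/-- The competing demands are met by orders of magnitude. `R` of order `√κ` is `O(e)`, as `long` and
`waste` require, and `o(κ)`, as `depth` requires. `R'` of order `κ ^ (1 - a)` tends to infinity
while `R' * e` stays `O(κ)`. -/
theorem exists_scale {Δ δ r Y : ℝ} (hΔ : 0 < Δ) (hδ : 0 < δ) (hr : 0 ≤ r) (hY : 0 < Y)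
    {k : ℕ → ℕ} (hk : (fun κ => (k κ : ℝ)) =Θ[atTop] fun κ : ℕ => (κ : ℝ))
    {e : ℕ → ℝ} (he : ∀ κ, 0 < e κ) (he_lower : (fun κ : ℕ => Real.sqrt κ) =O[atTop] e)
    {a : ℝ} (ha : a < 1) (he_upper : e =O[atTop] fun κ : ℕ => (κ : ℝ) ^ a)
    {T : ℕ → ℝ} (hT : ∃ d : ℕ, T =O[atTop] fun κ : ℕ => (κ : ℝ) ^ d) {a₁ : ℝ} (ha₁ : 0 < a₁) :
    ∃ (ζ η K Ce Ck : ℝ) (D d : ℕ), 0 < ζ ∧ 0 < η ∧ 0 < K ∧ K ≤ a₁ ∧ 0 < Ce ∧ 0 < Ck ∧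
      ∀ᶠ κ : ℕ in atTop, 1 ≤ κ ∧ K * κ ≤ k κ ∧ k κ ≤ Ck * κ ∧ e κ ≤ κ ∧
        (⌊(κ : ℝ) ^ (1 - a)⌋₊ + 1) * e κ ≤ Ce * κ ∧
        T κ / Δ + (⌊ζ * κ⌋₊ + 1 : ℕ) + 4 ≤ (D * (κ + 1) ^ d : ℕ) ∧
        Scale Δ (e κ) δ r (Y * ((⌊ζ * κ⌋₊ + 1 : ℕ) + 2) + 6) (K * κ) (T κ) ⌊η * Real.sqrt κ⌋₊
          (D * (κ + 1) ^ d) := by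
  obtain ⟨Ck, hCk, hk1⟩ := hk.1.exists_pos
  obtain ⟨B, hB, hk2⟩ := hk.2.exists_pos
  obtain ⟨Be, hBe, he1⟩ := he_lower.exists_pos
  obtain ⟨Ce, hCe, he2⟩ := he_upper.exists_pos
  obtain ⟨d, hT⟩ := hT
  obtain ⟨CT, hCT, hT⟩ := hT.exists_pos
  set K := min (1 / B) a₁ with hK
  have hK0 : 0 < K := lt_min (by positivity) ha₁
  have hKB : K ≤ 1 / B := min_le_left _ _
  -- The part of `depth` linear in `κ` then equals `K / 2 * κ`; the rest is of order `√κ`.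
  set ζ := K / (2 * Y * (2 * r / δ + 1)) with hζ
  have hζ0 : 0 < ζ := by positivity
  -- As `√κ / Be ≤ e`, the terms in `R` of `long` and `waste` take at most half of what is
  -- available. Large `κ` covers the constants.
  set η := min (1 / Be / (28 * Δ)) (δ * (1 / Be) / 112) with hη
  have hη0 : 0 < η := lt_min (by positivity) (by positivity)
  have hη1 : η * (28 * Δ) ≤ 1 / Be := by
    rw [← le_div_iff₀ (by positivity)]; exact min_le_left _ _
  have hη2 : η * 112 ≤ δ * (1 / Be) := by
    rw [← le_div_iff₀ (by positivity)]; exact min_le_right _ _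
  set D := ⌈CT / Δ + ζ + 10⌉₊ with hD
  have hD1 : CT / Δ + ζ + 10 ≤ D := Nat.le_ceil _
  refine ⟨ζ, η, K, 2 * Ce, Ck, D, d + 1, hζ0, hη0, hK0, min_le_right _ _, by positivity, hCk, ?_⟩
  have hsqrt : Tendsto (fun κ : ℕ => Real.sqrt κ) atTop atTop :=
    Real.tendsto_sqrt_atTop.comp tendsto_natCast_atTop_atTop
  have hpow : Tendsto (fun κ : ℕ => (κ : ℝ) ^ (1 - a)) atTop atTop :=
    (tendsto_rpow_atTop (by linarith)).comp tendsto_natCast_atTop_atTop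
  set X := (2 * r / δ + 1) * (3 * Y + 6) + r * (60 / δ + 3 * Δ) with hX
  have hX0 : 0 ≤ X := by positivity
  filter_upwards [hk1.bound, hk2.bound, he1.bound, he2.bound, hT.bound, eventually_ge_atTop 1,
    hpow.eventually_ge_atTop 1, hpow.eventually_ge_atTop Ce, hsqrt.eventually_ge_atTop 1,
    hsqrt.eventually_gt_atTop (2 * (X + r * (28 * η / δ)) / K),
    hsqrt.eventually_ge_atTop (40 * Δ * Be), hsqrt.eventually_ge_atTop (176 * Be / δ)]
    with κ hk1 hk2 he1 he2 hT hκ hp1 hp2 hs1 hs2 hs3 hs4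
  have hκ1 : (1 : ℝ) ≤ κ := by exact_mod_cast hκ
  have hκ0 : (0 : ℝ) < κ := by linarith
  set s := Real.sqrt κ with hs
  have hss : s * s = κ := Real.mul_self_sqrt hκ0.le
  have hs0 : 0 ≤ s := by linarith
  have heκ := he κ
  simp only [Real.norm_eq_abs, Nat.abs_cast, abs_of_pos heκ, abs_of_nonneg hs0,
    abs_of_nonneg (Real.rpow_nonneg hκ0.le _), abs_of_nonneg (pow_nonneg hκ0.le _)] at *
  have hse : s / Be ≤ e κ := by rw [div_le_iff₀ hBe]; linarith
  have hprod : (κ : ℝ) ^ a * (κ : ℝ) ^ (1 - a) = κ := by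
    rw [← Real.rpow_add hκ0]; norm_num
  have hpa := Real.rpow_nonneg hκ0.le a
  have hR : (⌊η * s⌋₊ : ℝ) ≤ η * s := Nat.floor_le (by positivity)
  have hR' : (⌊(κ : ℝ) ^ (1 - a)⌋₊ : ℝ) ≤ (κ : ℝ) ^ (1 - a) := Nat.floor_le (by positivity)
  have hn : (⌊ζ * κ⌋₊ : ℝ) ≤ ζ * κ := Nat.floor_le (by positivity)
  have hM : |T κ| / Δ + ζ * κ + 10 ≤ (D : ℝ) * ((κ : ℝ) + 1) ^ (d + 1) := by
    have h1 : |T κ| / Δ ≤ CT / Δ * ((κ : ℝ) + 1) ^ (d + 1) := by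
      calc |T κ| / Δ ≤ CT * (κ : ℝ) ^ d / Δ := by gcongr
        _ = CT / Δ * (κ : ℝ) ^ d := by ring
        _ ≤ CT / Δ * ((κ : ℝ) + 1) ^ (d + 1) := by
          gcongr
          calc (κ : ℝ) ^ d ≤ (κ : ℝ) ^ (d + 1) := pow_le_pow_right₀ hκ1 (Nat.le_succ d)
            _ ≤ _ := by gcongr; linarith
    have h2 : (κ : ℝ) + 1 ≤ ((κ : ℝ) + 1) ^ (d + 1) := le_self_pow₀ (by linarith) (Nat.succ_ne_zero d)
    have h3 : ζ * κ ≤ ζ * ((κ : ℝ) + 1) ^ (d + 1) := by gcongr; linarith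
    have h4 := mul_le_mul_of_nonneg_right hD1 (show 0 ≤ ((κ : ℝ) + 1) ^ (d + 1) by positivity)
    linarith
  have hTΔ : T κ / Δ ≤ |T κ| / Δ := by gcongr; exact le_abs_self _
  have hlong : 2 * Δ * (7 * (⌊η * s⌋₊ : ℝ) + 10) ≤ e κ := by
    refine le_trans ?_ hse
    have h1 : Δ * (⌊η * s⌋₊ : ℝ) ≤ Δ * (η * s) := by gcongr
    have h2 : η * (28 * Δ) * s ≤ 1 / Be * s := by gcongr
    have h3 : 40 * Δ ≤ s / Be := by rwa [le_div_iff₀ hBe]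
    have h4 : 1 / Be * s = s / Be := by ring
    linarith
  refine ⟨hκ, ?_, hk1, ?_, ?_, ?_, hΔ, ?_, hδ, hr, by positivity, hlong, ?_, ?_, ?_⟩
  · calc K * κ ≤ 1 / B * (B * k κ) := by gcongr
      _ = k κ := by field_simp
  · calc e κ ≤ Ce * (κ : ℝ) ^ a := he2
      _ ≤ (κ : ℝ) ^ (1 - a) * (κ : ℝ) ^ a := by gcongr
      _ = κ := by rw [mul_comm, hprod]
  · calc ((⌊(κ : ℝ) ^ (1 - a)⌋₊ : ℝ) + 1) * e κ
        ≤ ((κ : ℝ) ^ (1 - a) + (κ : ℝ) ^ (1 - a)) * (Ce * (κ : ℝ) ^ a) := by gcongr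
      _ = 2 * Ce * ((κ : ℝ) ^ a * (κ : ℝ) ^ (1 - a)) := by ring
      _ = 2 * Ce * κ := by rw [hprod]
  · push_cast
    linarith
  · have : 0 ≤ Δ * (⌊η * s⌋₊ : ℝ) := by positivity
    linarith
  · have h1 : δ * (s / Be) ≤ δ * e κ := by gcongr
    have h2 : η * 112 * s ≤ δ * (1 / Be) * s := by gcongr
    have h3 : 176 ≤ δ * (s / Be) := by
      rw [div_le_iff₀ hδ] at hs4
      rw [← mul_div_assoc, le_div_iff₀ hBe]
      linarith
    have h4 : δ * (1 / Be) * s = δ * (s / Be) := by ring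
    linarith
  · have hs5 : X + r * (28 * η / δ) < K / 2 * s := by
      rw [div_lt_iff₀ hK0] at hs2
      linarith
    push_cast
    calc r * (2 * (Y * ((⌊ζ * κ⌋₊ : ℝ) + 1 + 2) + 6 + 8 + 2 * (7 * ⌊η * s⌋₊ + 11)) / δ + 3 * Δ) +
          (Y * ((⌊ζ * κ⌋₊ : ℝ) + 1 + 2) + 6)
        ≤ r * (2 * (Y * (ζ * κ + 1 + 2) + 6 + 8 + 2 * (7 * (η * s) + 11)) / δ + 3 * Δ) +
          (Y * (ζ * κ + 1 + 2) + 6) := by gcongr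
      _ = ζ * (2 * Y * (2 * r / δ + 1)) / 2 * κ + (X + r * (28 * η / δ) * s) := by
        rw [hX]; ring
      _ = K / 2 * (s * s) + (X + r * (28 * η / δ) * s) := by
        rw [hζ, div_mul_cancel₀ _ (by positivity), hss]
      _ ≤ K / 2 * (s * s) + (X + r * (28 * η / δ)) * s := by
        have : X * 1 ≤ X * s := by gcongr
        linarith
      _ < K / 2 * (s * s) + K / 2 * s * s := by gcongr
      _ = K * κ := by rw [← hss]; ring
  · push_cast
    have : 0 ≤ ζ * κ := by positivity
    linarith

end CLC

/-! ### Assembly of the theorem -/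

theorem theorem1 (β lam Δ : ℝ) (hβ0 : 0 ≤ β) (hβ : β < 1 / 2) (hlam : 0 < lam) (hΔ : 0 < Δ)
    (hregime : lam * Δ - CLC.convergenceRate β lam Δ < CLC.convergenceRate β lam Δ)
    (k : ℕ → ℕ) (hk : (fun κ => (k κ : ℝ)) =Θ[atTop] fun κ : ℕ => (κ : ℝ))
    (e : ℕ → ℝ) (he : ∀ κ, 0 < e κ)
    (he_lower : (fun κ : ℕ => Real.sqrt κ) =O[atTop] e)
    (a : ℝ) (ha : a < 1) (he_upper : e =O[atTop] fun κ : ℕ => (κ : ℝ) ^ a)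
    (Tmax : ℕ → ℝ) (hT : ∃ d : ℕ, Tmax =O[atTop] fun κ : ℕ => (κ : ℝ) ^ d)
    (a₁ a₂ : ℝ) (ha₁ : 0 < a₁) :
    ∃ C c c' : ℝ, 0 < C ∧ 0 < c ∧ 0 < c' ∧ ∃ ν : ℕ → ℝ,
      SuperpolynomialDecay atTop (fun κ : ℕ => (κ : ℝ)) ν ∧
      ∀ (κ : ℕ) (Node : Type*) (cfg : CLC.Config Node),
        cfg.Δ = Δ → cfg.e = e κ → cfg.k = k κ →
        3 * {i | i ∈ cfg.checkpointers ∧ i ∉ cfg.honest}.ncard < cfg.checkpointers.card →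
      ∀ (Ω : Type*) [MeasurableSpace Ω] (μ : Measure Ω) [IsProbabilityMeasure μ]
        (H A : Ω → Set ℝ) (L : Ω → ℕ × ℕ → Node), CLC.IsOracle cfg β lam μ H A L →
        -- security of the finality rule: safety
        (∀ ω (ex : CLC.Execution Node) (GST : ℝ), ex.H = H ω → ex.A = A ω →
          CLC.PartialSyncSized cfg ex (L ω) GST →
          CLC.Safe cfg (CLC.confirmedFin ex) (Tmax κ)) ∧
        -- security of the finality rule: liveness
        μ {ω | ∃ (ex : CLC.Execution Node) (GST : ℝ), ex.H = H ω ∧ ex.A = A ω ∧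
            CLC.PartialSyncSized cfg ex (L ω) GST ∧
            ¬ CLC.Live cfg ex (CLC.confirmedFin ex) (C * (GST + κ)) (Tmax κ) c (c' * κ)}
          ≤ ENNReal.ofReal (ν κ) ∧
        -- security of the adaptive rule
        μ {ω | ∃ (ex : CLC.Execution Node) (depth : Node → ℕ), ex.H = H ω ∧ ex.A = A ω ∧
            CLC.SyncUnsized cfg ex ∧ (∀ i, a₁ * κ ≤ depth i ∧ depth i ≤ a₂ * κ) ∧
            ¬ (CLC.Safe cfg (CLC.confirmedAda ex depth) (Tmax κ) ∧
               CLC.Live cfg ex (CLC.confirmedAda ex depth) 0 (Tmax κ) c (c' * κ))}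
          ≤ ENNReal.ofReal (ν κ) ∧
        -- nested protocols, in every setting
        (∀ (ex : CLC.Execution Node) (GST : ℝ), 0 ≤ GST → CLC.Admissible cfg ex GST →
          ∀ depth : Node → ℕ, ∀ i ∈ cfg.honest, depth i ≤ cfg.k → ∀ t,
            CLC.confirmedFin ex i t ⊆ CLC.confirmedAda ex depth i t) := by
  obtain ⟨δ, r, c, Y, hδ, hr, hc, hY, htyp⟩ := CLC.exists_typical hβ0 hβ hlam hΔ hregime
  obtain ⟨ζ, η, K, Ce, Ck, D, d, hζ, hη, hK, hKa, hCe, hCk, hev⟩ :=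
    CLC.exists_scale hΔ hδ hr hY hk he he_lower ha he_upper hT ha₁
  obtain ⟨κ₀, hκ₀⟩ := eventually_atTop.1 hev
  -- The first constant makes time `C * (GST + κ)` recovered, using `q < K * κ` and `8 * (7 * R +
  -- 11) ≤ δ * e ≤ δ * κ`. For the finitely many small `κ` the trivial bound 1 is taken for `ν`.
  refine ⟨(2 * K + 20 + 2 * δ + 4 / Δ) / δ, δ / 2, δ * Ce + K + 4 + δ + Ck + |a₂|, by positivity,
    by positivity, by positivity, fun κ => if κ < κ₀ then 1 else
      CLC.failure c (⌊ζ * κ⌋₊ + 1) ⌊η * Real.sqrt κ⌋₊ ⌊(κ : ℝ) ^ (1 - a)⌋₊ (D * (κ + 1) ^ d), ?_, ?_⟩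
  · refine (CLC.superpolynomialDecay_failure hc hζ hη (sub_pos.2 ha) D d).congr' ?_
    filter_upwards [eventually_ge_atTop κ₀] with κ hκ
    rw [if_neg (not_lt.2 hκ)]
  intro κ Node cfg hcΔ hce hck hthird Ω _ μ _ H A L hO
  have hΔ' : 0 < cfg.Δ := hcΔ ▸ hΔ
  have he' : 0 < cfg.e := hce ▸ he κ
  refine ⟨fun ω ex GST _ _ hex => CLC.safe_confirmedFin hex.2.1 hthird hΔ' he' _, ?_, ?_,
    fun ex GST _ hadm depth i hi hd t => CLC.confirmedFin_subset_confirmedAda hadm hthird depth hi hd t⟩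
  all_goals
    beta_reduce
    by_cases hκ : κ < κ₀
    · rw [if_pos hκ, ENNReal.ofReal_one]
      exact prob_le_one
    rw [if_neg hκ]
    obtain ⟨hκ1, hKk, hkC, heκ, hRe, hTM, hscale⟩ := hκ₀ κ (not_lt.1 hκ)
    have hκ1 : (1 : ℝ) ≤ κ := by exact_mod_cast hκ1
    have hq := hscale.slack_lt
    have hK' : K * κ ≤ cfg.k := by rw [hck]; exact hKk
    obtain ⟨E, hE, hgood⟩ := htyp μ hO (⌊ζ * κ⌋₊ + 1) (D * (κ + 1) ^ d) (Nat.succ_pos _)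
    have hF := hO.measure_not_typicalLeaders hthird ⌊η * Real.sqrt κ⌋₊ ⌊(κ : ℝ) ^ (1 - a)⌋₊
      (D * (κ + 1) ^ d)
    refine CLC.measure_le_ofReal_add ?_ (by positivity) (by positivity) hE hF
    -- Off the two oracle events every execution is good, so the bad outcomes, quantified over all
    -- executions, lie in their union.
    rw [← Set.compl_subset_compl]
    intro ω hω
    rw [Set.compl_union] at hω
    have htypical := hgood ω hω.1 (Tmax κ) hTM
    have hlead := not_not.1 hω.2
  · rintro ⟨ex, GST, hH, hA, hex, hlive⟩
    rw [← hH, ← hA] at htypical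
    refine hlive (hscale.live_confirmedFin hcΔ hce hK' hthird hex htypical hlead ?_ ?_)
    · have hG := hex.1
      have hw := hscale.waste
      have hδe : δ * e κ ≤ δ * κ := by gcongr
      have h1 : (GST + e κ) / Δ ≤ 1 / Δ * (GST + κ) := by
        rw [one_div_mul_eq_div]; gcongr
      have h2 : δ * ((2 * K + 20 + 2 * δ + 4 / Δ) / δ * (GST + κ)) =
          (2 * K + 20 + 2 * δ) * (GST + κ) + 4 * (1 / Δ * (GST + κ)) := by
        field_simp
      have h3 : 0 ≤ K * GST := by positivity
      have h4 : 0 ≤ δ * GST := by positivity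
      have h5 : 0 < δ * κ := by positivity
      rw [mul_sub, h2]
      linarith
    · have hw := hscale.waste
      have hδe : δ * e κ ≤ δ * κ := by gcongr
      have h1 : δ * ((⌊(κ : ℝ) ^ (1 - a)⌋₊ + 1) * e κ) ≤ δ * (Ce * κ) := by gcongr
      have h2 : 0 ≤ |a₂| * κ := by positivity
      rw [hck]
      linarith
  · rintro ⟨ex, depth, hH, hA, hex, hdepth, hsec⟩
    rw [← hH, ← hA] at htypical
    refine hsec (hscale.security_confirmedAda hcΔ hce hK' hthird hex htypical
      (fun i => le_trans (by gcongr) (hdepth i).1) (fun i => (hdepth i).2) ?_)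
    have h1 : a₂ * κ ≤ |a₂| * κ := by gcongr; exact le_abs_self _
    have h2 : 0 ≤ (δ * Ce + δ + Ck) * κ := by positivity
    linarith
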